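/- Let $H^2(\mathbb{D}^2)$ be the Hardy space of the bidisk and let $\theta$ be a rational inner function on $\mathbb{D}^2$: a bounded holomorphic function on $\mathbb{D}^2$ that is a quotient of two polynomials and satisfies $|\theta|=1$ almost everywhere on $\mathbb{T}^2$ (in the sense of radial limits). Assume that $\theta$ has no univariate inner factor, that is, $\theta$ is not a product $\varphi\psi$ of inner functions on $\mathbb{D}^2$ with $\varphi$ nonconstant and depending only on $z$ or only on $w$. Let $\mathcal{K}_\theta=H^2(\mathbb{D}^2)\ominus\theta H^2(\mathbb{D}^2)$, let $S_z=P_{\mathcal{K}_\theta}M_z|_{\mathcal{K}_\theta}$ be the compression to $\mathcal{K}_\theta$ of multiplication by $z$, put $\Omega=\sigma(S_z)\setminus\sigma_e(S_z)$ and let $\Omega^*=\{\bar\lambda:\lambda\in\Omega\}$, with connected components $\Omega^*_i$. Then $S_z^*$ is a generalized Cowen--Douglas operator over $\Omega^*$: the set $\Omega^*$ is bounded and open, $\operatorname{Ran}(S_z^*-c)=\mathcal{K}_\theta$ for every $c\in\Omega^*$, the closed linear span of the spaces $\operatorname{Ker}(S_z^*-c)$, $c\in\Omega^*$, is $\mathcal{K}_\theta$,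 and $\dim\operatorname{Ker}(S_z^*-c)$ is finite, positive and constant on each $\Omega^*_i$. Moreover, $S_z$ is reducible (it has a closed subspace different from $\{0\}$ and $\mathcal{K}_\theta$ that is invariant under $S_z$ and $S_z^*$) if and only if its kernel bundle $E=E_{S_z^*}$ over $\Omega^*$, with fibres $E(c)=\operatorname{Ker}(S_z^*-c)$, is strictly reducible. Here a reducing decomposition $E=E^1\oplus E^2$ consists of two holomorphic subbundles $E^1,E^2$ of $E$ over $\Omega^*$ (the rank may differ between components), each different from the zero bundle and from $E$, such that $E^1(c)\oplus E^2(c)=E(c)$ for all $c\in\Omega^*$ and $E^1(c)\perp E^2(c')$ for all $c,c'\in\Omega^*$, including points of different components. The bundle $E$ is reducible if it has a reducing decomposition, and strictly reducible if it is reducible and, for every reducing decomposition $E=E^1\oplus E^2$ and every $i$, the restriction of $E^1$ to $\Omega^*_i$ is neither the zero bundle nor the restriction of $E$. -/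

import Mathlib

open Filter Topology MeasureTheory
open scoped ComplexConjugate InnerProductSpace lp Polynomial.Bivariate

noncomputable section

namespace Bidisk

/-- The open unit bidisk `𝔻²`. -/
def bidisk : Set (ℂ × ℂ) := Metric.ball 0 1 ×ˢ Metric.ball 0 1

/-! ### The Hardy space of the bidisk -/

/-- The Hardy space `H²(𝔻²)`: the Hilbert space of power series `∑ a_{mn} z^m w^n` with
square-summable coefficients, an element being given by its coefficients. -/
abbrev H2 : Type := lp (fun _ : ℕ × ℕ => ℂ) 2

/-- The holomorphic function on the bidisk defined by an element of `H²(𝔻²)`. -/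
def H2.toFun (f : H2) (x : ℂ × ℂ) : ℂ := ∑' k : ℕ × ℕ, f k * (x.1 ^ k.1 * x.2 ^ k.2)

theorem H2.summable (f : H2) {x : ℂ × ℂ} (hx : x ∈ bidisk) :
    Summable fun k : ℕ × ℕ => f k * (x.1 ^ k.1 * x.2 ^ k.2) := by
  obtain ⟨h1, h2⟩ := hx
  rw [mem_ball_zero_iff] at h1 h2
  have hs : Summable fun k : ℕ × ℕ => ‖x.1‖ ^ k.1 * ‖x.2‖ ^ k.2 :=
    (summable_geometric_of_lt_one (norm_nonneg _) h1).mul_of_nonneg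
      (summable_geometric_of_lt_one (norm_nonneg _) h2)
      (fun _ => by positivity) (fun _ => by positivity)
  refine Summable.of_norm_bounded (hs.mul_left ‖f‖) fun k => ?_
  rw [norm_mul, norm_mul, norm_pow, norm_pow]
  exact mul_le_mul_of_nonneg_right (lp.norm_apply_le_norm (by norm_num) f k) (by positivity)

/-- Coefficients of `z · f`. -/
def shiftCoeff (f : ℕ × ℕ → ℂ) : ℕ × ℕ → ℂ
  | (0, _) => 0
  | (m + 1, n) => f (m, n)

theorem hasSum_shiftCoeff (f : H2) :
    HasSum (fun k => ‖shiftCoeff f k‖ ^ (2 : ENNReal).toReal)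
      (‖f‖ ^ (2 : ENNReal).toReal) := by
  have h := lp.hasSum_norm (p := 2) (by norm_num) f
  have hinj : Function.Injective (fun k : ℕ × ℕ => (k.1 + 1, k.2)) := by
    rintro ⟨a, b⟩ ⟨c, d⟩ h
    simpa using h
  refine (hinj.hasSum_iff ?_).mp h
  rintro ⟨m, n⟩ hk
  cases m with
  | zero => simp [shiftCoeff]
  | succ m => exact absurd ⟨(m, n), rfl⟩ hk

/-- Multiplication by the coordinate function `z` on `H²(𝔻²)`. -/
def Mz : H2 →L[ℂ] H2 :=
  LinearMap.mkContinuous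
    { toFun := fun f => ⟨shiftCoeff f, memℓp_gen (hasSum_shiftCoeff f).summable⟩
      map_add' := fun f g => by
        ext ⟨m, n⟩
        cases m with
        | zero => exact (add_zero (0 : ℂ)).symm
        | succ m => rfl
      map_smul' := fun c f => by
        ext ⟨m, n⟩
        cases m <;> simp [shiftCoeff] }
    1 fun f => by
      rw [one_mul]
      refine le_of_eq ?_
      have h1 := lp.hasSum_norm (p := 2) (by norm_num)
        (⟨shiftCoeff f, memℓp_gen (hasSum_shiftCoeff f).summable⟩ : H2)
      have h2 := h1.unique (hasSum_shiftCoeff f)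
      exact (Real.rpow_left_inj (norm_nonneg _) (norm_nonneg _) (by norm_num)).mp h2

/-! ### Inner functions -/

/-- `θ` is an inner function on the bidisk: bounded and holomorphic, with radial boundary values
of modulus one almost everywhere on the torus. -/
structure IsInner (θ : ℂ × ℂ → ℂ) : Prop where
  holomorphic : DifferentiableOn ℂ θ bidisk
  bounded : ∃ C : ℝ, ∀ x ∈ bidisk, ‖θ x‖ ≤ C
  unimodular : ∀ᵐ t : ℝ × ℝ, ∃ c : ℂ, ‖c‖ = 1 ∧
    Tendsto (fun r : ℝ => θ (r * Complex.exp (t.1 * Complex.I), r * Complex.exp (t.2 * Complex.I)))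
      (𝓝[<] 1) (𝓝 c)

/-- A rational inner function: an inner function which on the bidisk is a quotient of two
polynomials, the denominator having no zeros in the bidisk. -/
def IsRationalInner (θ : ℂ × ℂ → ℂ) : Prop :=
  IsInner θ ∧ ∃ p q : ℂ[X][Y], ∀ x ∈ bidisk,
    p.evalEval x.1 x.2 ≠ 0 ∧ θ x = q.evalEval x.1 x.2 / p.evalEval x.1 x.2

/-- On the bidisk, `φ` depends only on `z` or only on `w`. -/
def IsUnivariate (φ : ℂ × ℂ → ℂ) : Prop :=
  (∃ g : ℂ → ℂ, ∀ x ∈ bidisk, φ x = g x.1) ∨ (∃ g : ℂ → ℂ, ∀ x ∈ bidisk, φ x = g x.2)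

/-- `θ` has a nonconstant inner factor that depends on one of the variables only. -/
def HasUnivariateInnerFactor (θ : ℂ × ℂ → ℂ) : Prop :=
  ∃ φ ψ : ℂ × ℂ → ℂ, IsInner φ ∧ IsInner ψ ∧ (∀ x ∈ bidisk, θ x = φ x * ψ x) ∧
    IsUnivariate φ ∧ ¬ ∃ c : ℂ, ∀ x ∈ bidisk, φ x = c

/-! ### The quotient module and the compressed shift -/

/-- The submodule `θ H²(𝔻²)`. -/
def thetaH2 (θ : ℂ × ℂ → ℂ) : Submodule ℂ H2 where
  carrier := {f | ∃ h : H2, ∀ x ∈ bidisk, f.toFun x = θ x * h.toFun x}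
  zero_mem' := ⟨0, fun x _ => by simp [H2.toFun]⟩
  add_mem' := by
    rintro f g ⟨a, ha⟩ ⟨b, hb⟩
    have key : ∀ u v : H2, ∀ x ∈ bidisk, (u + v).toFun x = u.toFun x + v.toFun x := by
      intro u v x hx
      simp only [H2.toFun]
      rw [← (u.summable hx).tsum_add (v.summable hx)]
      exact tsum_congr fun k => by rw [lp.coeFn_add, Pi.add_apply, add_mul]
    exact ⟨a + b, fun x hx => by rw [key f g x hx, key a b x hx, ha x hx, hb x hx, mul_add]⟩
  smul_mem' := by
    rintro c f ⟨a, ha⟩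
    have key : ∀ u : H2, ∀ x, (c • u).toFun x = c * u.toFun x := by
      intro u x
      simp only [H2.toFun]
      rw [← tsum_mul_left]
      exact tsum_congr fun k => by rw [lp.coeFn_smul, Pi.smul_apply, smul_eq_mul, mul_assoc]
    exact ⟨c • a, fun x hx => by rw [key, key, ha x hx]; ring⟩

/-- The Beurling type quotient module `K_θ = H²(𝔻²) ⊖ θ H²(𝔻²)`. -/
abbrev quotientModule (θ : ℂ × ℂ → ℂ) : Submodule ℂ H2 := (thetaH2 θ)ᗮ

/-- The compressed shift `S_z = P M_z |_{K_θ}` on `K_θ`. -/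
def Sz (θ : ℂ × ℂ → ℂ) : quotientModule θ →L[ℂ] quotientModule θ :=
  (quotientModule θ).orthogonalProjectionOnto ∘L Mz ∘L (quotientModule θ).subtypeL

/-! ### Operators, generalized Cowen-Douglas class and kernel bundles -/

section Operators

variable {H : Type*} [NormedAddCommGroup H] [InnerProductSpace ℂ H] [CompleteSpace H]

/-- `T` is reducible: there is a closed subspace, neither zero nor everything, that is invariant
under `T` and under its adjoint. -/
def IsReducible (T : H →L[ℂ] H) : Prop :=
  ∃ M : Submodule ℂ H, IsClosed (M : Set H) ∧ M ≠ ⊥ ∧ M ≠ ⊤ ∧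
    (∀ x ∈ M, T x ∈ M) ∧ ∀ x ∈ M, ContinuousLinearMap.adjoint T x ∈ M

/-- The essential spectrum. -/
def essentialSpectrum (T : H →L[ℂ] H) : Set ℂ :=
  {c | ¬ (T - c • ContinuousLinearMap.id ℂ H).IsFredholm}

/-- The fibre `Ker (T - c)` at `c` of the kernel bundle `E_T`. -/
def kernelBundle (T : H →L[ℂ] H) (c : ℂ) : Submodule ℂ H :=
  (T - c • ContinuousLinearMap.id ℂ H).ker

/-- `T` is a generalized Cowen-Douglas operator over `Ω`, that is, `T ∈ 𝔅_α(Ω)` for some family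
`α` of positive integers indexed by the connected components of `Ω`. -/
structure IsGeneralizedCowenDouglas (Ω : Set ℂ) (T : H →L[ℂ] H) : Prop where
  isOpen : IsOpen Ω
  isBounded : Bornology.IsBounded Ω
  range_eq_top : ∀ c ∈ Ω, (T - c • ContinuousLinearMap.id ℂ H).range = ⊤
  span_eq_top : (⨆ c ∈ Ω, kernelBundle T c).topologicalClosure = ⊤
  dim_constant : ∀ c₀ ∈ Ω, ∃ a : ℕ, 0 < a ∧
    ∀ c ∈ connectedComponentIn Ω c₀, Module.finrank ℂ (kernelBundle T c) = a

/-- The family of subspaces `E c`, `c ∈ Ω`, is a holomorphic subbundle of `Ω × H`: near every point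
of `Ω` it has a holomorphic frame. Its Hermitian metric is the one inherited from `H`. The rank is
constant on each connected component of `Ω` and may differ between components. -/
def IsHolomorphicSubbundle (Ω : Set ℂ) (E : ℂ → Submodule ℂ H) : Prop :=
  ∀ c₀ ∈ Ω, ∃ Δ : Set ℂ, IsOpen Δ ∧ c₀ ∈ Δ ∧ Δ ⊆ Ω ∧
    ∃ (n : ℕ) (s : Fin n → ℂ → H), (∀ i, DifferentiableOn ℂ (s i) Δ) ∧
      ∀ c ∈ Δ, LinearIndependent ℂ (fun i => s i c) ∧
        Submodule.span ℂ (Set.range fun i => s i c) = E c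

/-- `E_T = E¹ ⊕ E²` is a reducing decomposition of the kernel bundle of `T` over `Ω`.
Fibres over all pairs of points, also of different components, have to be orthogonal; equivalently,
the closed spans of `E¹` and `E²` over any two components are orthogonal. -/
structure IsReducingDecomposition (Ω : Set ℂ) (T : H →L[ℂ] H) (E₁ E₂ : ℂ → Submodule ℂ H) :
    Prop where
  holomorphic₁ : IsHolomorphicSubbundle Ω E₁
  holomorphic₂ : IsHolomorphicSubbundle Ω E₂
  disjoint : ∀ c ∈ Ω, E₁ c ⊓ E₂ c = ⊥
  sup_eq : ∀ c ∈ Ω, E₁ c ⊔ E₂ c = kernelBundle T c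
  orthogonal : ∀ c ∈ Ω, ∀ c' ∈ Ω, E₁ c ⟂ E₂ c'
  ne_zero₁ : ¬ ∀ c ∈ Ω, E₁ c = ⊥
  ne_kernelBundle₁ : ¬ ∀ c ∈ Ω, E₁ c = kernelBundle T c
  ne_zero₂ : ¬ ∀ c ∈ Ω, E₂ c = ⊥
  ne_kernelBundle₂ : ¬ ∀ c ∈ Ω, E₂ c = kernelBundle T c

/-- The kernel bundle of `T` over `Ω` is reducible. -/
def KernelBundleReducible (Ω : Set ℂ) (T : H →L[ℂ] H) : Prop :=
  ∃ E₁ E₂ : ℂ → Submodule ℂ H, IsReducingDecomposition Ω T E₁ E₂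

/-- The kernel bundle of `T` over `Ω` is strictly reducible: it is reducible, and in every reducing
decomposition `E_T = E¹ ⊕ E²` the restriction of `E¹` to each connected component of `Ω` is neither
zero nor all of `E_T`. -/
def KernelBundleStrictlyReducible (Ω : Set ℂ) (T : H →L[ℂ] H) : Prop :=
  KernelBundleReducible Ω T ∧
    ∀ E₁ E₂ : ℂ → Submodule ℂ H, IsReducingDecomposition Ω T E₁ E₂ → ∀ c₀ ∈ Ω,
      (¬ ∀ c ∈ connectedComponentIn Ω c₀, E₁ c = ⊥) ∧
      ¬ ∀ c ∈ connectedComponentIn Ω c₀, E₁ c = kernelBundle T c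

end Operators

/-- `Ω* = {conj c : c ∈ Ω}` for `Ω = σ(S_z) \ σ_e(S_z)`, the base of the kernel bundle of `S_z^*`. -/
def baseSet (θ : ℂ × ℂ → ℂ) : Set ℂ :=
  (fun c => conj c) '' (spectrum ℂ (Sz θ) \ essentialSpectrum (Sz θ))

end Bidisk
end

noncomputable section

namespace Bidisk

/-! ### Right inverses and holomorphic frames of kernels. -/

section AbstractOperators

variable {H : Type*} [NormedAddCommGroup H] [InnerProductSpace ℂ H] [CompleteSpace H]

/-! The operator theory is soft. Suppose that every `S - c` is injective and that all kernels of `S*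
- c` are finite-dimensional. Then `c ∈ Ω*` means that `S* - c` is onto with nonzero kernel
(`mem_conj_image_iff`). If `R` is a right inverse of `S* - c₀`, then `(1 - (c - c₀) R)⁻¹` moves the
kernel at `c₀` holomorphically to the kernel at `c` (`exists_frame`). If moreover the kernels over
`Ω*` span, a reducing subspace `M` cuts the bundle into its parts in `M` and `Mᗮ`, and conversely
the closed spans of the two summands are complementary reducing subspaces. Strictness comes for free
once a fibre vector orthogonal to all fibres over one component must vanish
(`cowenDouglas_and_isReducible_iff`).

For `S = S_z`, write `θ = q / p` in lowest terms. Absence of univariate factors ensures that no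
slice `q (c, ·)` with `|c| < 1` and no slice `q (·, w)` with `|w| < 1` vanishes identically; for
`|w| = 1` this follows from unimodularity and coprimality. An eigenvector of `Mz*` at `conj c` pairs
with `h` only through `h (c, ·)`, so the fibre is governed by the complement of `θ (c, ·) H²`. The
nonzero polynomial `q (c, ·)` imposes a linear recurrence on its coefficients, whence finite
dimension.

Call `c` bad if `q (c, ·)` has a zero on the unit circle. The bad set is closed of Hausdorff
dimension at most one, so its complement is dense (`dense_compl_badSet`). At a good `c` in the disk,
multiplication by `θ (c, ·)` is bounded below. Hence `S_z - c` is bounded below, and `f` orthogonal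
to the fibre at `conj c` satisfies `f (c, ·) ∈ θ (c, ·) H²`. If `f ∈ K_θ` is orthogonal to all
fibres, it is divisible by `θ` on a dense set of slices. The division theorem
`exists_powerSum_mul_eq` and the norm estimate `exists_H2_of_mul_eq` then give `f ∈ θ H²`, so `f =
0`. Thus the fibres span.

For strictness, a fibre vector at `d` has the form `f (0, w) / (1 - d z)`. If it is orthogonal to
the fibres over an open set, then for each good `z` there `θ (z, ·)` has a zero `w`, and
divisibility forces `f (0, w) = 0`. Unless `f = 0` there are countably many such `w`, each with
finitely many `z` satisfying `q (z, w) = 0`; but the good points of an open set are uncountable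
(`eq_zero_of_inner_eq_zero_on_open`). -/

theorem exists_rightInverse_of_surjective {T : H →L[ℂ] H} (hT : Function.Surjective T) :
    ∃ R : H →L[ℂ] H, T * R = 1 := by
  have hcl : IsClosed (T.ker : Set H) := T.isClosed_ker
  have : CompleteSpace T.ker := hcl.completeSpace_coe
  let A : T.kerᗮ →L[ℂ] H := T ∘L T.kerᗮ.subtypeL
  have hinj : A.ker = ⊥ := by
    rw [LinearMap.ker_eq_bot']
    rintro ⟨x, hx⟩ h
    have h1 : x ∈ T.ker := h
    have := (Submodule.isOrtho_orthogonal_right T.ker).disjoint.le_bot ⟨h1, hx⟩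
    exact Subtype.ext ((Submodule.mem_bot ℂ).1 this)
  have hsur : A.range = ⊤ := by
    rw [LinearMap.range_eq_top]
    intro y
    obtain ⟨x, rfl⟩ := hT y
    refine ⟨⟨x - T.ker.starProjection x, Submodule.sub_starProjection_mem_orthogonal x⟩, ?_⟩
    have h0 : T (T.ker.starProjection x) = 0 := Submodule.starProjection_apply_mem T.ker x
    change T (x - T.ker.starProjection x) = T x
    rw [map_sub, h0, sub_zero]
  let e := ContinuousLinearEquiv.ofBijective A hinj hsur
  refine ⟨T.kerᗮ.subtypeL ∘L (e.symm : H →L[ℂ] T.kerᗮ), ?_⟩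
  ext y
  exact e.apply_symm_apply y

theorem exists_leftInverse_of_isClosed_range {T : H →L[ℂ] H} (hT : Function.Injective T)
    (hc : IsClosed (T.range : Set H)) : ∃ L : H →L[ℂ] H, L * T = 1 := by
  have : CompleteSpace T.range := hc.completeSpace_coe
  obtain ⟨L, hL⟩ := ContinuousLinearMap.HasLeftInverse.of_injective_of_isClosed_range_of_closedComplement_range
    hT hc (Submodule.isTopCompl_orthogonal _).closedComplemented
  exact ⟨L, ContinuousLinearMap.ext hL⟩

/-- If `T R = 1` and `1 - δ R` is invertible, it maps `Ker (T - δ)` onto `Ker T`. -/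
theorem apply_eq_smul_iff_of_mul_eq_one {T R : H →L[ℂ] H} (hTR : T * R = 1) (δ : ℂ) (x : H) :
    T x = δ • x ↔ T ((1 - δ • R) x) = 0 := by
  have h : T (R x) = x := congrArg (fun A : H →L[ℂ] H => A x) hTR
  simp [h, sub_eq_zero]

/-- For `c` near `c₀` the operator `(1 - (c - c₀) R)⁻¹` is holomorphic in `c` and carries `Ker (T -
c₀)` onto `Ker (T - c)`. Since it commutes with `P`, it also preserves the fixed space `M` of `P`,
so it sends a basis of the fibre at `c₀` to a frame. Taking `P = 1` gives the whole kernel bundle.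
-/
theorem exists_frame {T R P : H →L[ℂ] H} {c₀ : ℂ}
    (hTR : (T - c₀ • ContinuousLinearMap.id ℂ H) * R = 1) (hPR : Commute P R)
    (hfin : FiniteDimensional ℂ (kernelBundle T c₀)) {M : Submodule ℂ H}
    (hM : ∀ x, x ∈ M ↔ P x = x) :
    ∃ ε > 0, (∀ c ∈ Metric.ball c₀ ε,
        Function.Surjective (T - c • ContinuousLinearMap.id ℂ H)) ∧
      ∃ (n : ℕ) (s : Fin n → ℂ → H), (∀ i, DifferentiableOn ℂ (s i) (Metric.ball c₀ ε)) ∧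
      ∀ c ∈ Metric.ball c₀ ε, LinearIndependent ℂ (fun i => s i c) ∧
        Submodule.span ℂ (Set.range fun i => s i c) = M ⊓ kernelBundle T c := by
  obtain ⟨ε, hε, hU⟩ : ∃ ε > 0, ∀ c ∈ Metric.ball c₀ ε, IsUnit (1 - (c - c₀) • R) := by
    have hcont : Continuous fun c : ℂ => 1 - (c - c₀) • R := by fun_prop
    have : {c | IsUnit (1 - (c - c₀) • R)} ∈ 𝓝 c₀ :=
      (Units.isOpen.preimage hcont).mem_nhds (by simp)
    exact Metric.mem_nhds_iff.1 this
  have := hfin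
  have : FiniteDimensional ℂ ↥(M ⊓ kernelBundle T c₀) :=
    Submodule.finiteDimensional_of_le inf_le_right
  let b := Module.finBasis ℂ ↥(M ⊓ kernelBundle T c₀)
  have key : ∀ c x, x ∈ kernelBundle T c ↔
      (1 - (c - c₀) • R) x ∈ kernelBundle T c₀ := by
    intro c x
    have := apply_eq_smul_iff_of_mul_eq_one hTR (c - c₀) x
    simp only [kernelBundle, LinearMap.mem_ker]
    change (T - c • ContinuousLinearMap.id ℂ H) x = 0 ↔
      (T - c₀ • ContinuousLinearMap.id ℂ H) ((1 - (c - c₀) • R) x) = 0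
    rw [← this]
    simp [sub_smul, sub_eq_zero]
  have inv_mul : ∀ c ∈ Metric.ball c₀ ε, ∀ x,
      Ring.inverse (1 - (c - c₀) • R) ((1 - (c - c₀) • R) x) = x := fun c hc x =>
    congrArg (fun A : H →L[ℂ] H => A x) (Ring.inverse_mul_cancel _ (hU c hc))
  have mul_inv : ∀ c ∈ Metric.ball c₀ ε, ∀ x,
      (1 - (c - c₀) • R) (Ring.inverse (1 - (c - c₀) • R) x) = x := fun c hc x =>
    congrArg (fun A : H →L[ℂ] H => A x) (Ring.mul_inverse_cancel _ (hU c hc))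
  have hPc : ∀ c : ℂ, Commute P (1 - (c - c₀) • R) := fun c =>
    (Commute.one_right P).sub_right (hPR.smul_right _)
  have hMc : ∀ c ∈ Metric.ball c₀ ε, ∀ x, x ∈ M ↔ (1 - (c - c₀) • R) x ∈ M := by
    intro c hc x
    have h1 : P ((1 - (c - c₀) • R) x) = (1 - (c - c₀) • R) (P x) :=
      congrArg (fun A : H →L[ℂ] H => A x) (hPc c).eq
    rw [hM, hM, h1]
    refine ⟨fun h => by rw [h], fun h => ?_⟩
    have := congrArg (Ring.inverse (1 - (c - c₀) • R) : H →L[ℂ] H) h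
    rwa [inv_mul c hc, inv_mul c hc] at this
  refine ⟨ε, hε, fun c hc y => ?_, Module.finrank ℂ ↥(M ⊓ kernelBundle T c₀),
    fun i c => (Ring.inverse (1 - (c - c₀) • R) : H →L[ℂ] H) (b i : H), fun i => ?_,
    fun c hc => ⟨?_, ?_⟩⟩
  · refine ⟨R (Ring.inverse (1 - (c - c₀) • R) y), ?_⟩
    have h1 : ∀ x, (T - c₀ • ContinuousLinearMap.id ℂ H) (R x) = x := fun x =>
      congrArg (fun A : H →L[ℂ] H => A x) hTR
    have h2 : (T - c • ContinuousLinearMap.id ℂ H) = (T - c₀ • ContinuousLinearMap.id ℂ H)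
        - (c - c₀) • ContinuousLinearMap.id ℂ H := by
      rw [sub_smul]; abel
    rw [h2, sub_apply, h1]
    have := mul_inv c hc y
    simpa using this
  · have h1 : DifferentiableOn ℂ (fun c : ℂ => 1 - (c - c₀) • R) (Metric.ball c₀ ε) := by
      fun_prop
    have h2 : DifferentiableOn ℂ (fun c : ℂ => Ring.inverse (1 - (c - c₀) • R))
        (Metric.ball c₀ ε) := by
      intro c hc
      obtain ⟨u, hu⟩ := hU c hc
      have h3 := differentiableAt_inverse (𝕜 := ℂ) u.isUnit
      rw [hu] at h3
      exact h3.comp_differentiableWithinAt c (h1 c hc)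
    exact h2.clm_apply (differentiableOn_const _)
  · have hli : LinearIndependent ℂ fun i => (b i : H) :=
      b.linearIndependent.map' (Submodule.subtype _) (Submodule.ker_subtype _)
    refine hli.map' (Ring.inverse (1 - (c - c₀) • R) : H →L[ℂ] H).toLinearMap ?_
    rw [LinearMap.ker_eq_bot']
    intro x hx
    have := mul_inv c hc x
    rw [show Ring.inverse (1 - (c - c₀) • R) x = 0 from hx, map_zero] at this
    exact this.symm
  · have h1 : (Set.range fun i => (Ring.inverse (1 - (c - c₀) • R) : H →L[ℂ] H) (b i : H)) =
        (Ring.inverse (1 - (c - c₀) • R) : H →L[ℂ] H).toLinearMap ''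
          ((Submodule.subtype _) '' (Set.range b)) := by
      rw [← Set.range_comp, ← Set.range_comp]; rfl
    rw [h1, Submodule.span_image, Submodule.span_image, b.span_eq, Submodule.map_top,
      Submodule.range_subtype]
    ext x
    simp only [Submodule.mem_map, Submodule.mem_inf]
    constructor
    · rintro ⟨y, ⟨hy1, hy2⟩, rfl⟩
      rw [hMc c hc, key]
      have := mul_inv c hc y
      exact ⟨by simpa [this] using hy1, by simpa [this] using hy2⟩
    · rintro ⟨hx1, hx2⟩
      exact ⟨_, ⟨(hMc c hc x).1 hx1, (key c x).1 hx2⟩, inv_mul c hc x⟩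

end AbstractOperators

/-! ### Cowen–Douglas property and reducibility for an abstract operator. -/

section AbstractTheorem

variable {H : Type*} [NormedAddCommGroup H] [InnerProductSpace ℂ H] [CompleteSpace H]

theorem adjoint_sub_smul_id (S : H →L[ℂ] H) (c : ℂ) :
    ContinuousLinearMap.adjoint (S - c • ContinuousLinearMap.id ℂ H) =
      ContinuousLinearMap.adjoint S - conj c • ContinuousLinearMap.id ℂ H := by
  have h : ContinuousLinearMap.adjoint (ContinuousLinearMap.id ℂ H) =
      ContinuousLinearMap.id ℂ H := ContinuousLinearMap.star_eq_adjoint (1 : H →L[ℂ] H) ▸ star_one _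
  rw [map_sub, map_smulₛₗ, h]

theorem mem_spectrum_iff_not_isUnit_sub (S : H →L[ℂ] H) (c : ℂ) :
    c ∈ spectrum ℂ S ↔ ¬ IsUnit (S - c • ContinuousLinearMap.id ℂ H) := by
  rw [spectrum.mem_iff, ← IsUnit.neg_iff, neg_sub, Algebra.algebraMap_eq_smul_one]
  rfl

/-- Description of `Ω*` when all `S - c` are injective with finite-dimensional cokernel. -/
theorem mem_conj_image_iff {S : H →L[ℂ] H}
    (hinj : ∀ c : ℂ, Function.Injective (S - c • ContinuousLinearMap.id ℂ H))
    (hfin : ∀ c, FiniteDimensional ℂ (kernelBundle (ContinuousLinearMap.adjoint S) c)) (c : ℂ) :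
    c ∈ (fun c => conj c) '' (spectrum ℂ S \ essentialSpectrum S) ↔
      Function.Surjective
        (ContinuousLinearMap.adjoint S - c • ContinuousLinearMap.id ℂ H) ∧
      kernelBundle (ContinuousLinearMap.adjoint S) c ≠ ⊥ := by
  have hadj := adjoint_sub_smul_id S (conj c)
  rw [Complex.conj_conj] at hadj
  set A := S - conj c • ContinuousLinearMap.id ℂ H with hA
  have hmem : c ∈ (fun c => conj c) '' (spectrum ℂ S \ essentialSpectrum S) ↔
      ¬ IsUnit A ∧ A.IsFredholm := by
    constructor
    · rintro ⟨l, ⟨h1, h2⟩, rfl⟩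
      rw [mem_spectrum_iff_not_isUnit_sub] at h1
      simp only [Complex.conj_conj] at hA
      rw [essentialSpectrum, Set.mem_ofPred_eq, not_not] at h2
      rw [hA]
      exact ⟨h1, h2⟩
    · rintro ⟨h1, h2⟩
      refine ⟨conj c, ⟨(mem_spectrum_iff_not_isUnit_sub _ _).2 h1, ?_⟩, Complex.conj_conj c⟩
      rw [essentialSpectrum, Set.mem_ofPred_eq, not_not]
      exact h2
  have hunit : IsUnit A ↔ IsUnit (ContinuousLinearMap.adjoint A) := by
    rw [← ContinuousLinearMap.star_eq_adjoint, isUnit_star]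
  have hker : kernelBundle (ContinuousLinearMap.adjoint S) c =
      (ContinuousLinearMap.adjoint A).ker := by rw [hadj, kernelBundle]
  rw [hmem, ← hadj, hker]
  constructor
  · rintro ⟨h1, h2⟩
    obtain ⟨L, hL⟩ := exists_leftInverse_of_isClosed_range (hinj (conj c)) h2.isClosed_range
    have hR : ContinuousLinearMap.adjoint A * ContinuousLinearMap.adjoint L = 1 := by
      rw [← ContinuousLinearMap.star_eq_adjoint, ← ContinuousLinearMap.star_eq_adjoint,
        ← star_mul, hL, star_one]
    have hs : Function.Surjective (ContinuousLinearMap.adjoint A) := fun y =>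
      ⟨ContinuousLinearMap.adjoint L y, congrArg (fun B : H →L[ℂ] H => B y) hR⟩
    refine ⟨hs, fun h0 => h1 (hunit.2 ?_)⟩
    rw [ContinuousLinearMap.isUnit_iff_bijective]
    exact ⟨LinearMap.ker_eq_bot.1 h0, hs⟩
  · rintro ⟨h1, h2⟩
    obtain ⟨R, hR⟩ := exists_rightInverse_of_surjective h1
    have hL : ContinuousLinearMap.adjoint R * A = 1 := by
      have := congrArg star hR
      rwa [star_mul, star_one, ContinuousLinearMap.star_eq_adjoint,
        ContinuousLinearMap.star_eq_adjoint, ContinuousLinearMap.adjoint_adjoint] at this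
    have hleft : A.HasLeftInverse :=
      ⟨ContinuousLinearMap.adjoint R, fun x => congrArg (fun B : H →L[ℂ] H => B x) hL⟩
    refine ⟨fun hu => h2 ?_, ?_⟩
    · rw [hunit, ContinuousLinearMap.isUnit_iff_bijective] at hu
      exact LinearMap.ker_eq_bot.2 hu.1
    · have hk : A.ker = ⊥ := LinearMap.ker_eq_bot.2 hleft.injective
      have hcl := hleft.isClosed_range
      have : CompleteSpace A.range := hcl.completeSpace_coe
      refine ⟨?_, hcl, ?_, ?_, ?_⟩
      · exact (Function.LeftInverse.isEmbedding hleft.leftInverse_leftInverse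
          hleft.leftInverse.continuous A.continuous).isStrictMap
      · rw [hk]; infer_instance
      -- The cokernel is finite-dimensional because the orthogonal complement of the closed range is
      -- the kernel of the adjoint.
      · have hfg : (A.rangeᗮ).FG := by
          rw [ContinuousLinearMap.orthogonal_range, ← hker]
          exact Module.Finite.iff_fg.1 (hfin c)
        exact Submodule.FG.cofg_of_isCompl
          (Submodule.isCompl_orthogonal _).symm hfg
      · rw [hk]; exact Submodule.closedComplemented_bot


/-- A closed subspace reducing `T` gives a holomorphic subbundle of the kernel bundle. -/
theorem isHolomorphicSubbundle_inf_kernelBundle {T P : H →L[ℂ] H} {Ω : Set ℂ} (hΩ : IsOpen Ω)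
    (hsurj : ∀ c ∈ Ω, Function.Surjective (T - c • ContinuousLinearMap.id ℂ H))
    (hfin : ∀ c, FiniteDimensional ℂ (kernelBundle T c)) (hPT : Commute P T)
    (hP : P * P = P) {M : Submodule ℂ H} (hM : ∀ x, x ∈ M ↔ P x = x) :
    IsHolomorphicSubbundle Ω fun c => M ⊓ kernelBundle T c := by
  intro c₀ hc₀
  obtain ⟨R, hR⟩ := exists_rightInverse_of_surjective (hsurj c₀ hc₀)
  have hcomm : Commute P (T - c₀ • ContinuousLinearMap.id ℂ H) :=
    hPT.sub_right ((Commute.one_right P).smul_right c₀)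
  set A := T - c₀ • ContinuousLinearMap.id ℂ H
  -- An arbitrary right inverse need not commute with `P`; its block-diagonal part does, and it
  -- remains a right inverse because `P` commutes with `A`.
  have hR' : A * (P * R * P + (1 - P) * R * (1 - P)) = 1 := by
    have e1 : A * (P * R * P) = P * P := by
      rw [← mul_assoc, ← mul_assoc, ← hcomm.eq, mul_assoc P A R, hR, mul_one]
    have h1 : A * (1 - P) = (1 - P) * A := ((Commute.one_left A).sub_left hcomm).eq.symm
    have e2 : A * ((1 - P) * R * (1 - P)) = (1 - P) * (1 - P) := by
      rw [← mul_assoc, ← mul_assoc, h1, mul_assoc (1 - P) A R, hR, mul_one]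
    rw [mul_add, e1, e2, mul_sub, sub_mul, sub_mul, hP]
    simp
  have hcomm' : Commute P (P * R * P + (1 - P) * R * (1 - P)) := by
    have h2 : P * (1 - P) = 0 := by rw [mul_sub, hP, mul_one, sub_self]
    have h3 : (1 - P) * P = 0 := by rw [sub_mul, hP, one_mul, sub_self]
    rw [commute_iff_eq, mul_add, add_mul]
    simp only [← mul_assoc, hP, h2, zero_mul]
    simp only [mul_assoc, hP, h3, mul_zero]
  obtain ⟨ε, hε, -, n, s, hs, hspan⟩ := exists_frame hR' hcomm' (hfin c₀) hM
  obtain ⟨ε', hε', hsub⟩ := Metric.isOpen_iff.1 hΩ c₀ hc₀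
  refine ⟨Metric.ball c₀ (min ε ε'), Metric.isOpen_ball, Metric.mem_ball_self (lt_min hε hε'),
    (Metric.ball_subset_ball (min_le_right _ _)).trans hsub, n, s, fun i => (hs i).mono
    (Metric.ball_subset_ball (min_le_left _ _)), fun c hc => hspan c
    (Metric.ball_subset_ball (min_le_left _ _) hc)⟩

theorem isGeneralizedCowenDouglas_of_mem_iff {T : H →L[ℂ] H} {Ω : Set ℂ}
    (hmem : ∀ c, c ∈ Ω ↔ Function.Surjective (T - c • ContinuousLinearMap.id ℂ H) ∧
      kernelBundle T c ≠ ⊥)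
    (hb : Bornology.IsBounded Ω)
    (hfin : ∀ c, FiniteDimensional ℂ (kernelBundle T c))
    (hspan : (⨆ c ∈ Ω, kernelBundle T c).topologicalClosure = ⊤) :
    IsGeneralizedCowenDouglas Ω T := by
  -- A local frame of the full kernel bundle gives openness of `Ω` and local constancy of the rank
  -- together; on a connected component the rank is then constant.
  have hloc : ∀ c₀ ∈ Ω, ∃ ε > 0, ∀ c ∈ Metric.ball c₀ ε, c ∈ Ω ∧
      Module.finrank ℂ (kernelBundle T c) = Module.finrank ℂ (kernelBundle T c₀) := by
    intro c₀ hc₀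
    obtain ⟨R, hR⟩ := exists_rightInverse_of_surjective ((hmem c₀).1 hc₀).1
    obtain ⟨ε, hε, hsurj, n, s, -, hs⟩ := exists_frame hR (Commute.one_left R) (hfin c₀)
      (M := ⊤) (fun x => by simp)
    simp only [top_inf_eq] at hs
    have hrank : ∀ c ∈ Metric.ball c₀ ε, Module.finrank ℂ (kernelBundle T c) = n := by
      intro c hc
      rw [← (hs c hc).2, finrank_span_eq_card (hs c hc).1, Fintype.card_fin]
    have h0 := hrank c₀ (Metric.mem_ball_self hε)
    refine ⟨ε, hε, fun c hc => ⟨(hmem c).2 ⟨hsurj c hc, fun h => ?_⟩, by rw [hrank c hc, h0]⟩⟩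
    have h1 := hrank c hc
    rw [h, finrank_bot] at h1
    rw [← h1] at h0
    have := hfin c₀
    exact ((hmem c₀).1 hc₀).2 (Submodule.finrank_eq_zero.1 h0)
  refine ⟨Metric.isOpen_iff.2 fun c₀ hc₀ => ?_, hb, fun c hc => ?_, hspan, fun c₀ hc₀ => ?_⟩
  · obtain ⟨ε, hε, h⟩ := hloc c₀ hc₀
    exact ⟨ε, hε, fun c hc => (h c hc).1⟩
  · exact LinearMap.range_eq_top.2 ((hmem c).1 hc).1
  · refine ⟨Module.finrank ℂ (kernelBundle T c₀), ?_, fun c hc => ?_⟩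
    · have := hfin c₀
      exact Nat.pos_of_ne_zero fun h => ((hmem c₀).1 hc₀).2 (Submodule.finrank_eq_zero.1 h)
    · have hcont : ContinuousOn (fun c => Module.finrank ℂ (kernelBundle T c))
          (connectedComponentIn Ω c₀) := by
        intro c hc
        obtain ⟨ε, hε, h⟩ := hloc c (connectedComponentIn_subset Ω c₀ hc)
        refine ContinuousAt.continuousWithinAt ?_
        refine (continuousAt_const (y := Module.finrank ℂ (kernelBundle T c))).congr ?_
        filter_upwards [Metric.ball_mem_nhds c hε] with d hd using (h d hd).2.symm
      exact isPreconnected_connectedComponentIn.constant hcont hc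
        (mem_connectedComponentIn hc₀)

/-- The closed spans `M₁`, `M₂` of the two summands are invariant under the adjoint, mutually
orthogonal and jointly dense, so `M₁ = M₂ᗮ`. Invariance of `M₁` under `S` is the dual of invariance
of `M₂` under the adjoint. Orthogonality across different components is indispensable here. -/
theorem isReducible_of_kernelBundleReducible {S : H →L[ℂ] H} {Ω : Set ℂ}
    (hspan : (⨆ c ∈ Ω, kernelBundle (ContinuousLinearMap.adjoint S) c).topologicalClosure = ⊤)
    (h : KernelBundleReducible Ω (ContinuousLinearMap.adjoint S)) : IsReducible S := by
  obtain ⟨E₁, E₂, hE⟩ := h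
  set T := ContinuousLinearMap.adjoint S with hT
  let M₁ : Submodule ℂ H := (⨆ c ∈ Ω, E₁ c).topologicalClosure
  let M₂ : Submodule ℂ H := (⨆ c ∈ Ω, E₂ c).topologicalClosure
  have hinv : ∀ E : ℂ → Submodule ℂ H, (∀ c ∈ Ω, E c ≤ kernelBundle T c) →
      ∀ x ∈ (⨆ c ∈ Ω, E c).topologicalClosure, T x ∈ (⨆ c ∈ Ω, E c).topologicalClosure := by
    intro E hE x hx
    have h1 : (⨆ c ∈ Ω, E c) ≤ (⨆ c ∈ Ω, E c).comap T.toLinearMap := by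
      refine iSup₂_le fun c hc x hx => ?_
      have h2 : T x = c • x := by
        have : (T - c • ContinuousLinearMap.id ℂ H) x = 0 := hE c hc hx
        simpa [sub_eq_zero] using this
      change T x ∈ (⨆ c ∈ Ω, E c)
      rw [h2]
      exact Submodule.smul_mem _ _ (le_iSup₂_of_le (f := fun c (_ : c ∈ Ω) => E c) c hc le_rfl hx)
    exact map_mem_closure T.continuous hx fun y hy => h1 hy
  have hle₁ : ∀ c ∈ Ω, E₁ c ≤ kernelBundle T c := fun c hc => hE.sup_eq c hc ▸ le_sup_left
  have hle₂ : ∀ c ∈ Ω, E₂ c ≤ kernelBundle T c := fun c hc => hE.sup_eq c hc ▸ le_sup_right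
  have hsub₁ : ∀ c ∈ Ω, E₁ c ≤ M₁ := fun c hc =>
    (le_iSup₂_of_le (f := fun c (_ : c ∈ Ω) => E₁ c) c hc le_rfl).trans
      (Submodule.le_topologicalClosure _)
  have hsub₂ : ∀ c ∈ Ω, E₂ c ≤ M₂ := fun c hc =>
    (le_iSup₂_of_le (f := fun c (_ : c ∈ Ω) => E₂ c) c hc le_rfl).trans
      (Submodule.le_topologicalClosure _)
  have hM₁cl : IsClosed (M₁ : Set H) := Submodule.isClosed_topologicalClosure _
  have : CompleteSpace M₁ := hM₁cl.completeSpace_coe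
  have hort : M₁ ≤ M₂ᗮ := by
    refine Submodule.topologicalClosure_minimal _ (iSup₂_le fun c hc => ?_)
      (Submodule.isClosed_orthogonal _)
    rw [Submodule.orthogonal_closure]
    refine Submodule.IsOrtho.le ?_
    rw [Submodule.isOrtho_iSup_right]
    intro c'
    rw [Submodule.isOrtho_iSup_right]
    exact fun hc' => hE.orthogonal c hc c' hc'
  have heq : M₁ = M₂ᗮ := by
    refine le_antisymm hort fun x hx => ?_
    have hn : x - M₁.starProjection x ∈ M₁ᗮ := Submodule.sub_starProjection_mem_orthogonal x
    have hn2 : x - M₁.starProjection x ∈ M₂ᗮ :=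
      Submodule.sub_mem _ hx (hort (Submodule.starProjection_apply_mem _ _))
    have h0 : x - M₁.starProjection x ∈ (⨆ c ∈ Ω, kernelBundle T c)ᗮ := by
      rw [Submodule.mem_orthogonal]
      intro u hu
      have hle : (⨆ c ∈ Ω, kernelBundle T c) ≤ M₁ ⊔ M₂ := by
        refine iSup₂_le fun c hc => ?_
        rw [← hE.sup_eq c hc]
        exact sup_le_sup (hsub₁ c hc) (hsub₂ c hc)
      obtain ⟨a, ha, b, hb, rfl⟩ := Submodule.mem_sup.1 (hle hu)
      rw [inner_add_left, (Submodule.mem_orthogonal _ _).1 hn a ha,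
        (Submodule.mem_orthogonal _ _).1 hn2 b hb, add_zero]
    rw [Submodule.topologicalClosure_eq_top_iff.1 hspan, Submodule.mem_bot, sub_eq_zero] at h0
    rw [h0]
    exact Submodule.starProjection_apply_mem _ _
  refine ⟨M₁, hM₁cl, fun h => hE.ne_zero₁ fun c hc => ?_, fun h => hE.ne_zero₂ fun c hc => ?_,
    fun x hx => ?_, hinv E₁ hle₁⟩
  · exact eq_bot_iff.2 (h ▸ hsub₁ c hc)
  · have h1 : M₂ᗮ = ⊤ := heq ▸ h
    have h2 : M₂ = ⊥ := by
      rw [Submodule.orthogonal_eq_top_iff] at h1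
      exact h1
    exact eq_bot_iff.2 (h2 ▸ hsub₂ c hc)
  · rw [heq, Submodule.mem_orthogonal] at hx ⊢
    intro u hu
    rw [← ContinuousLinearMap.adjoint_inner_left]
    exact hx _ (hinv E₂ hle₂ u hu)

/-- The projection onto a reducing subspace `M` commutes with the adjoint, hence preserves each
kernel and splits it into its parts in `M` and `Mᗮ`. -/
theorem kernelBundleReducible_of_isReducible {S : H →L[ℂ] H} {Ω : Set ℂ} (hΩ : IsOpen Ω)
    (hsurj : ∀ c ∈ Ω, Function.Surjective
      (ContinuousLinearMap.adjoint S - c • ContinuousLinearMap.id ℂ H))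
    (hfin : ∀ c, FiniteDimensional ℂ (kernelBundle (ContinuousLinearMap.adjoint S) c))
    (hspan : (⨆ c ∈ Ω, kernelBundle (ContinuousLinearMap.adjoint S) c).topologicalClosure = ⊤)
    (h : IsReducible S) : KernelBundleReducible Ω (ContinuousLinearMap.adjoint S) := by
  obtain ⟨M, hMcl, hbot, htop, hMS, hMT⟩ := h
  set T := ContinuousLinearMap.adjoint S with hT
  have : CompleteSpace M := hMcl.completeSpace_coe
  set P : H →L[ℂ] H := M.starProjection with hPdef
  have hP : P * P = P := M.isIdempotentElem_starProjection
  have hM : ∀ x, x ∈ M ↔ P x = x := fun x => Submodule.starProjection_eq_self_iff.symm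
  have hM' : ∀ x, x ∈ Mᗮ ↔ (1 - P) x = x := fun x => by
    rw [sub_apply, one_apply_eq_self, sub_eq_self]
    exact (Submodule.starProjection_apply_eq_zero_iff M).symm
  have hMT' : ∀ x ∈ Mᗮ, T x ∈ Mᗮ := by
    intro x hx
    rw [Submodule.mem_orthogonal] at hx ⊢
    intro u hu
    rw [ContinuousLinearMap.adjoint_inner_right]
    exact hx _ (hMS u hu)
  have hPT : Commute P T := by
    rw [commute_iff_eq]
    ext x
    have h1 : P (T (P x)) = T (P x) := (hM _).1 (hMT _ (Submodule.starProjection_apply_mem M x))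
    have h2 : P (T (x - P x)) = 0 := (Submodule.starProjection_apply_eq_zero_iff M).2
      (hMT' _ (Submodule.sub_starProjection_mem_orthogonal x))
    rw [map_sub, map_sub, h1, sub_eq_zero] at h2
    exact h2
  have hker : ∀ c x, x ∈ kernelBundle T c → P x ∈ kernelBundle T c := by
    intro c x hx
    have hcomm : Commute P (T - c • ContinuousLinearMap.id ℂ H) :=
      hPT.sub_right ((Commute.one_right P).smul_right c)
    have h1 : (T - c • ContinuousLinearMap.id ℂ H) (P x) =
      P ((T - c • ContinuousLinearMap.id ℂ H) x) :=
        (congrArg (fun B : H →L[ℂ] H => B x) hcomm.eq).symm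
    have h2 : (T - c • ContinuousLinearMap.id ℂ H) x = 0 := hx
    change (T - c • ContinuousLinearMap.id ℂ H) (P x) = 0
    rw [h1, h2, map_zero]
  have hcov : ∀ c, (M ⊓ kernelBundle T c) ⊔ (Mᗮ ⊓ kernelBundle T c) = kernelBundle T c := by
    intro c
    refine le_antisymm (sup_le inf_le_right inf_le_right) fun x hx => ?_
    rw [← add_sub_cancel (P x) x]
    exact Submodule.add_mem_sup ⟨Submodule.starProjection_apply_mem M x, hker c x hx⟩
      ⟨Submodule.sub_starProjection_mem_orthogonal x, Submodule.sub_mem _ hx (hker c x hx)⟩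
  -- Because the fibres span, each of the four degenerate decompositions would make `M` or `Mᗮ` the
  -- whole space.
  have hfull : ∀ N : Submodule ℂ H, IsClosed (N : Set H) → (∀ c ∈ Ω, kernelBundle T c ≤ N) →
      N = ⊤ := by
    intro N hN h
    rw [eq_top_iff, ← hspan]
    exact Submodule.topologicalClosure_minimal _ (iSup₂_le h) hN
  have htop' : M ≠ ⊤ := htop
  have hbot' : Mᗮ ≠ ⊤ := fun h => hbot ((Submodule.orthogonal_eq_top_iff M).1 h)
  refine ⟨fun c => M ⊓ kernelBundle T c, fun c => Mᗮ ⊓ kernelBundle T c,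
    isHolomorphicSubbundle_inf_kernelBundle hΩ hsurj hfin hPT hP hM,
    isHolomorphicSubbundle_inf_kernelBundle hΩ hsurj hfin
      ((Commute.one_left T).sub_left hPT) ?_ hM', fun c _ => ?_, fun c _ => hcov c,
      fun c _ c' _ => ?_, fun h => hbot' ?_, fun h => htop' ?_, fun h => htop' ?_,
      fun h => hbot' ?_⟩
  · rw [mul_sub, sub_mul, sub_mul, hP]; simp
  · rw [eq_bot_iff]
    exact (inf_le_inf inf_le_left inf_le_left).trans (Submodule.inf_orthogonal_eq_bot M).le
  · exact (Submodule.isOrtho_orthogonal_right M).mono inf_le_left inf_le_left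
  · refine hfull _ (Submodule.isClosed_orthogonal M) fun c hc => ?_
    have := hcov c
    rw [h c hc, bot_sup_eq] at this
    exact inf_eq_right.1 this
  · exact hfull _ hMcl fun c hc => inf_eq_right.1 (h c hc)
  · refine hfull _ hMcl fun c hc => ?_
    have := hcov c
    rw [h c hc, sup_bot_eq] at this
    exact inf_eq_right.1 this
  · exact hfull _ (Submodule.isClosed_orthogonal M) fun c hc => inf_eq_right.1 (h c hc)

/-- The main theorem for an abstract operator whose kernel bundle has the property that a fibre
vector orthogonal to all fibres over one component vanishes. -/
theorem cowenDouglas_and_isReducible_iff {S : H →L[ℂ] H}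
    (hinj : ∀ c : ℂ, Function.Injective (S - c • ContinuousLinearMap.id ℂ H))
    (hfin : ∀ c, FiniteDimensional ℂ (kernelBundle (ContinuousLinearMap.adjoint S) c))
    {Ω : Set ℂ} (hΩ : Ω = (fun c => conj c) '' (spectrum ℂ S \ essentialSpectrum S))
    (hspan : (⨆ c ∈ Ω, kernelBundle (ContinuousLinearMap.adjoint S) c).topologicalClosure = ⊤)
    (hcomp : ∀ c₀ ∈ Ω, ∀ c' ∈ Ω, ∀ f ∈ kernelBundle (ContinuousLinearMap.adjoint S) c',
      (∀ c ∈ connectedComponentIn Ω c₀,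
        ∀ g ∈ kernelBundle (ContinuousLinearMap.adjoint S) c, ⟪g, f⟫_ℂ = 0) → f = 0) :
    IsGeneralizedCowenDouglas Ω (ContinuousLinearMap.adjoint S) ∧
      (IsReducible S ↔ KernelBundleStrictlyReducible Ω (ContinuousLinearMap.adjoint S)) := by
  have hmem : ∀ c, c ∈ Ω ↔ Function.Surjective
      (ContinuousLinearMap.adjoint S - c • ContinuousLinearMap.id ℂ H) ∧
      kernelBundle (ContinuousLinearMap.adjoint S) c ≠ ⊥ := fun c => by
    rw [hΩ]; exact mem_conj_image_iff hinj hfin c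
  have hb : Bornology.IsBounded Ω := by
    have h1 : Bornology.IsBounded (spectrum ℂ S \ essentialSpectrum S) :=
      (spectrum.isBounded S).subset Set.sdiff_subset
    rw [hΩ]
    exact Complex.conjLIE.lipschitz.isBounded_image h1
  have hCD := isGeneralizedCowenDouglas_of_mem_iff hmem hb hfin hspan
  refine ⟨hCD, fun h => ⟨kernelBundleReducible_of_isReducible hCD.isOpen
    (fun c hc => ((hmem c).1 hc).1) hfin hspan h, fun E₁ E₂ hE c₀ hc₀ => ⟨fun h0 => ?_,
    fun h0 => ?_⟩⟩, fun h => isReducible_of_kernelBundleReducible hspan h.1⟩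
  -- If `E₁` vanishes over a component, `E₂` fills the fibres there, so every vector of `E₁`
  -- anywhere is orthogonal to all of them and is zero by `hcomp`. The other case exchanges the
  -- roles of `E₁` and `E₂`.
  · refine hE.ne_zero₁ fun c' hc' => eq_bot_iff.2 fun f hf => ?_
    refine hcomp c₀ hc₀ c' hc' f (hE.sup_eq c' hc' ▸ Submodule.mem_sup_left hf)
      fun c hc g hg => ?_
    have hcΩ := connectedComponentIn_subset Ω c₀ hc
    rw [← hE.sup_eq c hcΩ, h0 c hc, bot_sup_eq] at hg
    exact (Submodule.isOrtho_iff_inner_eq.1 (hE.orthogonal c' hc' c hcΩ).symm) g hg f hf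
  · refine hE.ne_zero₂ fun c' hc' => eq_bot_iff.2 fun f hf => ?_
    refine hcomp c₀ hc₀ c' hc' f (hE.sup_eq c' hc' ▸ Submodule.mem_sup_right hf)
      fun c hc g hg => ?_
    have hcΩ := connectedComponentIn_subset Ω c₀ hc
    rw [← h0 c hc] at hg
    exact (Submodule.isOrtho_iff_inner_eq.1 (hE.orthogonal c hcΩ c' hc')) g hg f hf

end AbstractTheorem

/-! ### Parseval's identity and comparison of power series near the unit circle. -/

section Parseval

open Complex

theorem integral_exp_int_mul_I (k : ℤ) :
    ∫ s in (0 : ℝ)..2 * Real.pi, exp (k * s * I) = if k = 0 then 2 * Real.pi else 0 := by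
  split_ifs with h
  · simp [h]
  · have hk : (k * I : ℂ) ≠ 0 := mul_ne_zero (Int.cast_ne_zero.2 h) I_ne_zero
    have h1 : ∀ s : ℝ, exp (k * s * I) = exp (k * I * s) := fun s => by ring_nf
    simp only [h1]
    rw [integral_exp_mul_complex hk]
    have h2 : exp (k * I * ((2 * Real.pi : ℝ) : ℂ)) = 1 := by
      rw [← exp_int_mul_two_pi_mul_I k]; push_cast; ring_nf
    rw [h2]
    simp

theorem integral_tsum_mul_exp_eq {a : ℕ → ℂ} (ha : Summable fun n => ‖a n‖) (m : ℕ) :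
    ∫ s in (0 : ℝ)..2 * Real.pi, (∑' n, a n * exp (n * s * I)) * exp (-(m * s * I)) =
      2 * Real.pi * a m := by
  have h1 : HasSum (fun n : ℕ => ∫ s in (0 : ℝ)..2 * Real.pi,
      a n * exp (n * s * I) * exp (-(m * s * I)))
      (∫ s in (0 : ℝ)..2 * Real.pi, (∑' n, a n * exp (n * s * I)) * exp (-(m * s * I))) := by
    refine intervalIntegral.hasSum_integral_of_dominated_convergence (fun n _ => ‖a n‖)
      (fun n => ?_) (fun n => ?_) ?_ ?_ ?_
    · exact (by fun_prop : Continuous fun s : ℝ =>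
        a n * exp (n * s * I) * exp (-(m * s * I))).aestronglyMeasurable
    · refine Eventually.of_forall fun s _ => ?_
      rw [norm_mul, norm_mul, ← neg_mul, Complex.norm_exp, Complex.norm_exp]
      simp
    · exact Eventually.of_forall fun s _ => ha
    · exact intervalIntegrable_const
    · refine Eventually.of_forall fun s _ => HasSum.mul_right _ ?_
      refine Summable.hasSum (Summable.of_norm ?_)
      refine ha.congr fun n => ?_
      rw [norm_mul, Complex.norm_exp]
      simp
  have h2 : ∀ n : ℕ, ∫ s in (0 : ℝ)..2 * Real.pi,
      a n * exp (n * s * I) * exp (-(m * s * I)) = if n = m then 2 * Real.pi * a m else 0 := by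
    intro n
    have h3 : ∀ s : ℝ, a n * exp (n * s * I) * exp (-(m * s * I)) =
        a n * exp (((n - m : ℤ) : ℂ) * s * I) := by
      intro s
      rw [mul_assoc, ← exp_add]
      push_cast
      ring_nf
    simp only [h3]
    rw [intervalIntegral.integral_const_mul, integral_exp_int_mul_I]
    by_cases h : n = m
    · simp [h, mul_comm]
    · have : (n - m : ℤ) ≠ 0 := by omega
      simp [h, this]
  simp only [h2] at h1
  rw [← h1.tsum_eq, tsum_ite_eq]

/-- Parseval's identity for absolutely convergent one-sided Fourier series. -/
theorem integral_norm_sq_tsum_mul_exp {a : ℕ → ℂ} (ha : Summable fun n => ‖a n‖) :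
    ∫ s in (0 : ℝ)..2 * Real.pi, ‖∑' n, a n * exp (n * s * I)‖ ^ 2 =
      2 * Real.pi * ∑' n, ‖a n‖ ^ 2 := by
  have hsum : ∀ s : ℝ, Summable fun n : ℕ => a n * exp (n * s * I) := fun s => by
    refine Summable.of_norm (ha.congr fun n => ?_)
    rw [norm_mul, Complex.norm_exp]
    simp
  have hcont : Continuous fun s : ℝ => ∑' n : ℕ, a n * exp (n * s * I) := by
    refine continuous_tsum (fun n => by fun_prop) ha fun n s => ?_
    rw [norm_mul, Complex.norm_exp]
    simp
  have hbound : ∀ s : ℝ, ‖∑' n : ℕ, a n * exp (n * s * I)‖ ≤ ∑' n, ‖a n‖ := by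
    intro s
    refine tsum_of_norm_bounded ha.hasSum fun n => ?_
    rw [norm_mul, Complex.norm_exp]
    simp
  have h1 : HasSum (fun n : ℕ => ∫ s in (0 : ℝ)..2 * Real.pi,
      conj (a n) * ((∑' k, a k * exp (k * s * I)) * exp (-(n * s * I))))
      (∫ s in (0 : ℝ)..2 * Real.pi, ((‖∑' k, a k * exp (k * s * I)‖ ^ 2 : ℝ) : ℂ)) := by
    refine intervalIntegral.hasSum_integral_of_dominated_convergence
      (fun n _ => ‖a n‖ * ∑' k, ‖a k‖)
      (fun n => ?_) (fun n => ?_) ?_ ?_ ?_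
    · exact (by fun_prop : Continuous fun s : ℝ =>
        conj (a n) * ((∑' k, a k * exp (k * s * I)) * exp (-(n * s * I)))).aestronglyMeasurable
    · refine Eventually.of_forall fun s _ => ?_
      rw [norm_mul, norm_mul, ← neg_mul, Complex.norm_exp, Complex.norm_conj]
      have := hbound s
      simp only [neg_mul, neg_re, mul_re, natCast_re, ofReal_re, natCast_im, ofReal_im, mul_zero,
        sub_zero, I_re, mul_im, zero_mul, add_zero, I_im, mul_one, sub_self, neg_zero,
        Real.exp_zero, mul_one]
      gcongr
    · exact Eventually.of_forall fun s _ => ha.mul_right _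
    · exact intervalIntegrable_const
    · refine Eventually.of_forall fun s _ => ?_
      have h2 := (((hsum s).hasSum).star).mul_left (∑' k, a k * exp (k * s * I))
      have h3 : ((‖∑' k, a k * exp (k * s * I)‖ ^ 2 : ℝ) : ℂ) =
          (∑' k, a k * exp (k * s * I)) * star (∑' k, a k * exp (k * s * I)) := by
        rw [← starRingEnd_apply, Complex.mul_conj, Complex.normSq_eq_norm_sq]
      rw [h3]
      refine h2.congr_fun fun n => ?_
      rw [← starRingEnd_apply, map_mul, ← exp_conj]
      simp only [map_mul, conj_natCast, conj_ofReal, conj_I, mul_neg]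
      ring
  have h4 : ∀ n : ℕ, ∫ s in (0 : ℝ)..2 * Real.pi,
      conj (a n) * ((∑' k, a k * exp (k * s * I)) * exp (-(n * s * I))) =
      ((2 * Real.pi * ‖a n‖ ^ 2 : ℝ) : ℂ) := by
    intro n
    rw [intervalIntegral.integral_const_mul, integral_tsum_mul_exp_eq ha]
    have : conj (a n) * a n = ((‖a n‖ ^ 2 : ℝ) : ℂ) := by
      rw [mul_comm, Complex.mul_conj, Complex.normSq_eq_norm_sq]
    rw [mul_left_comm, this]
    push_cast
    ring
  simp only [h4] at h1
  rw [intervalIntegral.integral_ofReal, Complex.hasSum_ofReal] at h1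
  rw [← h1.tsum_eq, tsum_mul_left]

theorem summable_norm_mul_pow_sq {a : ℕ → ℂ} {r : ℝ} (hr : 0 ≤ r)
    (ha : Summable fun n => ‖a n‖ * r ^ n) :
    Summable fun n => ‖a n * (r : ℂ) ^ n‖ := by
  refine ha.congr fun n => ?_
  rw [norm_mul, norm_pow, norm_real, Real.norm_of_nonneg hr]

theorem integral_norm_sq_circle {a : ℕ → ℂ} {r : ℝ} (hr : 0 ≤ r)
    (ha : Summable fun n => ‖a n‖ * r ^ n) :
    ∫ s in (0 : ℝ)..2 * Real.pi, ‖∑' n, a n * (r * exp (s * I)) ^ n‖ ^ 2 =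
      2 * Real.pi * ∑' n, (‖a n‖ * r ^ n) ^ 2 := by
  have h := integral_norm_sq_tsum_mul_exp (summable_norm_mul_pow_sq hr ha)
  have h1 : ∀ n, ‖a n * (r : ℂ) ^ n‖ = ‖a n‖ * r ^ n := fun n => by
    rw [norm_mul, norm_pow, norm_real, Real.norm_of_nonneg hr]
  simp only [h1] at h
  rw [← h]
  congr 1
  ext s
  congr 3
  ext n
  rw [mul_pow, ← exp_nat_mul, mul_assoc, mul_assoc (n : ℂ)]

/-- If a power series is dominated by another one near the unit circle, so are the
`ℓ²` norms of the coefficients. -/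
theorem summable_sq_of_norm_tsum_le {a b : ℕ → ℂ}
    (ha : ∀ r : ℝ, 0 ≤ r → r < 1 → Summable fun n => ‖a n‖ * r ^ n)
    (hb : Summable fun n => ‖b n‖ ^ 2) {C : ℝ} (hC : 0 ≤ C)
    (hb' : ∀ r : ℝ, 0 ≤ r → r < 1 → Summable fun n => ‖b n‖ * r ^ n)
    (h : ∀ ε > 0, ∃ ρ < (1 : ℝ), ∀ t : ℂ, ρ < ‖t‖ → ‖t‖ < 1 →
      ‖∑' n, a n * t ^ n‖ ≤ (C + ε) * ‖∑' n, b n * t ^ n‖) :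
    Summable (fun n => ‖a n‖ ^ 2) ∧ ∑' n, ‖a n‖ ^ 2 ≤ C ^ 2 * ∑' n, ‖b n‖ ^ 2 := by
  have hpos : 0 < 2 * Real.pi := Real.two_pi_pos
  have hcont : ∀ c : ℕ → ℂ, ∀ r : ℝ, 0 ≤ r → (Summable fun n => ‖c n‖ * r ^ n) →
      Continuous fun s : ℝ => ∑' n, c n * (r * exp (s * I)) ^ n := by
    intro c r hr hc
    refine continuous_tsum (fun n => by fun_prop) hc fun n s => ?_
    rw [norm_mul, norm_pow, norm_mul, norm_real, norm_exp_ofReal_mul_I, mul_one,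
      Real.norm_of_nonneg hr]
  have hsq : ∀ c : ℕ → ℂ, ∀ r : ℝ, 0 ≤ r → (Summable fun n => ‖c n‖ * r ^ n) →
      Summable fun n => (‖c n‖ * r ^ n) ^ 2 := by
    intro c r hr hc
    have h0 : Tendsto (fun n => ‖c n‖ * r ^ n) atTop (𝓝 0) := hc.tendsto_atTop_zero
    refine Summable.of_norm_bounded_eventually_nat hc ?_
    filter_upwards [h0.eventually_le_const one_pos] with n hn
    have : 0 ≤ ‖c n‖ * r ^ n := by positivity
    rw [Real.norm_of_nonneg (by positivity), sq]
    exact mul_le_of_le_one_left this hn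
  -- The pointwise bound is integrated over circles of radius `r`. Square summability of `a` is not
  -- yet known, so finite sums are kept on the left: for them the limit `r → 1` needs only
  -- continuity.
  have key : ∀ s : Finset ℕ, ∀ ε > 0, ∑ n ∈ s, ‖a n‖ ^ 2 ≤ (C + ε) ^ 2 * ∑' n, ‖b n‖ ^ 2 := by
    intro s ε hε
    obtain ⟨ρ, hρ, hle⟩ := h ε hε
    have hr : ∀ᶠ r : ℝ in 𝓝[<] 1, ∑ n ∈ s, (‖a n‖ * r ^ n) ^ 2 ≤
        (C + ε) ^ 2 * ∑' n, ‖b n‖ ^ 2 := by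
      have h1 : ∀ᶠ r : ℝ in 𝓝[<] 1, r ∈ Set.Ioo (max ρ 0) 1 :=
        Ioo_mem_nhdsLT (max_lt hρ one_pos)
      filter_upwards [h1] with r hr
      have hr0 : 0 ≤ r := (le_max_right _ _).trans hr.1.le
      have hρr : ρ < r := (le_max_left _ _).trans_lt hr.1
      have hA := integral_norm_sq_circle hr0 (ha r hr0 hr.2)
      have hB := integral_norm_sq_circle hr0 (hb' r hr0 hr.2)
      have hInt : ∫ s in (0 : ℝ)..2 * Real.pi, ‖∑' n, a n * (r * exp (s * I)) ^ n‖ ^ 2 ≤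
          ∫ s in (0 : ℝ)..2 * Real.pi,
            (C + ε) ^ 2 * ‖∑' n, b n * (r * exp (s * I)) ^ n‖ ^ 2 := by
        refine intervalIntegral.integral_mono_on hpos.le
          (((hcont a r hr0 (ha r hr0 hr.2)).norm.pow 2).intervalIntegrable _ _)
          ((((hcont b r hr0 (hb' r hr0 hr.2)).norm.pow 2).const_mul _).intervalIntegrable _ _)
          fun s _ => ?_
        have hn : ‖(r * exp (s * I) : ℂ)‖ = r := by
          rw [norm_mul, norm_real, norm_exp_ofReal_mul_I, mul_one, Real.norm_of_nonneg hr0]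
        rw [← mul_pow]
        exact pow_le_pow_left₀ (norm_nonneg _) (hle _ (hρr.trans_eq hn.symm) (hn.trans_lt hr.2)) 2
      rw [intervalIntegral.integral_const_mul, hA, hB] at hInt
      have h3 : ∑' n, (‖a n‖ * r ^ n) ^ 2 ≤ (C + ε) ^ 2 * ∑' n, (‖b n‖ * r ^ n) ^ 2 := by
        refine le_of_mul_le_mul_left ?_ hpos
        linarith
      have h4 : ∑' n, (‖b n‖ * r ^ n) ^ 2 ≤ ∑' n, ‖b n‖ ^ 2 := by
        refine (hsq b r hr0 (hb' r hr0 hr.2)).tsum_le_tsum (fun n => ?_) hb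
        refine pow_le_pow_left₀ (by positivity) ?_ 2
        exact mul_le_of_le_one_right (norm_nonneg _) (pow_le_one₀ hr0 hr.2.le)
      have h5 := (hsq a r hr0 (ha r hr0 hr.2)).sum_le_tsum s (fun n _ => by positivity)
      exact h5.trans (h3.trans (by gcongr))
    have hlim : Tendsto (fun r : ℝ => ∑ n ∈ s, (‖a n‖ * r ^ n) ^ 2) (𝓝[<] 1)
        (𝓝 (∑ n ∈ s, (‖a n‖ * 1 ^ n) ^ 2)) :=
      ((by fun_prop : Continuous fun r : ℝ => ∑ n ∈ s, (‖a n‖ * r ^ n) ^ 2).tendsto 1).mono_left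
        nhdsWithin_le_nhds
    simpa using le_of_tendsto hlim hr
  have key' : ∀ s : Finset ℕ, ∑ n ∈ s, ‖a n‖ ^ 2 ≤ C ^ 2 * ∑' n, ‖b n‖ ^ 2 := by
    intro s
    have hlim : Tendsto (fun ε : ℝ => (C + ε) ^ 2 * ∑' n, ‖b n‖ ^ 2) (𝓝[>] 0)
        (𝓝 ((C + 0) ^ 2 * ∑' n, ‖b n‖ ^ 2)) :=
      ((by fun_prop : Continuous fun ε : ℝ => (C + ε) ^ 2 * ∑' n, ‖b n‖ ^ 2).tendsto 0).mono_left
        nhdsWithin_le_nhds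
    rw [add_zero] at hlim
    exact ge_of_tendsto hlim (eventually_mem_nhdsWithin.mono fun ε hε => key s ε hε)
  have hsum : Summable fun n => ‖a n‖ ^ 2 :=
    summable_of_sum_le (fun n => by positivity) key'
  exact ⟨hsum, hsum.tsum_le_of_sum_le key'⟩

end Parseval

/-! ### The norm of `H²(𝔻²)` as an average of one-variable norms over diagonal slices. -/

section Slices

open Complex

/-- The sum of the double power series with coefficients `a`. -/
def powerSum (a : ℕ × ℕ → ℂ) (x : ℂ × ℂ) : ℂ := ∑' k : ℕ × ℕ, a k * (x.1 ^ k.1 * x.2 ^ k.2)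

/-- The double power series with coefficients `a` converges absolutely on the bidisk. -/
def AbsConv (a : ℕ × ℕ → ℂ) : Prop :=
  ∀ r : ℝ, 0 ≤ r → r < 1 → Summable fun k : ℕ × ℕ => ‖a k‖ * r ^ (k.1 + k.2)

theorem AbsConv.summable_norm {a : ℕ × ℕ → ℂ} (ha : AbsConv a) {x : ℂ × ℂ} (hx : x ∈ bidisk) :
    Summable fun k : ℕ × ℕ => ‖a k * (x.1 ^ k.1 * x.2 ^ k.2)‖ := by
  obtain ⟨h1, h2⟩ := hx
  rw [mem_ball_zero_iff] at h1 h2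
  have := ha (max ‖x.1‖ ‖x.2‖) (le_max_of_le_left (norm_nonneg _)) (max_lt h1 h2)
  refine Summable.of_nonneg_of_le (fun _ => norm_nonneg _) (fun k => ?_) this
  rw [norm_mul, norm_mul, norm_pow, norm_pow, pow_add]
  gcongr
  · exact le_max_left _ _
  · exact le_max_right _ _

theorem absConv_coe (f : H2) : AbsConv f := by
  intro r hr hr1
  have hs : Summable fun k : ℕ × ℕ => r ^ k.1 * r ^ k.2 :=
    (summable_geometric_of_lt_one hr hr1).mul_of_nonneg (summable_geometric_of_lt_one hr hr1)
      (fun _ => by positivity) (fun _ => by positivity)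
  refine Summable.of_nonneg_of_le (fun _ => by positivity) (fun k => ?_) (hs.mul_left ‖f‖)
  rw [pow_add]
  gcongr
  exact lp.norm_apply_le_norm (by norm_num) f k

theorem toFun_eq_powerSum (f : H2) (x : ℂ × ℂ) : f.toFun x = powerSum f x := rfl

/-- Coefficients of `t ↦ F (t, t e^{iτ})` for `F` with coefficients `a`. -/
def sliceCoeff (a : ℕ × ℕ → ℂ) (τ : ℝ) (N : ℕ) : ℂ :=
  ∑ k ∈ Finset.HasAntidiagonal.antidiagonal N, a k * exp (k.2 * τ * I)

theorem norm_sliceCoeff_le (a : ℕ × ℕ → ℂ) (τ : ℝ) (N : ℕ) :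
    ‖sliceCoeff a τ N‖ ≤ ∑ k ∈ Finset.HasAntidiagonal.antidiagonal N, ‖a k‖ := by
  refine norm_sum_le_of_le _ fun k _ => ?_
  rw [norm_mul, Complex.norm_exp]
  simp

theorem summable_antidiagonal {a : ℕ × ℕ → ℂ} (ha : AbsConv a) {r : ℝ} (hr : 0 ≤ r)
    (hr1 : r < 1) :
    Summable fun N => ∑ k ∈ Finset.HasAntidiagonal.antidiagonal N, ‖a k‖ * r ^ (k.1 + k.2) := by
  have h := ((Finset.HasAntidiagonal.sigmaAntidiagonalEquivProd (A := ℕ)).summable_iff.2 (ha r hr hr1)).sigma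
  refine h.congr fun N => ?_
  rw [tsum_fintype]
  exact Finset.sum_coe_sort (Finset.HasAntidiagonal.antidiagonal N)
    fun k => ‖a k‖ * r ^ (k.1 + k.2)

theorem summable_norm_sliceCoeff {a : ℕ × ℕ → ℂ} (ha : AbsConv a) (τ : ℝ) {r : ℝ} (hr : 0 ≤ r)
    (hr1 : r < 1) : Summable fun N => ‖sliceCoeff a τ N‖ * r ^ N := by
  refine Summable.of_nonneg_of_le (fun _ => by positivity) (fun N => ?_)
    (summable_antidiagonal ha hr hr1)
  refine (mul_le_mul_of_nonneg_right (norm_sliceCoeff_le a τ N) (by positivity)).trans ?_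
  rw [Finset.sum_mul]
  refine Finset.sum_le_sum fun k hk => ?_
  rw [Finset.HasAntidiagonal.mem_antidiagonal.1 hk]

theorem mk_mem_bidisk {t : ℂ} (ht : ‖t‖ < 1) (τ : ℝ) : (t, t * exp (τ * I)) ∈ bidisk := by
  refine ⟨mem_ball_zero_iff.2 ht, mem_ball_zero_iff.2 ?_⟩
  rw [norm_mul, norm_exp_ofReal_mul_I, mul_one]
  exact ht

theorem powerSum_slice {a : ℕ × ℕ → ℂ} (ha : AbsConv a) (τ : ℝ) {t : ℂ} (ht : ‖t‖ < 1) :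
    powerSum a (t, t * exp (τ * I)) = ∑' N, sliceCoeff a τ N * t ^ N := by
  have h := (ha.summable_norm (mk_mem_bidisk ht τ)).of_norm
  have h' := (Finset.HasAntidiagonal.sigmaAntidiagonalEquivProd (A := ℕ)).summable_iff.2 h
  rw [powerSum, ← (Finset.HasAntidiagonal.sigmaAntidiagonalEquivProd (A := ℕ)).tsum_eq]
  refine (Summable.tsum_sigma' (fun N => (hasSum_fintype _).summable) h').trans ?_
  refine tsum_congr fun N => ?_
  rw [tsum_fintype, Finset.univ_eq_attach, sliceCoeff, Finset.sum_mul,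
    ← Finset.sum_attach (Finset.HasAntidiagonal.antidiagonal N)]
  refine Finset.sum_congr rfl fun k _ => ?_
  change a k.1 * (t ^ k.1.1 * (t * exp (τ * I)) ^ k.1.2) = _
  have hk : t ^ N = t ^ k.1.1 * t ^ k.1.2 := by
    rw [← pow_add, Finset.HasAntidiagonal.mem_antidiagonal.1 k.2]
  rw [mul_pow, ← exp_nat_mul, hk]
  ring_nf

theorem continuous_sliceCoeff (a : ℕ × ℕ → ℂ) (N : ℕ) : Continuous fun τ => sliceCoeff a τ N := by
  unfold sliceCoeff
  fun_prop

theorem measurable_norm_sq_sliceCoeff (a : ℕ × ℕ → ℂ) (N : ℕ) :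
    Measurable fun τ => ENNReal.ofReal (‖sliceCoeff a τ N‖ ^ 2) :=
  ((continuous_sliceCoeff a N).norm.pow 2).measurable.ennreal_ofReal

/-- For fixed `N` the slice coefficient is a trigonometric polynomial in `τ` whose coefficients are
the `a k` of total degree `N`, so Parseval applies in `τ`. -/
theorem integral_norm_sq_sliceCoeff (a : ℕ × ℕ → ℂ) (N : ℕ) :
    ∫ τ in (0 : ℝ)..2 * Real.pi, ‖sliceCoeff a τ N‖ ^ 2 =
      2 * Real.pi * ∑ k ∈ Finset.HasAntidiagonal.antidiagonal N, ‖a k‖ ^ 2 := by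
  let c : ℕ → ℂ := fun k => if k ∈ Finset.range (N + 1) then a (N - k, k) else 0
  have hc : ∀ k ∉ Finset.range (N + 1), c k = 0 := fun k hk => if_neg hk
  have h := integral_norm_sq_tsum_mul_exp (a := c)
    (summable_of_ne_finset_zero (s := Finset.range (N + 1)) fun k hk => by rw [hc k hk, norm_zero])
  have h1 : ∀ τ : ℝ, ∑' n, c n * exp (n * τ * I) = sliceCoeff a τ N := by
    intro τ
    rw [tsum_eq_sum (s := Finset.range (N + 1)) fun k hk => by rw [hc k hk, zero_mul],
      sliceCoeff, ← Finset.Nat.sum_antidiagonal_swap,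
      Finset.Nat.sum_antidiagonal_eq_sum_range_succ_mk]
    refine Finset.sum_congr rfl fun k hk => ?_
    simp only [c, if_pos hk, Prod.swap]
  have h2 : ∑' n, ‖c n‖ ^ 2 = ∑ k ∈ Finset.HasAntidiagonal.antidiagonal N, ‖a k‖ ^ 2 := by
    rw [tsum_eq_sum (s := Finset.range (N + 1)) fun k hk => by rw [hc k hk]; simp,
      ← Finset.Nat.sum_antidiagonal_swap, Finset.Nat.sum_antidiagonal_eq_sum_range_succ_mk]
    refine Finset.sum_congr rfl fun k hk => ?_
    simp only [c, if_pos hk, Prod.swap]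
  simpa only [h1, h2] using h

/-- Tonelli over the total degree `N`. The identity lives in extended nonnegative reals so that it
can be used to prove that `a` is square-summable. -/
theorem lintegral_tsum_sq_sliceCoeff (a : ℕ × ℕ → ℂ) :
    ∫⁻ τ in Set.Ioc (0 : ℝ) (2 * Real.pi), ∑' N, ENNReal.ofReal (‖sliceCoeff a τ N‖ ^ 2) =
      ENNReal.ofReal (2 * Real.pi) * ∑' k, ENNReal.ofReal (‖a k‖ ^ 2) := by
  rw [lintegral_tsum fun N =>
    (measurable_norm_sq_sliceCoeff a N).aemeasurable]
  have h1 : ∀ N, ∫⁻ τ in Set.Ioc (0 : ℝ) (2 * Real.pi), ENNReal.ofReal (‖sliceCoeff a τ N‖ ^ 2) =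
      ENNReal.ofReal (2 * Real.pi) *
        ∑ k ∈ Finset.HasAntidiagonal.antidiagonal N, ENNReal.ofReal (‖a k‖ ^ 2) := by
    intro N
    have hInt : IntegrableOn (fun τ => ‖sliceCoeff a τ N‖ ^ 2)
        (Set.Ioc (0 : ℝ) (2 * Real.pi)) :=
      (((continuous_sliceCoeff a N).norm.pow 2).integrableOn_Icc).mono_set Set.Ioc_subset_Icc_self
    rw [← ofReal_integral_eq_lintegral_ofReal hInt (Eventually.of_forall fun _ => by positivity),
      ← intervalIntegral.integral_of_le Real.two_pi_pos.le, integral_norm_sq_sliceCoeff,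
      ENNReal.ofReal_mul Real.two_pi_pos.le,
      ENNReal.ofReal_sum_of_nonneg fun _ _ => by positivity]
  simp only [h1]
  rw [ENNReal.tsum_mul_left]
  congr 1
  rw [← (Finset.HasAntidiagonal.sigmaAntidiagonalEquivProd (A := ℕ)).tsum_eq fun k => ENNReal.ofReal (‖a k‖ ^ 2),
    ENNReal.tsum_sigma']
  refine tsum_congr fun N => ?_
  rw [tsum_fintype, Finset.univ_eq_attach, ← Finset.sum_attach]
  rfl

theorem H2.hasSum_norm_sq (f : H2) : HasSum (fun k => ‖f k‖ ^ 2) (‖f‖ ^ 2) := by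
  have := lp.hasSum_norm (p := 2) (by norm_num) f
  simpa using this

/-- A power series on the bidisk which on almost every slice `t ↦ (t, t e^{iτ})` is dominated near
the unit circle by `C` times a function in `H²(𝔻²)` belongs to `H²(𝔻²)`. -/
theorem exists_H2_of_slice_le {a : ℕ × ℕ → ℂ} (ha : AbsConv a) (g : H2) {C : ℝ} (hC : 0 ≤ C)
    (h : ∀ᵐ τ : ℝ, ∀ ε > 0, ∃ ρ < (1 : ℝ), ∀ t : ℂ, ρ < ‖t‖ → ‖t‖ < 1 →
      ‖powerSum a (t, t * exp (τ * I))‖ ≤ (C + ε) * ‖g.toFun (t, t * exp (τ * I))‖) :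
    ∃ f : H2, (f : ℕ × ℕ → ℂ) = a ∧ ‖f‖ ≤ C * ‖g‖ := by
  have hgsum : ∑' k, ENNReal.ofReal (‖g k‖ ^ 2) = ENNReal.ofReal (‖g‖ ^ 2) := by
    rw [← g.hasSum_norm_sq.tsum_eq, ENNReal.ofReal_tsum_of_nonneg (fun _ => by positivity)
      g.hasSum_norm_sq.summable]
  -- Since the average over `τ` is finite, almost every slice of `g` lies in the one-variable Hardy
  -- space, and there the one-variable comparison applies.
  have hgfin : ∀ᵐ τ ∂volume.restrict (Set.Ioc (0 : ℝ) (2 * Real.pi)),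
      ∑' N, ENNReal.ofReal (‖sliceCoeff g τ N‖ ^ 2) < ⊤ := by
    refine ae_lt_top ?_ ?_
    · exact Measurable.tsum fun N =>
        measurable_norm_sq_sliceCoeff g N
    · rw [lintegral_tsum_sq_sliceCoeff, hgsum]
      exact ENNReal.mul_ne_top ENNReal.ofReal_ne_top ENNReal.ofReal_ne_top
  have hle : ∀ᵐ τ ∂volume.restrict (Set.Ioc (0 : ℝ) (2 * Real.pi)),
      ∑' N, ENNReal.ofReal (‖sliceCoeff a τ N‖ ^ 2) ≤
        ENNReal.ofReal (C ^ 2) * ∑' N, ENNReal.ofReal (‖sliceCoeff g τ N‖ ^ 2) := by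
    filter_upwards [hgfin, ae_restrict_of_ae h] with τ hτ hτ'
    have hs : Summable fun N => ‖sliceCoeff g τ N‖ ^ 2 := by
      have := ENNReal.summable_toReal hτ.ne
      refine this.congr fun N => ENNReal.toReal_ofReal (by positivity)
    obtain ⟨h1, h2⟩ := summable_sq_of_norm_tsum_le (a := sliceCoeff a τ) (b := sliceCoeff g τ)
      (fun r hr hr1 => summable_norm_sliceCoeff ha τ hr hr1) hs hC
      (fun r hr hr1 => summable_norm_sliceCoeff (absConv_coe g) τ hr hr1) (fun ε hε => by
        obtain ⟨ρ, hρ, hb⟩ := hτ' ε hε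
        refine ⟨ρ, hρ, fun t ht ht1 => ?_⟩
        rw [← powerSum_slice ha τ ht1, ← powerSum_slice (absConv_coe g) τ ht1]
        exact hb t ht ht1)
    rw [← ENNReal.ofReal_tsum_of_nonneg (fun _ => by positivity) h1,
      ← ENNReal.ofReal_tsum_of_nonneg (fun _ => by positivity) hs,
      ← ENNReal.ofReal_mul (by positivity)]
    exact ENNReal.ofReal_le_ofReal h2
  have hInt := lintegral_mono_ae hle
  rw [lintegral_const_mul _ (Measurable.tsum fun N =>
        measurable_norm_sq_sliceCoeff g N),
    lintegral_tsum_sq_sliceCoeff, lintegral_tsum_sq_sliceCoeff, hgsum, mul_left_comm,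
    ENNReal.mul_le_mul_iff_right (by simpa using Real.pi_pos) ENNReal.ofReal_ne_top,
    ← ENNReal.ofReal_mul (by positivity)] at hInt
  have hs : Summable fun k => ‖a k‖ ^ 2 := by
    have := ENNReal.summable_toReal (ne_top_of_le_ne_top ENNReal.ofReal_ne_top hInt)
    refine this.congr fun N => ENNReal.toReal_ofReal (by positivity)
  rw [← ENNReal.ofReal_tsum_of_nonneg (fun _ => by positivity) hs,
    ENNReal.ofReal_le_ofReal_iff (by positivity)] at hInt
  let f : H2 := ⟨a, memℓp_gen (by simpa using hs)⟩
  refine ⟨f, rfl, ?_⟩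
  have h3 : ‖f‖ ^ 2 ≤ (C * ‖g‖) ^ 2 := by
    rw [← f.hasSum_norm_sq.tsum_eq, mul_pow]
    exact hInt
  exact le_of_sq_le_sq h3 (by positivity)

end Slices

/-! ### Cauchy integrals of `f / θ` in the second variable. -/

section Division

open Complex Metric

/-- A circle integral depending holomorphically on a parameter is holomorphic. -/
theorem differentiableOn_circleIntegral {U : Set ℂ} (hU : IsOpen U) {G : ℂ → ℂ → ℂ} {ρ : ℝ}
    (hρ : 0 < ρ) (hc : ContinuousOn (fun x : ℂ × ℂ => G x.1 x.2) (U ×ˢ sphere 0 ρ))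
    (hd : ∀ ζ ∈ sphere (0 : ℂ) ρ, DifferentiableOn ℂ (fun z => G z ζ) U) :
    DifferentiableOn ℂ (fun z => ∮ ζ in C(0, ρ), G z ζ) U := by
  intro z₀ hz₀
  refine DifferentiableAt.differentiableWithinAt ?_
  -- The factor 2 leaves room for a disk of radius `ε` about every point of `ball z₀ ε`, so that
  -- Cauchy's estimate bounds the derivative by `M / ε` uniformly.
  obtain ⟨ε, hε, hball⟩ : ∃ ε > 0, closedBall z₀ (2 * ε) ⊆ U := by
    obtain ⟨δ, hδ, h⟩ := nhds_basis_closedBall.mem_iff.1 (hU.mem_nhds hz₀)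
    exact ⟨δ / 2, half_pos hδ, by rwa [mul_div_cancel₀ δ two_ne_zero]⟩
  obtain ⟨M, hM⟩ := ((isCompact_closedBall z₀ (2 * ε)).prod
    (isCompact_sphere (0 : ℂ) ρ)).exists_bound_of_continuousOn
      (hc.mono (Set.prod_mono hball le_rfl))
  have hmem : ∀ s : ℝ, circleMap 0 ρ s ∈ sphere (0 : ℂ) ρ := circleMap_mem_sphere _ hρ.le
  have hcirc : ∀ z ∈ U, Continuous fun s : ℝ => G z (circleMap 0 ρ s) := by
    intro z hz
    exact hc.comp_continuous (by fun_prop : Continuous fun s : ℝ => (z, circleMap 0 ρ s))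
      fun s => ⟨hz, hmem s⟩
  have hF : ∀ z ∈ U, Continuous fun s : ℝ => deriv (circleMap 0 ρ) s • G z (circleMap 0 ρ s) := by
    intro z hz
    have h1 : Continuous fun s => deriv (circleMap 0 ρ) s := by
      simp only [deriv_circleMap]; fun_prop
    exact h1.smul (hcirc z hz)
  have hder : ∀ s : ℝ, ∀ z ∈ ball z₀ ε,
      ‖deriv (fun z => G z (circleMap 0 ρ s)) z‖ ≤ M / ε := by
    intro s z hz
    have hsub : closedBall z ε ⊆ closedBall z₀ (2 * ε) :=
      closedBall_subset_closedBall' (by have := mem_ball.1 hz; linarith)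
    refine norm_deriv_le_of_forall_mem_sphere_norm_le hε ?_ fun w hw =>
      hM (w, circleMap 0 ρ s) ⟨hsub (sphere_subset_closedBall hw), hmem s⟩
    refine DifferentiableOn.diffContOnCl ?_
    rw [closure_ball z hε.ne']
    exact (hd _ (hmem s)).mono (hsub.trans hball)
  have hballU : ball z₀ ε ⊆ U := fun z hz => hball (closedBall_subset_closedBall (by linarith)
    (ball_subset_closedBall hz))
  have hdiffAt : ∀ s : ℝ, ∀ z ∈ ball z₀ ε, HasDerivAt (fun z => G z (circleMap 0 ρ s))
      (deriv (fun z => G z (circleMap 0 ρ s)) z) z := fun s z hz =>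
    ((hd _ (hmem s)).differentiableAt (hU.mem_nhds (hballU hz))).hasDerivAt
  -- Joint regularity of the `z`-derivative is not assumed; it is measurable in `s` as a pointwise
  -- limit of continuous difference quotients.
  have hmeas : AEStronglyMeasurable (fun s : ℝ => deriv (circleMap 0 ρ) s •
      deriv (fun z => G z (circleMap 0 ρ s)) z₀)
      (volume.restrict (Set.uIoc (0 : ℝ) (2 * Real.pi))) := by
    obtain ⟨u, hu0, hu1, hu2⟩ : ∃ u : ℕ → ℂ, (∀ n, u n ≠ 0) ∧ (∀ n, z₀ + u n ∈ U) ∧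
        Tendsto u atTop (𝓝 0) := by
      refine ⟨fun n => ((ε / (n + 1) : ℝ) : ℂ), fun n => ?_, fun n => hball ?_, ?_⟩
      · exact ofReal_ne_zero.2 (by positivity)
      · rw [mem_closedBall, dist_self_add_left, norm_real, Real.norm_of_nonneg (by positivity)]
        refine (div_le_self hε.le (by linarith [n.cast_nonneg (α := ℝ)])).trans (by linarith)
      · rw [← ofReal_zero, tendsto_ofReal_iff]
        exact tendsto_const_div_atTop_nhds_zero_nat ε |>.comp (tendsto_add_atTop_nat 1) |>.congr
          fun n => by simp
    have h1 : Continuous fun s => deriv (circleMap 0 ρ) s := by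
      simp only [deriv_circleMap]; fun_prop
    suffices h2 : AEStronglyMeasurable (fun s : ℝ => deriv (fun z => G z (circleMap 0 ρ s)) z₀)
        (volume.restrict (Set.uIoc (0 : ℝ) (2 * Real.pi))) from h1.aestronglyMeasurable.smul h2
    refine aestronglyMeasurable_of_tendsto_ae atTop
      (f := fun n s => (u n)⁻¹ • (G (z₀ + u n) (circleMap 0 ρ s) - G z₀ (circleMap 0 ρ s)))
      (fun n => ?_) (Eventually.of_forall fun s => ?_)
    · have h3 : Continuous fun s : ℝ => (u n)⁻¹ •
          (G (z₀ + u n) (circleMap 0 ρ s) - G z₀ (circleMap 0 ρ s)) :=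
        ((hcirc _ (hu1 n)).sub (hcirc _ hz₀)).const_smul (u n)⁻¹
      exact h3.aestronglyMeasurable
    · have h1 := (hdiffAt s z₀ (mem_ball_self hε)).tendsto_slope_zero
      exact h1.comp (tendsto_nhdsWithin_iff.2 ⟨hu2, Eventually.of_forall hu0⟩)
  have := intervalIntegral.hasDerivAt_integral_of_dominated_loc_of_deriv_le
    (F := fun z s => deriv (circleMap 0 ρ) s • G z (circleMap 0 ρ s))
    (F' := fun z s => deriv (circleMap 0 ρ) s • deriv (fun z => G z (circleMap 0 ρ s)) z)
    (bound := fun _ => ρ * (M / ε)) (a := 0) (b := 2 * Real.pi) (μ := volume)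
    (ball_mem_nhds z₀ hε)
    (by filter_upwards [hU.mem_nhds hz₀] with z hz using (hF z hz).aestronglyMeasurable)
    ((hF z₀ hz₀).intervalIntegrable _ _) hmeas
    (Eventually.of_forall fun s _ z hz => by
      rw [norm_smul]
      have h1 : ‖deriv (circleMap 0 ρ) s‖ = ρ := by simp [abs_of_pos hρ]
      rw [h1]
      exact mul_le_mul_of_nonneg_left (hder s z hz) hρ.le)
    intervalIntegrable_const
    (Eventually.of_forall fun s _ z hz => by
      simpa only [smul_eq_mul] using (hdiffAt s z hz).const_mul _)
  exact this.2.differentiableAt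

/-- The zeros of a holomorphic function that does not vanish identically are countable. -/
theorem countable_zeros {g : ℂ → ℂ} {U : Set ℂ} (hg : DifferentiableOn ℂ g U) (hU : IsOpen U)
    (hconn : IsPreconnected U) (hne : ∃ x ∈ U, g x ≠ 0) : {x ∈ U | g x = 0}.Countable := by
  obtain ⟨x, hx, hgx⟩ := hne
  rcases (hg.analyticOnNhd hU).eqOn_zero_or_eventually_ne_zero_of_preconnected hconn with h | h
  · exact absurd (h hx) hgx
  · have h1 : ({x | g x = 0}ᶜ) ∈ codiscreteWithin U := h
    have h2 := (HereditarilyLindelofSpace.isLindelof _).countable_of_isDiscrete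
      (isDiscrete_of_codiscreteWithin h1)
    refine h2.mono fun y hy => ?_
    exact ⟨hy.2, hy.1⟩

/-- The moduli of the countably many zeros cannot fill an interval. -/
theorem exists_radius_ne_zero {g : ℂ → ℂ} (hg : DifferentiableOn ℂ g (ball 0 1))
    (hne : ∃ x ∈ ball (0 : ℂ) 1, g x ≠ 0) {ρ₁ : ℝ} (h1 : ρ₁ < 1) :
    ∃ ρ, ρ₁ < ρ ∧ ρ < 1 ∧ ∀ ζ ∈ sphere (0 : ℂ) ρ, g ζ ≠ 0 := by
  have hZ := (countable_zeros hg isOpen_ball (convex_ball 0 1).isPreconnected hne).image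
    (fun x => ‖x‖)
  obtain ⟨ρ, hρ, hρ'⟩ := (hZ.dense_compl ℝ).exists_mem_open isOpen_Ioo (Set.nonempty_Ioo.2 h1)
  refine ⟨ρ, hρ'.1, hρ'.2, fun ζ hζ h => hρ ⟨ζ, ⟨?_, h⟩, mem_sphere_zero_iff_norm.1 hζ⟩⟩
  rw [mem_ball_zero_iff, mem_sphere_zero_iff_norm.1 hζ]
  exact hρ'.2

/-- `F` is continuous on the bidisk and holomorphic in each variable. -/
structure SepHolo (F : ℂ × ℂ → ℂ) : Prop where
  cont : ContinuousOn F bidisk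
  left : ∀ w ∈ ball (0 : ℂ) 1, DifferentiableOn ℂ (fun z => F (z, w)) (ball 0 1)
  right : ∀ z ∈ ball (0 : ℂ) 1, DifferentiableOn ℂ (fun w => F (z, w)) (ball 0 1)

theorem isOpen_bidisk : IsOpen bidisk := isOpen_ball.prod isOpen_ball

/-- The circle of radius `ρ` is free of zeros of `θ (z, ·)`. -/
def GoodRadius (θ : ℂ × ℂ → ℂ) (ρ : ℝ) (z : ℂ) : Prop :=
  0 < ρ ∧ ρ < 1 ∧ ∀ ζ ∈ sphere (0 : ℂ) ρ, θ (z, ζ) ≠ 0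

/-- The coefficients of the Cauchy integral over the circle of radius `ρ` of `f / θ`. -/
def cauchyCoeff (f θ : ℂ × ℂ → ℂ) (ρ : ℝ) (k : ℕ) (z : ℂ) : ℂ :=
  cauchyPowerSeries (fun ζ => f (z, ζ) / θ (z, ζ)) 0 ρ k fun _ => 1

variable {f θ : ℂ × ℂ → ℂ} {ρ : ℝ}

theorem sphere_subset_ball_one (hρ : ρ < 1) : sphere (0 : ℂ) ρ ⊆ ball 0 1 := fun ζ hζ => by
  rw [mem_ball_zero_iff, mem_sphere_zero_iff_norm.1 hζ]; exact hρ

/-- By the tube lemma, a zero-free circle stays zero-free under small changes of `z`. -/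
theorem GoodRadius.exists_ball (hθ : SepHolo θ) {z₀ : ℂ} (hz₀ : z₀ ∈ ball (0 : ℂ) 1)
    (h : GoodRadius θ ρ z₀) :
    ∃ ε > 0, ball z₀ ε ⊆ ball 0 1 ∧ ∀ z ∈ ball z₀ ε, GoodRadius θ ρ z := by
  have hopen : IsOpen (bidisk ∩ θ ⁻¹' {0}ᶜ) :=
    hθ.cont.isOpen_inter_preimage isOpen_bidisk isOpen_compl_singleton
  obtain ⟨u, v, hu, -, hzu, hv, huv⟩ := generalized_tube_lemma (isCompact_singleton (x := z₀))
    (isCompact_sphere (0 : ℂ) ρ) hopen (by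
      rintro ⟨z, ζ⟩ ⟨hz, hζ⟩
      rw [Set.mem_singleton_iff] at hz
      simp only at hz hζ
      subst hz
      exact ⟨⟨hz₀, sphere_subset_ball_one h.2.1 hζ⟩, h.2.2 ζ hζ⟩)
  obtain ⟨ε, hε, hsub⟩ := Metric.isOpen_iff.1 (hu.inter isOpen_ball) z₀
    ⟨hzu (Set.mem_singleton z₀), hz₀⟩
  exact ⟨ε, hε, fun z hz => (hsub hz).2, fun z hz => ⟨h.1, h.2.1, fun ζ hζ =>
    (huv (⟨(hsub hz).1, hv hζ⟩ : (z, ζ) ∈ u ×ˢ v)).2⟩⟩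

theorem continuousOn_div_prod_sphere (hf : SepHolo f) (hθ : SepHolo θ) {U : Set ℂ}
    (hU : U ⊆ ball 0 1) (hρ : ρ < 1) (hgood : ∀ z ∈ U, GoodRadius θ ρ z) :
    ContinuousOn (fun x : ℂ × ℂ => f (x.1, x.2) / θ (x.1, x.2)) (U ×ˢ sphere 0 ρ) := by
  have hsub : U ×ˢ sphere (0 : ℂ) ρ ⊆ bidisk := Set.prod_mono hU (sphere_subset_ball_one hρ)
  exact (hf.cont.mono hsub).div (hθ.cont.mono hsub) fun x hx => (hgood x.1 hx.1).2.2 x.2 hx.2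

theorem differentiableOn_cauchyCoeff (hf : SepHolo f) (hθ : SepHolo θ) {U : Set ℂ}
    (hUo : IsOpen U) (hU : U ⊆ ball 0 1) (hρ0 : 0 < ρ) (hρ : ρ < 1)
    (hgood : ∀ z ∈ U, GoodRadius θ ρ z) (k : ℕ) :
    DifferentiableOn ℂ (cauchyCoeff f θ ρ k) U := by
  unfold cauchyCoeff
  simp only [cauchyPowerSeries_apply, smul_eq_mul, sub_zero]
  refine DifferentiableOn.const_mul ?_ _
  refine differentiableOn_circleIntegral
    (G := fun z ζ => (1 / ζ) ^ k * (ζ⁻¹ * (f (z, ζ) / θ (z, ζ)))) hUo hρ0 ?_ fun ζ hζ => ?_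
  · have h1 : ContinuousOn (fun x : ℂ × ℂ => x.2⁻¹) (U ×ˢ sphere 0 ρ) := by
      refine continuousOn_snd.inv₀ fun x hx h0 => ?_
      have := mem_sphere_zero_iff_norm.1 hx.2
      rw [h0, norm_zero] at this
      exact hρ0.ne this
    simp only [one_div]
    exact (h1.pow k).mul (h1.mul (continuousOn_div_prod_sphere hf hθ hU hρ hgood))
  · refine DifferentiableOn.const_mul (DifferentiableOn.const_mul ?_ _) _
    have hζ' := sphere_subset_ball_one hρ hζ
    exact ((hf.left ζ hζ').mono hU).div ((hθ.left ζ hζ').mono hU) fun z hz =>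
      (hgood z hz).2.2 ζ hζ

theorem exists_ball_norm_cauchyCoeff_le (hf : SepHolo f) (hθ : SepHolo θ) {z₀ : ℂ}
    (hz₀ : z₀ ∈ ball (0 : ℂ) 1) (h : GoodRadius θ ρ z₀) :
    ∃ ε > 0, ∃ M : ℝ, ball z₀ ε ⊆ ball 0 1 ∧ ∀ z ∈ ball z₀ ε, GoodRadius θ ρ z ∧
      ∀ k, ‖cauchyCoeff f θ ρ k z‖ ≤ M * ρ⁻¹ ^ k := by
  obtain ⟨ε, hε, hsub, hgood⟩ := h.exists_ball hθ hz₀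
  have hcb : closedBall z₀ (ε / 2) ⊆ ball z₀ ε := closedBall_subset_ball (half_lt_self hε)
  obtain ⟨M, hM⟩ := ((isCompact_closedBall z₀ (ε / 2)).prod
    (isCompact_sphere (0 : ℂ) ρ)).exists_bound_of_continuousOn
      (continuousOn_div_prod_sphere hf hθ (hcb.trans hsub) h.2.1 fun z hz => hgood z (hcb hz))
  refine ⟨ε / 2, half_pos hε, M, (ball_subset_closedBall.trans hcb).trans hsub,
    fun z hz => ⟨hgood z (hcb (ball_subset_closedBall hz)), fun k => ?_⟩⟩
  have h1 := norm_cauchyPowerSeries_le (fun ζ => f (z, ζ) / θ (z, ζ)) 0 ρ k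
  have h2 : ‖cauchyCoeff f θ ρ k z‖ ≤
      ‖cauchyPowerSeries (fun ζ => f (z, ζ) / θ (z, ζ)) 0 ρ k‖ := by
    refine (ContinuousMultilinearMap.le_opNorm
      (cauchyPowerSeries (fun ζ => f (z, ζ) / θ (z, ζ)) 0 ρ k) _).trans ?_
    simp
  refine h2.trans (h1.trans ?_)
  rw [abs_of_pos h.1]
  have hpos := h.1
  gcongr
  have h3 : ∫ s in (0 : ℝ)..2 * Real.pi,
      ‖f (z, circleMap 0 ρ s) / θ (z, circleMap 0 ρ s)‖ ≤ ∫ s in (0 : ℝ)..2 * Real.pi, M := by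
    refine intervalIntegral.integral_mono_on Real.two_pi_pos.le ?_ intervalIntegrable_const
      fun s _ => hM (z, circleMap 0 ρ s) ⟨ball_subset_closedBall hz, circleMap_mem_sphere _ h.1.le s⟩
    have hc := continuousOn_div_prod_sphere hf hθ (hcb.trans hsub) h.2.1
      fun z hz => hgood z (hcb hz)
    exact (hc.comp_continuous (by fun_prop : Continuous fun s : ℝ => (z, circleMap 0 ρ s))
      fun s => ⟨ball_subset_closedBall hz, circleMap_mem_sphere _ h.1.le s⟩).norm.intervalIntegrable
        _ _
  rw [intervalIntegral.integral_const, smul_eq_mul, sub_zero] at h3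
  have := Real.two_pi_pos
  calc (2 * Real.pi)⁻¹ * ∫ s in (0 : ℝ)..2 * Real.pi,
        ‖f (z, circleMap 0 ρ s) / θ (z, circleMap 0 ρ s)‖
      ≤ (2 * Real.pi)⁻¹ * (2 * Real.pi * M) := by gcongr
    _ = M := by field_simp

/-- On a zero-free circle `f / θ` equals `g`, so its Cauchy coefficients are the Taylor coefficients
of `g`. In particular they do not depend on the radius. -/
theorem hasFPowerSeriesOnBall_of_eq_mul {z : ℂ} (h : GoodRadius θ ρ z) {g : ℂ → ℂ}
    (hg : DifferentiableOn ℂ g (ball 0 1))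
    (hfg : ∀ w ∈ ball (0 : ℂ) 1, f (z, w) = θ (z, w) * g w) :
    HasFPowerSeriesOnBall g (cauchyPowerSeries (fun ζ => f (z, ζ) / θ (z, ζ)) 0 ρ) 0
      (ENNReal.ofReal ρ) := by
  have heq : cauchyPowerSeries (fun ζ => f (z, ζ) / θ (z, ζ)) 0 ρ = cauchyPowerSeries g 0 ρ := by
    ext n : 1
    unfold cauchyPowerSeries
    congr 2
    refine circleIntegral.integral_congr h.1.le fun ζ hζ => ?_
    simp only
    rw [hfg ζ (sphere_subset_ball_one h.2.1 hζ), mul_div_cancel_left₀ _ (h.2.2 ζ hζ)]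
  rw [heq]
  have h1 := DifferentiableOn.hasFPowerSeriesOnBall (R := ρ.toNNReal) (c := 0) (f := g)
    (hg.mono (by rw [Real.coe_toNNReal _ h.1.le]; exact closedBall_subset_ball h.2.1))
    (by simpa using h.1)
  rwa [Real.coe_toNNReal _ h.1.le] at h1

theorem cauchyPowerSeries_apply_eq (k : ℕ) (z w : ℂ) :
    (cauchyPowerSeries (fun ζ => f (z, ζ) / θ (z, ζ)) 0 ρ k fun _ => w) =
      cauchyCoeff f θ ρ k z * w ^ k := by
  have := (cauchyPowerSeries (fun ζ => f (z, ζ) / θ (z, ζ)) 0 ρ k).map_smul_univ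
    (fun _ => w) (fun _ => 1)
  simp only [smul_eq_mul, mul_one, Finset.prod_const, Finset.card_univ, Fintype.card_fin] at this
  rw [this, cauchyCoeff, mul_comm]

end Division

/-! ### The division theorem on the bidisk. -/

section PowerSeries

open Complex Metric

/-- Functions holomorphic in `z` with Cauchy type bounds are the `w`-coefficients of an absolutely
convergent double power series. -/
theorem exists_powerSum_eq_tsum {a : ℕ → ℂ → ℂ}
    (hd : ∀ k, DifferentiableOn ℂ (a k) (ball 0 1))
    (hb : ∀ r : ℝ, 0 < r → r < 1 → ∃ M : ℝ, ∀ z : ℂ, ‖z‖ ≤ r → ∀ k, ‖a k z‖ ≤ M * r⁻¹ ^ k) :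
    ∃ b : ℕ × ℕ → ℂ, AbsConv b ∧
      ∀ x ∈ bidisk, powerSum b x = ∑' k, a k x.1 * x.2 ^ k := by
  let b : ℕ × ℕ → ℂ := fun i => (i.1.factorial : ℂ)⁻¹ * iteratedDeriv i.1 (a i.2) 0
  have hconv : AbsConv b := by
    intro r hr hr1
    obtain ⟨R, hR, hR1⟩ := exists_between hr1
    have hR0 : 0 < R := hr.trans_lt hR
    obtain ⟨M, hM⟩ := hb R hR0 hR1
    have hbound : ∀ i, ‖b i‖ ≤ M * R⁻¹ ^ i.1 * R⁻¹ ^ i.2 := by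
      intro i
      have h1 := norm_iteratedDeriv_le_of_forall_mem_sphere_norm_le (c := 0) (R := R)
        (C := M * R⁻¹ ^ i.2) (f := a i.2) i.1 hR0
        (((hd i.2).mono (by
          rw [closure_ball _ hR0.ne']
          exact closedBall_subset_ball hR1)).diffContOnCl)
        (fun z hz => hM z (mem_sphere_zero_iff_norm.1 hz).le i.2)
      simp only [b]
      rw [norm_mul, norm_inv, norm_natCast]
      have hf : (0 : ℝ) < i.1.factorial := by positivity
      rw [inv_mul_le_iff₀ hf]
      refine h1.trans (le_of_eq ?_)
      rw [inv_pow, inv_pow]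
      field_simp
    have hq : r / R < 1 := (div_lt_one hR0).2 hR
    have hq0 : 0 ≤ r / R := by positivity
    have hs : Summable fun k : ℕ × ℕ => (r / R) ^ k.1 * (r / R) ^ k.2 :=
      (summable_geometric_of_lt_one hq0 hq).mul_of_nonneg (summable_geometric_of_lt_one hq0 hq)
        (fun _ => by positivity) (fun _ => by positivity)
    refine Summable.of_nonneg_of_le (fun _ => by positivity) (fun k => ?_) (hs.mul_left M)
    refine (mul_le_mul_of_nonneg_right (hbound k) (by positivity)).trans (le_of_eq ?_)
    rw [pow_add, div_pow, div_pow, inv_pow, inv_pow]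
    field_simp
  refine ⟨b, hconv, fun x hx => ?_⟩
  have hs := (hconv.summable_norm hx).of_norm
  rw [powerSum, ← (Equiv.prodComm ℕ ℕ).tsum_eq]
  have hs' := (Equiv.prodComm ℕ ℕ).summable_iff.2 hs
  refine (hs'.tsum_prod' fun k => hs'.prod_factor k).trans ?_
  refine tsum_congr fun k => ?_
  rw [← taylorSeries_eq_on_ball' hx.1 (hd k), ← tsum_mul_right]
  refine tsum_congr fun j => ?_
  simp only [b, Function.comp, Equiv.prodComm_apply, Prod.swap, sub_zero]
  ring

/-- **Division on the bidisk**: if `θ (z, ·)` divides `f (z, ·)` for a dense set of `z`, then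
`f / θ` is given by a convergent power series. -/
theorem exists_powerSum_mul_eq {f θ : ℂ × ℂ → ℂ} (hf : SepHolo f) (hθ : SepHolo θ)
    (hne : ∀ z ∈ ball (0 : ℂ) 1, ∃ w ∈ ball (0 : ℂ) 1, θ (z, w) ≠ 0) {S : Set ℂ}
    (hS : ball 0 1 ⊆ closure S)
    (hdiv : ∀ z ∈ S ∩ ball 0 1, ∃ g : ℂ → ℂ, DifferentiableOn ℂ g (ball 0 1) ∧
      ∀ w ∈ ball (0 : ℂ) 1, f (z, w) = θ (z, w) * g w) :
    ∃ b : ℕ × ℕ → ℂ, AbsConv b ∧ ∀ x ∈ bidisk, θ x * powerSum b x = f x := by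
  have hgood : ∀ z ∈ ball (0 : ℂ) 1, ∀ ρ₁ : ℝ, 0 ≤ ρ₁ → ρ₁ < 1 →
      ∃ ρ, ρ₁ < ρ ∧ GoodRadius θ ρ z := by
    intro z hz ρ₁ h0 h1
    obtain ⟨ρ, h2, h3, h4⟩ := exists_radius_ne_zero (hθ.right z hz) (hne z hz) h1
    exact ⟨ρ, h2, h0.trans_lt h2, h3, h4⟩
  have hdense : ∀ z₀, ∀ ε : ℝ, ball z₀ ε ⊆ ball 0 1 → ball z₀ ε ⊆ closure (S ∩ ball z₀ ε) := by
    intro z₀ ε hsub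
    have h1 := isOpen_ball.inter_closure (s := ball z₀ ε) (t := S)
    intro z hz
    have := h1 ⟨hz, hS (hsub hz)⟩
    rwa [Set.inter_comm] at this
  -- The coefficients for two radii agree at nearby points of `S`, where the quotient exists, and
  -- then at `z` by continuity and density. This makes the local Cauchy coefficients into global
  -- holomorphic functions `a k`.
  have hind : ∀ z ∈ ball (0 : ℂ) 1, ∀ ρ ρ', GoodRadius θ ρ z → GoodRadius θ ρ' z →
      ∀ k, cauchyCoeff f θ ρ k z = cauchyCoeff f θ ρ' k z := by
    intro z hz ρ ρ' h h' k
    obtain ⟨ε₁, hε₁, hs₁, hg₁⟩ := h.exists_ball hθ hz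
    obtain ⟨ε₂, hε₂, -, hg₂⟩ := h'.exists_ball hθ hz
    have hb₁ : ball z (min ε₁ ε₂) ⊆ ball z ε₁ := ball_subset_ball (min_le_left _ _)
    have hb₂ : ball z (min ε₁ ε₂) ⊆ ball z ε₂ := ball_subset_ball (min_le_right _ _)
    have heq : Set.EqOn (cauchyCoeff f θ ρ k) (cauchyCoeff f θ ρ' k)
        (S ∩ ball z (min ε₁ ε₂)) := by
      intro y hy
      obtain ⟨g, hg, hfg⟩ := hdiv y ⟨hy.1, hs₁ (hb₁ hy.2)⟩
      have e1 := (hasFPowerSeriesOnBall_of_eq_mul (hg₁ y (hb₁ hy.2)) hg hfg).hasFPowerSeriesAt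
      have e2 := (hasFPowerSeriesOnBall_of_eq_mul (hg₂ y (hb₂ hy.2)) hg hfg).hasFPowerSeriesAt
      unfold cauchyCoeff
      rw [e1.eq_formalMultilinearSeries e2]
    refine heq.of_subset_closure
      (differentiableOn_cauchyCoeff hf hθ isOpen_ball (hb₁.trans hs₁) h.1 h.2.1
        (fun y hy => hg₁ y (hb₁ hy)) k).continuousOn
      (differentiableOn_cauchyCoeff hf hθ isOpen_ball (hb₁.trans hs₁) h'.1 h'.2.1
        (fun y hy => hg₂ y (hb₂ hy)) k).continuousOn Set.inter_subset_right
      (hdense z _ (hb₁.trans hs₁)) (mem_ball_self (lt_min hε₁ hε₂))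
  choose! R hR using fun z hz => hgood z hz 0 le_rfl one_pos
  let a : ℕ → ℂ → ℂ := fun k z => cauchyCoeff f θ (R z) k z
  have ha : ∀ z ∈ ball (0 : ℂ) 1, ∀ ρ, GoodRadius θ ρ z → ∀ k, a k z = cauchyCoeff f θ ρ k z :=
    fun z hz ρ h k => hind z hz _ _ (hR z hz).2 h k
  have hd : ∀ k, DifferentiableOn ℂ (a k) (ball 0 1) := by
    intro k z hz
    obtain ⟨ε, hε, hs, hg⟩ := (hR z hz).2.exists_ball hθ hz
    have h1 := differentiableOn_cauchyCoeff hf hθ isOpen_ball hs (hR z hz).2.1 (hR z hz).2.2.1 hg k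
    have h2 := h1.differentiableAt (ball_mem_nhds z hε)
    refine DifferentiableAt.differentiableWithinAt (h2.congr_of_eventuallyEq ?_)
    filter_upwards [ball_mem_nhds z hε] with y hy using ha y (hs hy) _ (hg y hy) k
  have hb : ∀ r : ℝ, 0 < r → r < 1 → ∃ M : ℝ, ∀ z : ℂ, ‖z‖ ≤ r → ∀ k,
      ‖a k z‖ ≤ M * r⁻¹ ^ k := by
    intro r hr hr1
    -- Near each point a good radius `ρ > r` gives the bound `M ρ⁻¹ ^ k ≤ M r⁻¹ ^ k`; compactness of
    -- the closed disk yields one constant.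
    have : ∃ M : ℝ, ∀ z ∈ closedBall (0 : ℂ) r, ∀ k, ‖a k z‖ ≤ M * r⁻¹ ^ k := by
      refine (isCompact_closedBall (0 : ℂ) r).induction_on
        (p := fun s => ∃ M : ℝ, ∀ z ∈ s, ∀ k, ‖a k z‖ ≤ M * r⁻¹ ^ k)
        ⟨0, fun z hz => absurd hz (Set.notMem_empty z)⟩
        (fun s t hst ⟨M, hM⟩ => ⟨M, fun z hz => hM z (hst hz)⟩) ?_ fun z₀ hz₀ => ?_
      · rintro s t ⟨M, hM⟩ ⟨M', hM'⟩
        refine ⟨max M M', fun z hz k => ?_⟩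
        rcases hz with hz | hz
        · exact (hM z hz k).trans (by gcongr; exact le_max_left _ _)
        · exact (hM' z hz k).trans (by gcongr; exact le_max_right _ _)
      · have hz₁ : z₀ ∈ ball (0 : ℂ) 1 := closedBall_subset_ball hr1 hz₀
        obtain ⟨ρ, hρ, hg⟩ := hgood z₀ hz₁ r hr.le hr1
        obtain ⟨ε, hε, M, hs, hM⟩ := exists_ball_norm_cauchyCoeff_le hf hθ hz₁ hg
        refine ⟨ball z₀ ε, mem_nhdsWithin_of_mem_nhds (ball_mem_nhds z₀ hε), M,
          fun z hz k => ?_⟩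
        rw [ha z (hs hz) ρ (hM z hz).1 k]
        have hM0 : 0 ≤ M := by
          have := (norm_nonneg _).trans ((hM z hz).2 0)
          simpa using this
        have hρ0 : 0 < ρ := hg.1
        refine ((hM z hz).2 k).trans ?_
        gcongr
    obtain ⟨M, hM⟩ := this
    exact ⟨M, fun z hz => hM z (mem_closedBall_zero_iff.2 hz)⟩
  obtain ⟨b, hbc, hbs⟩ := exists_powerSum_eq_tsum hd hb
  refine ⟨b, hbc, fun x hx => ?_⟩
  rw [hbs x hx]
  obtain ⟨z₀, w⟩ := x
  obtain ⟨hz₀, hw⟩ := hx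
  simp only at hz₀ hw ⊢
  have hw1 := mem_ball_zero_iff.1 hw
  obtain ⟨ρ, hρ, hg⟩ := hgood z₀ hz₀ ‖w‖ (norm_nonneg _) hw1
  obtain ⟨ε, hε, M, hs, hM⟩ := exists_ball_norm_cauchyCoeff_le hf hθ hz₀ hg
  have hρ0 : 0 < ρ := hg.1
  -- With a fixed radius `ρ > ‖w‖` the product formula holds at points of `S` near `z₀` and passes
  -- to `z₀` by continuity.
  have heq : Set.EqOn (fun z => θ (z, w) * ∑' k, cauchyCoeff f θ ρ k z * w ^ k)
      (fun z => f (z, w)) (S ∩ ball z₀ ε) := by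
    intro z hz
    obtain ⟨g, hgd, hfg⟩ := hdiv z ⟨hz.1, hs hz.2⟩
    have h1 := (hasFPowerSeriesOnBall_of_eq_mul (hM z hz.2).1 hgd hfg).hasSum (y := w) (by
      rw [eball_ofReal, mem_ball_zero_iff]; exact hρ)
    simp only [cauchyPowerSeries_apply_eq, zero_add] at h1
    simp only
    rw [h1.tsum_eq, hfg w hw]
  have hcont : ContinuousOn (fun z => θ (z, w) * ∑' k, cauchyCoeff f θ ρ k z * w ^ k)
      (ball z₀ ε) := by
    refine ((hθ.left w hw).continuousOn.mono hs).mul ?_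
    refine continuousOn_tsum (u := fun k => M * (‖w‖ / ρ) ^ k) (fun k => ?_) ?_ fun k z hz => ?_
    · exact (differentiableOn_cauchyCoeff hf hθ isOpen_ball hs hg.1 hg.2.1
        (fun z hz => (hM z hz).1) k).continuousOn.mul continuousOn_const
    · exact (summable_geometric_of_lt_one (by positivity) ((div_lt_one hρ0).2 hρ)).mul_left M
    · rw [norm_mul, norm_pow, div_eq_mul_inv, mul_pow, mul_comm (‖w‖ ^ k), ← mul_assoc]
      exact mul_le_mul_of_nonneg_right ((hM z hz).2 k) (by positivity)
  have := heq.of_subset_closure hcont ((hf.left w hw).continuousOn.mono hs)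
    Set.inter_subset_right (hdense z₀ ε hs) (mem_ball_self hε)
  refine Eq.trans ?_ this
  simp only
  congr 1
  exact tsum_congr fun k => by rw [ha z₀ hz₀ ρ hg k]

end PowerSeries

/-! ### Holomorphic multipliers and division within `H²(𝔻²)`. -/

section Multipliers

open Complex Metric

theorem AbsConv.sepHolo {a : ℕ × ℕ → ℂ} (ha : AbsConv a) : SepHolo (powerSum a) := by
  have hbound : ∀ r : ℝ, ∀ x : ℂ × ℂ, ‖x.1‖ ≤ r → ‖x.2‖ ≤ r → ∀ k : ℕ × ℕ,
      ‖a k * (x.1 ^ k.1 * x.2 ^ k.2)‖ ≤ ‖a k‖ * r ^ (k.1 + k.2) := by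
    intro r x h1 h2 k
    rw [norm_mul, norm_mul, norm_pow, norm_pow, pow_add]
    have : 0 ≤ r := (norm_nonneg _).trans h1
    gcongr
  refine ⟨fun x hx => ?_, fun w hw z hz => ?_, fun z hz w hw => ?_⟩
  · obtain ⟨r, hr, hr1⟩ := exists_between
      (max_lt (mem_ball_zero_iff.1 hx.1) (mem_ball_zero_iff.1 hx.2))
    have hcont : ContinuousOn (powerSum a) (ball 0 r ×ˢ ball 0 r) :=
      continuousOn_tsum (fun k => by fun_prop)
        (ha r ((le_max_of_le_left (norm_nonneg _)).trans hr.le) hr1) fun k y hy =>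
        hbound r y (mem_ball_zero_iff.1 hy.1).le (mem_ball_zero_iff.1 hy.2).le k
    refine (hcont.continuousAt ?_).continuousWithinAt
    exact (isOpen_ball.prod isOpen_ball).mem_nhds
      ⟨mem_ball_zero_iff.2 ((le_max_left _ _).trans_lt hr),
        mem_ball_zero_iff.2 ((le_max_right _ _).trans_lt hr)⟩
  · obtain ⟨r, hr, hr1⟩ := exists_between
      (max_lt (mem_ball_zero_iff.1 hz) (mem_ball_zero_iff.1 hw))
    have hd : DifferentiableOn ℂ (fun z => ∑' k : ℕ × ℕ, a k * (z ^ k.1 * w ^ k.2)) (ball 0 r) :=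
      differentiableOn_tsum_of_summable_norm
        (ha r ((le_max_of_le_left (norm_nonneg _)).trans hr.le) hr1) (fun k => by fun_prop)
        isOpen_ball fun k y hy => hbound r (y, w) (mem_ball_zero_iff.1 hy).le
          ((le_max_right _ _).trans_lt hr).le k
    exact (hd.differentiableAt (isOpen_ball.mem_nhds (mem_ball_zero_iff.2
      ((le_max_left _ _).trans_lt hr)))).differentiableWithinAt
  · obtain ⟨r, hr, hr1⟩ := exists_between
      (max_lt (mem_ball_zero_iff.1 hz) (mem_ball_zero_iff.1 hw))
    have hd : DifferentiableOn ℂ (fun w => ∑' k : ℕ × ℕ, a k * (z ^ k.1 * w ^ k.2)) (ball 0 r) :=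
      differentiableOn_tsum_of_summable_norm
        (ha r ((le_max_of_le_left (norm_nonneg _)).trans hr.le) hr1) (fun k => by fun_prop)
        isOpen_ball fun k y hy => hbound r (z, y) ((le_max_left _ _).trans_lt hr).le
          (mem_ball_zero_iff.1 hy).le k
    exact (hd.differentiableAt (isOpen_ball.mem_nhds (mem_ball_zero_iff.2
      ((le_max_right _ _).trans_lt hr)))).differentiableWithinAt

theorem H2.sepHolo (f : H2) : SepHolo f.toFun := (absConv_coe f).sepHolo

theorem SepHolo.mul {F G : ℂ × ℂ → ℂ} (hF : SepHolo F) (hG : SepHolo G) :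
    SepHolo fun x => F x * G x :=
  ⟨hF.cont.mul hG.cont, fun w hw => (hF.left w hw).mul (hG.left w hw),
    fun z hz => (hF.right z hz).mul (hG.right z hz)⟩

theorem sepHolo_one : SepHolo fun _ => 1 :=
  ⟨continuousOn_const, fun _ _ => differentiableOn_const _, fun _ _ => differentiableOn_const _⟩

theorem sepHolo_of_differentiableOn {F : ℂ × ℂ → ℂ} (hF : DifferentiableOn ℂ F bidisk) :
    SepHolo F :=
  ⟨hF.continuousOn,
    fun w hw => hF.comp (f := fun z : ℂ => (z, w)) (by fun_prop) fun z hz => ⟨hz, hw⟩,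
    fun z hz => hF.comp (f := fun w : ℂ => (z, w)) (by fun_prop) fun w hw => ⟨hz, hw⟩⟩

theorem SepHolo.freeze {F : ℂ × ℂ → ℂ} (hF : SepHolo F) {c : ℂ} (hc : c ∈ ball (0 : ℂ) 1) :
    SepHolo fun x => F (c, x.2) :=
  ⟨(hF.right c hc).continuousOn.comp continuousOn_snd fun _ hx => hx.2,
    fun w _ => differentiableOn_const (F (c, w)), fun _ _ => hF.right c hc⟩

/-- Osgood's lemma, read off from the division theorem with denominator 1. -/
theorem SepHolo.exists_powerSum {F : ℂ × ℂ → ℂ} (hF : SepHolo F) :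
    ∃ b : ℕ × ℕ → ℂ, AbsConv b ∧ ∀ x ∈ bidisk, powerSum b x = F x := by
  obtain ⟨b, hb, h⟩ := exists_powerSum_mul_eq hF sepHolo_one (S := Set.univ)
    (fun _ _ => ⟨0, mem_ball_self one_pos, one_ne_zero⟩) (by simp)
    (fun z hz => ⟨fun w => F (z, w), hF.right z hz.2, fun w _ => (one_mul _).symm⟩)
  exact ⟨b, hb, fun x hx => by rw [← h x hx, one_mul]⟩

theorem H2.toFun_add (f g : H2) {x : ℂ × ℂ} (hx : x ∈ bidisk) :
    (f + g).toFun x = f.toFun x + g.toFun x := by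
  simp only [H2.toFun]
  rw [← (f.summable hx).tsum_add (g.summable hx)]
  exact tsum_congr fun k => by rw [lp.coeFn_add, Pi.add_apply, add_mul]

theorem H2.toFun_smul (c : ℂ) (f : H2) (x : ℂ × ℂ) : (c • f).toFun x = c * f.toFun x := by
  simp only [H2.toFun]
  rw [← tsum_mul_left]
  exact tsum_congr fun k => by rw [lp.coeFn_smul, Pi.smul_apply, smul_eq_mul, mul_assoc]

theorem H2.toFun_sub (f g : H2) {x : ℂ × ℂ} (hx : x ∈ bidisk) :
    (f - g).toFun x = f.toFun x - g.toFun x := by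
  rw [sub_eq_add_neg, H2.toFun_add _ _ hx, ← neg_one_smul ℂ g, H2.toFun_smul]
  ring

theorem H2.toFun_zero (x : ℂ × ℂ) : (0 : H2).toFun x = 0 := by simp [H2.toFun]

/-- If `F` is bounded below by `1 / C` near the boundary of almost all slices, division by `F` does
not lead out of `H²(𝔻²)`. -/
theorem exists_H2_of_mul_eq {F : ℂ × ℂ → ℂ} {C : ℝ} (hC : 0 ≤ C)
    (hF : ∀ᵐ τ : ℝ, ∀ ε > 0, ∃ ρ < (1 : ℝ), ∀ t : ℂ, ρ < ‖t‖ → ‖t‖ < 1 →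
      1 ≤ (C + ε) * ‖F (t, t * exp (τ * I))‖)
    {b : ℕ × ℕ → ℂ} (hb : AbsConv b) (f : H2) (hbf : ∀ x ∈ bidisk, F x * powerSum b x = f.toFun x) :
    ∃ h : H2, (h : ℕ × ℕ → ℂ) = b ∧ ‖h‖ ≤ C * ‖f‖ := by
  refine exists_H2_of_slice_le hb f hC ?_
  filter_upwards [hF] with τ hτ ε hε
  obtain ⟨ρ, hρ, h⟩ := hτ ε hε
  refine ⟨ρ, hρ, fun t ht ht1 => ?_⟩
  rw [← hbf _ (mk_mem_bidisk ht1 τ), norm_mul, ← mul_assoc]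
  exact le_mul_of_one_le_left (norm_nonneg _) (h t ht ht1)

/-- The slice estimate with `C = 0` bounds the norm of `f - g` by zero. -/
theorem H2.ext_toFun {f g : H2} (h : ∀ x ∈ bidisk, f.toFun x = g.toFun x) : f = g := by
  obtain ⟨u, hu, hn⟩ := exists_H2_of_slice_le (absConv_coe (f - g)) 0 le_rfl (C := 0)
    (Eventually.of_forall fun τ ε hε => ⟨0, one_pos, fun t _ ht => by
      have h1 := mk_mem_bidisk ht τ
      rw [← toFun_eq_powerSum, H2.toFun_sub _ _ h1, h _ h1, sub_self, H2.toFun_zero]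
      simp⟩)
  have hu' : u = f - g := lp.ext hu
  rw [zero_mul, hu', norm_le_zero_iff, sub_eq_zero] at hn
  exact hn

theorem norm_le_of_mul_eq {F : ℂ × ℂ → ℂ} {C : ℝ} (hC : 0 ≤ C)
    (hF : ∀ᵐ τ : ℝ, ∀ ε > 0, ∃ ρ < (1 : ℝ), ∀ t : ℂ, ρ < ‖t‖ → ‖t‖ < 1 →
      1 ≤ (C + ε) * ‖F (t, t * exp (τ * I))‖)
    {h f : H2} (hhf : ∀ x ∈ bidisk, f.toFun x = F x * h.toFun x) : ‖h‖ ≤ C * ‖f‖ := by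
  obtain ⟨h', h1, h2⟩ := exists_H2_of_mul_eq hC hF (absConv_coe h) f fun x hx => (hhf x hx).symm
  rwa [show h' = h from lp.ext h1] at h2

/-- Multiplication by a bounded holomorphic function is a bounded operator on `H²(𝔻²)`. -/
theorem exists_mulOp {F : ℂ × ℂ → ℂ} (hF : SepHolo F) {C : ℝ} (hC : ∀ x ∈ bidisk, ‖F x‖ ≤ C) :
    ∃ X : H2 →L[ℂ] H2, ∀ h : H2, ∀ x ∈ bidisk, (X h).toFun x = F x * h.toFun x := by
  have hC0 : 0 ≤ C := (norm_nonneg _).trans (hC (0, 0) ⟨by simp, by simp⟩)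
  have key : ∀ h : H2, ∃ g : H2, (∀ x ∈ bidisk, g.toFun x = F x * h.toFun x) ∧
      ‖g‖ ≤ C * ‖h‖ := by
    intro h
    obtain ⟨b, hb, hbe⟩ := (hF.mul h.sepHolo).exists_powerSum
    obtain ⟨g, hg, hn⟩ := exists_H2_of_slice_le hb h hC0
      (Eventually.of_forall fun τ ε hε => ⟨0, one_pos, fun t _ ht => by
        have h1 := mk_mem_bidisk ht τ
        rw [hbe _ h1, norm_mul]
        have := hC _ h1
        gcongr
        linarith⟩)
    refine ⟨g, fun x hx => ?_, hn⟩
    rw [toFun_eq_powerSum, hg, hbe x hx]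
  choose X hX hXn using key
  refine ⟨LinearMap.mkContinuous
    { toFun := X
      map_add' := fun f g => H2.ext_toFun fun x hx => ?_
      map_smul' := fun c f => H2.ext_toFun fun x hx => ?_ } C hXn, hX⟩
  · rw [hX _ x hx, H2.toFun_add _ _ hx, H2.toFun_add _ _ hx, hX _ x hx, hX _ x hx, mul_add]
  · rw [hX _ x hx, H2.toFun_smul, RingHom.id_apply, H2.toFun_smul, hX _ x hx]
    ring

end Multipliers

/-! ### The shift in `z`, its adjoint, and evaluation at `z = c`. -/

section Shift

open Metric

theorem Mz_apply_zero (f : H2) (n : ℕ) : Mz f (0, n) = 0 := rfl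

theorem Mz_apply_succ (f : H2) (m n : ℕ) : Mz f (m + 1, n) = f (m, n) := rfl

theorem norm_Mz (f : H2) : ‖Mz f‖ = ‖f‖ := by
  have h1 := lp.hasSum_norm (p := 2) (by norm_num) (Mz f)
  have h2 := h1.unique (hasSum_shiftCoeff f)
  exact (Real.rpow_left_inj (norm_nonneg _) (norm_nonneg _) (by norm_num)).mp h2

theorem adjoint_Mz_apply (f : H2) (m n : ℕ) :
    ContinuousLinearMap.adjoint Mz f (m, n) = f (m + 1, n) := by
  have hs : Mz (lp.single 2 (m, n) (1 : ℂ)) = lp.single 2 (m + 1, n) (1 : ℂ) := by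
    ext ⟨i, j⟩
    cases i with
    | zero => rw [Mz_apply_zero, lp.single_apply_ne]; simp
    | succ i =>
      rw [Mz_apply_succ]
      by_cases h : (i, j) = (m, n)
      · obtain ⟨rfl, rfl⟩ := Prod.mk.inj h
        rw [lp.single_apply_self, lp.single_apply_self]
      · rw [lp.single_apply_ne _ _ _ h, lp.single_apply_ne]
        simpa using h
  have h1 := ContinuousLinearMap.adjoint_inner_right Mz (lp.single 2 (m, n) (1 : ℂ)) f
  rw [hs, lp.inner_single_left, lp.inner_single_left] at h1
  simpa using h1

theorem toFun_Mz (f : H2) (x : ℂ × ℂ) : (Mz f).toFun x = x.1 * f.toFun x := by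
  have hinj : Function.Injective (fun k : ℕ × ℕ => (k.1 + 1, k.2)) := by
    rintro ⟨a, b⟩ ⟨c, d⟩ h
    simpa using h
  rw [H2.toFun, ← hinj.tsum_eq, H2.toFun, ← tsum_mul_left]
  · refine tsum_congr fun k => ?_
    simp only [Mz_apply_succ]
    ring
  · rintro ⟨m, n⟩ hk
    cases m with
    | zero => exact absurd (zero_mul (x.1 ^ 0 * x.2 ^ n)) hk
    | succ m => exact ⟨(m, n), rfl⟩

theorem toFun_sub_Mz_adjoint (f : H2) (x : ℂ × ℂ) :
    (f - Mz (ContinuousLinearMap.adjoint Mz f)).toFun x = f.toFun (0, x.2) := by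
  simp only [H2.toFun]
  refine tsum_congr fun ⟨m, n⟩ => ?_
  cases m with
  | zero => simp [Mz_apply_zero]
  | succ m => simp [Mz_apply_succ, adjoint_Mz_apply]

theorem mul_toFun_adjoint_Mz (f : H2) {x : ℂ × ℂ} (hx : x ∈ bidisk) :
    x.1 * (ContinuousLinearMap.adjoint Mz f).toFun x = f.toFun x - f.toFun (0, x.2) := by
  rw [← toFun_sub_Mz_adjoint f x, H2.toFun_sub _ _ hx, toFun_Mz]
  ring

theorem norm_adjoint_Mz_le : ‖ContinuousLinearMap.adjoint Mz‖ ≤ 1 := by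
  rw [LinearIsometryEquiv.norm_map]
  exact ContinuousLinearMap.opNorm_le_bound _ zero_le_one fun f => by rw [norm_Mz, one_mul]

/-- Evaluation `f ↦ f (c, ·)` in the first variable, together with the corresponding division
with remainder by `z - c`. -/
theorem exists_evalOp {c : ℂ} (hc : ‖c‖ < 1) :
    ∃ ev D : H2 →L[ℂ] H2, (∀ f, f = ev f + (Mz (D f) - c • D f)) ∧
      ∀ f, ∀ x ∈ bidisk, (ev f).toFun x = f.toFun (c, x.2) := by
  set B := ContinuousLinearMap.adjoint Mz with hB
  have hlt : ‖c • B‖ < 1 := by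
    rw [norm_smul]
    calc ‖c‖ * ‖B‖ ≤ ‖c‖ * 1 := by gcongr; exact norm_adjoint_Mz_le
      _ < 1 := by rwa [mul_one]
  have hu : IsUnit (1 - c • B) := isUnit_one_sub_of_norm_lt_one hlt
  obtain ⟨R, hR⟩ : ∃ R : H2 →L[ℂ] H2, (1 - c • B) * R = 1 :=
    ⟨Ring.inverse (1 - c • B), Ring.mul_inverse_cancel _ hu⟩
  have hRf : ∀ f, R f - c • B (R f) = f := fun f =>
    congrArg (fun A : H2 →L[ℂ] H2 => A f) hR
  -- With `g = R f` one has `f = g - c B g`, and `g - Mz (B g)` is `g (0, ·)`. Setting `z = c` in `z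
  -- (B g) = g - g (0, ·)` shows that `g (0, w) = f (c, w)`.
  refine ⟨R - Mz ∘L B ∘L R, B ∘L R, fun f => ?_, fun f x hx => ?_⟩
  · change f = (R f - Mz (B (R f))) + (Mz (B (R f)) - c • B (R f))
    rw [sub_add_sub_cancel, hRf]
  · change (R f - Mz (B (R f))).toFun x = _
    rw [toFun_sub_Mz_adjoint]
    have hcx : (c, x.2) ∈ bidisk := ⟨mem_ball_zero_iff.2 hc, hx.2⟩
    have h1 := mul_toFun_adjoint_Mz (R f) hcx
    conv_rhs => rw [← hRf f]
    rw [H2.toFun_sub _ _ hcx, H2.toFun_smul]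
    simp only at h1
    rw [h1]
    ring

theorem norm_Mz_sub_smul_ge (c : ℂ) (f : H2) : (1 - ‖c‖) * ‖f‖ ≤ ‖Mz f - c • f‖ := by
  have := norm_sub_norm_le (Mz f) (c • f)
  rw [norm_Mz, norm_smul] at this
  linarith

end Shift

/-! ### Boundary behaviour of rational inner functions on slices. -/

section RationalSlices

open Complex Metric Polynomial

/-- A bounded rational function on the disk with unimodular radial limits has modulus tending
uniformly to one at the unit circle. -/
theorem one_le_mul_norm_of_unimodular {P Q : ℂ[X]} (hP : ∀ t ∈ ball (0 : ℂ) 1, P.eval t ≠ 0)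
    {C : ℝ} (hb : ∀ t ∈ ball (0 : ℂ) 1, ‖Q.eval t / P.eval t‖ ≤ C)
    (hae : ∀ᵐ s : ℝ, ∃ c : ℂ, ‖c‖ = 1 ∧ Tendsto (fun r : ℝ =>
      Q.eval (r * exp (s * I)) / P.eval (r * exp (s * I))) (𝓝[<] 1) (𝓝 c))
    {ε : ℝ} (hε : 0 < ε) :
    ∃ ρ < (1 : ℝ), ∀ t : ℂ, ρ < ‖t‖ → ‖t‖ < 1 → 1 ≤ (1 + ε) * ‖Q.eval t / P.eval t‖ := by
  have hP0 : P ≠ 0 := fun h => hP 0 (mem_ball_self one_pos) (by simp [h])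
  obtain ⟨P', Q', D, hrel, hDP, hDQ⟩ :=
    UniqueFactorizationMonoid.exists_reduced_factors P hP0 Q
  have hPP : ∀ t ∈ ball (0 : ℂ) 1, D.eval t ≠ 0 ∧ P'.eval t ≠ 0 := fun t ht => by
    have := hP t ht
    rw [← hDP, eval_mul] at this
    exact mul_ne_zero_iff.1 this
  have hquot : ∀ t ∈ ball (0 : ℂ) 1, Q.eval t / P.eval t = Q'.eval t / P'.eval t := fun t ht => by
    rw [← hDP, ← hDQ, eval_mul, eval_mul, mul_div_mul_left _ _ (hPP t ht).1]
  have hle : ∀ t ∈ closedBall (0 : ℂ) 1, ‖Q'.eval t‖ ≤ C * ‖P'.eval t‖ := by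
    intro t ht
    rw [← closure_ball (0 : ℂ) one_ne_zero] at ht
    refine le_on_closure (s := ball (0 : ℂ) 1) (f := fun t => ‖Q'.eval t‖)
      (g := fun t => C * ‖P'.eval t‖) (fun t ht => ?_) ?_ ?_ ht
    · have h1 := hb t ht
      rw [hquot t ht, norm_div, div_le_iff₀ (norm_pos_iff.2 (hPP t ht).2)] at h1
      exact h1
    · exact Q'.continuous.norm.continuousOn
    · exact (continuous_const.mul P'.continuous.norm).continuousOn
  -- Boundedness forces a zero of the reduced denominator to be a zero of the numerator as well,
  -- contradicting coprimality. So the quotient is continuous up to the circle, and almost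
  -- everywhere unimodular becomes everywhere unimodular.
  have hP' : ∀ t ∈ closedBall (0 : ℂ) 1, P'.eval t ≠ 0 := by
    intro t ht h0
    have h1 := hle t ht
    rw [h0, norm_zero, mul_zero, norm_le_zero_iff] at h1
    obtain ⟨u, v, huv⟩ := hrel.isCoprime
    have := congrArg (eval t) huv
    simp [h0, h1] at this
  have hcont : ContinuousOn (fun t => Q'.eval t / P'.eval t) (closedBall (0 : ℂ) 1) :=
    Q'.continuous.continuousOn.div P'.continuous.continuousOn hP'
  have hmem : ∀ s : ℝ, exp (s * I) ∈ closedBall (0 : ℂ) 1 := fun s => by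
    rw [mem_closedBall_zero_iff, norm_exp_ofReal_mul_I]
  have hcs : Continuous fun s : ℝ => ‖Q'.eval (exp (s * I)) / P'.eval (exp (s * I))‖ :=
    (hcont.comp_continuous (by fun_prop : Continuous fun s : ℝ => exp (s * I)) hmem).norm
  have hone : ∀ s : ℝ, ‖Q'.eval (exp (s * I)) / P'.eval (exp (s * I))‖ = 1 := by
    have h1 : (fun s : ℝ => ‖Q'.eval (exp (s * I)) / P'.eval (exp (s * I))‖) =ᵐ[volume]
        fun _ => 1 := by
      filter_upwards [hae] with s ⟨c, hc, hlim⟩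
      have h2 : Tendsto (fun r : ℝ => (r : ℂ) * exp (s * I)) (𝓝[<] 1)
          (𝓝[closedBall 0 1] exp (s * I)) := by
        refine tendsto_nhdsWithin_iff.2 ⟨?_, ?_⟩
        · have : Continuous fun r : ℝ => (r : ℂ) * exp (s * I) := by fun_prop
          have h3 := this.tendsto 1
          simp only [ofReal_one, one_mul] at h3
          exact h3.mono_left nhdsWithin_le_nhds
        · filter_upwards [Ioo_mem_nhdsLT (zero_lt_one' ℝ)] with r hr
          rw [mem_closedBall_zero_iff, norm_mul, norm_exp_ofReal_mul_I, mul_one, norm_real,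
            Real.norm_of_nonneg hr.1.le]
          exact hr.2.le
      have h3 := (hcont _ (hmem s)).tendsto.comp h2
      have h4 : Tendsto (fun r : ℝ =>
          Q.eval (r * exp (s * I)) / P.eval (r * exp (s * I))) (𝓝[<] 1)
          (𝓝 (Q'.eval (exp (s * I)) / P'.eval (exp (s * I)))) := by
        refine h3.congr' ?_
        filter_upwards [Ioo_mem_nhdsLT (zero_lt_one' ℝ)] with r hr
        refine (hquot _ ?_).symm
        rw [mem_ball_zero_iff, norm_mul, norm_exp_ofReal_mul_I, mul_one, norm_real,
          Real.norm_of_nonneg hr.1.le]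
        exact hr.2
      rw [← tendsto_nhds_unique hlim h4, hc]
    exact fun s => congrFun ((hcs.ae_eq_iff_eq volume continuous_const).1 h1) s
  have hsph : ∀ t : ℂ, ‖t‖ = 1 → ‖Q'.eval t / P'.eval t‖ = 1 := by
    intro t ht
    have := hone t.arg
    rwa [show exp (t.arg * I) = t by
      conv_rhs => rw [← norm_mul_exp_arg_mul_I t, ht, ofReal_one, one_mul]] at this
  have hcpt : IsCompact {t ∈ closedBall (0 : ℂ) 1 | (1 + ε) * ‖Q'.eval t / P'.eval t‖ ≤ 1} := by
    refine (isCompact_closedBall (0 : ℂ) 1).of_isClosed_subset ?_ (fun t ht => ht.1)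
    exact (continuousOn_const.mul hcont.norm).preimage_isClosed_of_isClosed isClosed_closedBall
      isClosed_Iic
  rcases Set.eq_empty_or_nonempty
    {t ∈ closedBall (0 : ℂ) 1 | (1 + ε) * ‖Q'.eval t / P'.eval t‖ ≤ 1} with he | hne
  · refine ⟨0, one_pos, fun t _ ht => ?_⟩
    rw [hquot t (mem_ball_zero_iff.2 ht)]
    by_contra hcon
    have : t ∈ {t ∈ closedBall (0 : ℂ) 1 | (1 + ε) * ‖Q'.eval t / P'.eval t‖ ≤ 1} :=
      ⟨mem_closedBall_zero_iff.2 ht.le, (not_le.1 hcon).le⟩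
    rw [he] at this
    exact this
  -- The exceptional set is compact and misses the unit circle, so its largest modulus serves as
  -- `ρ`.
  · obtain ⟨t₀, ht₀, hmax⟩ := hcpt.exists_isMaxOn hne continuous_norm.continuousOn
    refine ⟨‖t₀‖, lt_of_le_of_ne (mem_closedBall_zero_iff.1 ht₀.1) fun h => ?_, fun t ht ht1 => ?_⟩
    · have := ht₀.2
      rw [hsph t₀ h] at this
      linarith
    · rw [hquot t (mem_ball_zero_iff.2 ht1)]
      by_contra hcon
      exact absurd (hmax ⟨mem_closedBall_zero_iff.2 ht1.le, (not_le.1 hcon).le⟩) (not_le.2 ht)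

theorem eval_eval_C_mul_X (p : ℂ[X][Y]) (e t : ℂ) :
    (p.eval (C e * X)).eval t = p.evalEval t (t * e) := by
  rw [Polynomial.evalEval, ← coe_evalRingHom t, ← coe_evalRingHom (C (t * e)),
    ← coe_evalRingHom (C e * X)]
  have : (evalRingHom t).comp (evalRingHom (C e * X : ℂ[X])) =
      (evalRingHom t).comp (evalRingHom (C (t * e))) := by
    refine Polynomial.ringHom_ext (fun a => ?_) ?_
    · simp only [RingHom.comp_apply, coe_evalRingHom, eval_C]
    · simp only [RingHom.comp_apply, coe_evalRingHom, eval_X, eval_mul, eval_C]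
      ring
  exact congrArg (fun g : ℂ[X][Y] →+* ℂ => g p) this

/-- The shear `(τ, s) ↦ (s, s + τ)` preserves Lebesgue measure; Fubini then passes from the torus to
almost every slice. -/
theorem IsInner.ae_slice {θ : ℂ × ℂ → ℂ} (hθ : IsInner θ) :
    ∀ᵐ τ : ℝ, ∀ᵐ s : ℝ, ∃ c : ℂ, ‖c‖ = 1 ∧ Tendsto (fun r : ℝ =>
      θ (r * exp (s * I), r * exp (s * I) * exp (τ * I))) (𝓝[<] 1) (𝓝 c) := by
  have h1 := (measurePreserving_prod_add_swap (volume : Measure ℝ)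
    (volume : Measure ℝ)).quasiMeasurePreserving.ae hθ.unimodular
  have h2 := Measure.ae_ae_of_ae_prod h1
  filter_upwards [h2] with τ hτ
  filter_upwards [hτ] with s ⟨c, hc, hlim⟩
  refine ⟨c, hc, hlim.congr fun r => ?_⟩
  simp only [ofReal_add, add_mul, exp_add, mul_assoc]

/-- On almost every slice a rational inner function has modulus tending uniformly to one at the
boundary. -/
theorem ae_slice_one_le {θ : ℂ × ℂ → ℂ} (hθ : IsInner θ) {p q : ℂ[X][Y]}
    (hpq : ∀ x ∈ bidisk, p.evalEval x.1 x.2 ≠ 0 ∧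
      θ x = q.evalEval x.1 x.2 / p.evalEval x.1 x.2) :
    ∀ᵐ τ : ℝ, ∀ ε > 0, ∃ ρ < (1 : ℝ), ∀ t : ℂ, ρ < ‖t‖ → ‖t‖ < 1 →
      1 ≤ (1 + ε) * ‖θ (t, t * exp (τ * I))‖ := by
  obtain ⟨K, hK⟩ := hθ.bounded
  filter_upwards [hθ.ae_slice] with τ hτ ε hε
  have hslice : ∀ t : ℂ, ‖t‖ < 1 → θ (t, t * exp (τ * I)) =
      (q.eval (C (exp (τ * I)) * X)).eval t / (p.eval (C (exp (τ * I)) * X)).eval t := by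
    intro t ht
    rw [(hpq _ (mk_mem_bidisk ht τ)).2, eval_eval_C_mul_X, eval_eval_C_mul_X]
  obtain ⟨ρ, hρ, h⟩ := one_le_mul_norm_of_unimodular
    (P := p.eval (C (exp (τ * I)) * X)) (Q := q.eval (C (exp (τ * I)) * X)) (C := K)
    (fun t ht => by
      rw [eval_eval_C_mul_X]
      exact (hpq _ (mk_mem_bidisk (mem_ball_zero_iff.1 ht) τ)).1)
    (fun t ht => by
      rw [← hslice t (mem_ball_zero_iff.1 ht)]
      exact hK _ (mk_mem_bidisk (mem_ball_zero_iff.1 ht) τ))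
    (by
      filter_upwards [hτ] with s ⟨c, hc, hlim⟩
      refine ⟨c, hc, hlim.congr' ?_⟩
      filter_upwards [Ioo_mem_nhdsLT (zero_lt_one' ℝ)] with r hr
      refine hslice _ ?_
      rw [norm_mul, norm_exp_ofReal_mul_I, mul_one, norm_real, Real.norm_of_nonneg hr.1.le]
      exact hr.2) hε
  refine ⟨ρ, hρ, fun t ht ht1 => ?_⟩
  rw [hslice t ht1]
  exact h t ht ht1

end RationalSlices

/-! ### Blaschke factors, and nonvanishing of the slices of the numerator. -/

section UnivariateFactors

open Complex Metric Polynomial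

/-- The Blaschke factor with zero `c`. -/
def blaschke (c z : ℂ) : ℂ := (z - c) / (1 - conj c * z)

theorem norm_one_sub_conj_mul_ge {c z : ℂ} (hz : ‖z‖ ≤ 1) : 1 - ‖c‖ ≤ ‖1 - conj c * z‖ := by
  have h := norm_sub_norm_le (1 : ℂ) (conj c * z)
  rw [norm_one, norm_mul, norm_conj] at h
  nlinarith [norm_nonneg c]

theorem one_sub_conj_mul_ne_zero {c z : ℂ} (hc : ‖c‖ < 1) (hz : ‖z‖ ≤ 1) : 1 - conj c * z ≠ 0 := by
  have := norm_one_sub_conj_mul_ge (c := c) hz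
  exact norm_pos_iff.1 (by linarith)

theorem norm_blaschke_of_norm_eq_one {c z : ℂ} (hc : ‖c‖ < 1) (hz : ‖z‖ = 1) :
    ‖blaschke c z‖ = 1 := by
  have h1 : ‖1 - conj c * z‖ = ‖z - c‖ := by
    have h2 : 1 - conj c * z = z * conj (z - c) := by
      rw [map_sub, mul_sub, mul_conj, normSq_eq_norm_sq, hz]
      push_cast
      ring
    rw [h2, norm_mul, hz, one_mul, norm_conj]
  rw [blaschke, norm_div, h1, div_self]
  rw [← h1]
  exact norm_ne_zero_iff.2 (one_sub_conj_mul_ne_zero hc hz.le)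

theorem differentiableAt_blaschke {c z : ℂ} (hc : ‖c‖ < 1) (hz : ‖z‖ ≤ 1) :
    DifferentiableAt ℂ (blaschke c) z := by
  unfold blaschke
  exact DifferentiableAt.div (by fun_prop) (by fun_prop) (one_sub_conj_mul_ne_zero hc hz)

theorem norm_blaschke_le {c z : ℂ} (hc : ‖c‖ < 1) (hz : ‖z‖ ≤ 1) :
    ‖blaschke c z‖ ≤ 2 / (1 - ‖c‖) := by
  rw [blaschke, norm_div]
  have h1 := norm_one_sub_conj_mul_ge (c := c) hz
  have h2 : ‖z - c‖ ≤ 2 := (norm_sub_le _ _).trans (by linarith)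
  have : 0 < 1 - ‖c‖ := by linarith
  gcongr

/-- Outside the radius `(1 + ‖c‖) / 2` the Blaschke factor is at least `(1 - ‖c‖) / 4` in modulus;
inside, the maximum principle takes over. This keeps the cofactor bounded after a Blaschke factor is
split off. -/
theorem norm_le_of_norm_blaschke_mul_le {c : ℂ} (hc : ‖c‖ < 1) {g : ℂ → ℂ}
    (hg : DifferentiableOn ℂ g (ball 0 1)) {C : ℝ}
    (h : ∀ z ∈ ball (0 : ℂ) 1, ‖blaschke c z * g z‖ ≤ C) :
    ∀ z ∈ ball (0 : ℂ) 1, ‖g z‖ ≤ 4 / (1 - ‖c‖) * C := by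
  have hpos : 0 < 1 - ‖c‖ := by linarith
  set r := (1 + ‖c‖) / 2 with hr
  have hr1 : r < 1 := by rw [hr]; linarith
  have hr0 : 0 < r := by rw [hr]; positivity
  have houter : ∀ z ∈ ball (0 : ℂ) 1, r ≤ ‖z‖ → ‖g z‖ ≤ 4 / (1 - ‖c‖) * C := by
    intro z hz hrz
    have hz1 := mem_ball_zero_iff.1 hz
    have h1 : (1 - ‖c‖) / 4 ≤ ‖blaschke c z‖ := by
      rw [blaschke, norm_div, le_div_iff₀ (norm_pos_iff.2 (one_sub_conj_mul_ne_zero hc hz1.le))]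
      have h2 : ‖1 - conj c * z‖ ≤ 2 := by
        refine (norm_sub_le _ _).trans ?_
        rw [norm_one, norm_mul, norm_conj]
        nlinarith [norm_nonneg c, norm_nonneg z]
      have h3 : (1 - ‖c‖) / 2 ≤ ‖z - c‖ := by
        have := norm_sub_norm_le z c
        rw [hr] at hrz
        linarith
      nlinarith
    have h2 := h z hz
    rw [norm_mul] at h2
    have h3 : (1 - ‖c‖) / 4 * ‖g z‖ ≤ C :=
      (mul_le_mul_of_nonneg_right h1 (norm_nonneg _)).trans h2
    rw [div_mul_eq_mul_div, le_div_iff₀ hpos]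
    linarith
  intro z hz
  rcases le_or_gt r ‖z‖ with hrz | hrz
  · exact houter z hz hrz
  · refine norm_le_of_forall_mem_frontier_norm_le (U := ball (0 : ℂ) r) isBounded_ball
      (DifferentiableOn.diffContOnCl ?_) (fun y hy => ?_)
      (subset_closure (mem_ball_zero_iff.2 hrz))
    · rw [closure_ball _ hr0.ne']
      exact hg.mono (closedBall_subset_ball hr1)
    · rw [frontier_ball _ hr0.ne', mem_sphere_zero_iff_norm] at hy
      exact houter y (mem_ball_zero_iff.2 (hy ▸ hr1)) hy.ge

/-- Splitting off a Blaschke factor, in the coordinate `π`. -/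
theorem hasUnivariateInnerFactor_of_eq_blaschke_mul {θ ψ : ℂ × ℂ → ℂ} (hθ : IsInner θ) {c : ℂ} (hc : ‖c‖ < 1)
    {π : ℂ × ℂ → ℂ} (hπd : Differentiable ℂ π)
    (hπ : π = Prod.fst ∨ π = Prod.snd) (hψ : DifferentiableOn ℂ ψ bidisk)
    (hb : ∃ C : ℝ, ∀ x ∈ bidisk, ‖ψ x‖ ≤ C)
    (h : ∀ x ∈ bidisk, θ x = blaschke c (π x) * ψ x) :
    HasUnivariateInnerFactor θ := by
  have hmem : ∀ x ∈ bidisk, ‖π x‖ < 1 := by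
    intro x hx
    rcases hπ with rfl | rfl
    · exact mem_ball_zero_iff.1 hx.1
    · exact mem_ball_zero_iff.1 hx.2
  have hrad : ∀ t : ℝ × ℝ, ∃ e : ℂ, ‖e‖ = 1 ∧
      Tendsto (fun r : ℝ => blaschke c (π (r * exp (t.1 * I), r * exp (t.2 * I)))) (𝓝[<] 1)
        (𝓝 (blaschke c e)) := by
    intro t
    refine ⟨π (exp (t.1 * I), exp (t.2 * I)), ?_, ?_⟩
    · rcases hπ with rfl | rfl <;> simp only [norm_exp_ofReal_mul_I]
    · have he : ‖π (exp (t.1 * I), exp (t.2 * I))‖ = 1 := by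
        rcases hπ with rfl | rfl <;> simp only [norm_exp_ofReal_mul_I]
      have h1 : Tendsto (fun r : ℝ => π (r * exp (t.1 * I), r * exp (t.2 * I))) (𝓝[<] 1)
          (𝓝 (π (exp (t.1 * I), exp (t.2 * I)))) := by
        have hcont : Continuous fun r : ℝ => π (r * exp (t.1 * I), r * exp (t.2 * I)) :=
          hπd.continuous.comp (by fun_prop)
        have := hcont.tendsto 1
        simp only [ofReal_one, one_mul] at this
        exact this.mono_left nhdsWithin_le_nhds
      exact (differentiableAt_blaschke hc he.le).continuousAt.tendsto.comp h1
  refine ⟨fun x => blaschke c (π x), ψ, ⟨?_, ?_, ?_⟩, ⟨hψ, hb, ?_⟩, h, ?_, ?_⟩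
  · intro x hx
    exact ((differentiableAt_blaschke hc (hmem x hx).le).comp x
      (hπd x)).differentiableWithinAt
  · exact ⟨_, fun x hx => norm_blaschke_le hc (hmem x hx).le⟩
  · refine Eventually.of_forall fun t => ?_
    obtain ⟨e, he, hlim⟩ := hrad t
    exact ⟨_, norm_blaschke_of_norm_eq_one hc he, hlim⟩
  · filter_upwards [hθ.unimodular] with t ⟨d, hd, hlim⟩
    obtain ⟨e, he, hlim'⟩ := hrad t
    have hne : blaschke c e ≠ 0 :=
      norm_ne_zero_iff.1 (by rw [norm_blaschke_of_norm_eq_one hc he]; exact one_ne_zero)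
    refine ⟨d / blaschke c e, ?_, (hlim.div hlim' hne).congr' ?_⟩
    · rw [norm_div, hd, norm_blaschke_of_norm_eq_one hc he, div_one]
    · filter_upwards [hlim'.eventually_ne hne, Ioo_mem_nhdsLT (zero_lt_one' ℝ)] with r hr hr1
      have hx : ((r : ℂ) * exp (t.1 * I), (r : ℂ) * exp (t.2 * I)) ∈ bidisk := by
        constructor <;>
        · rw [mem_ball_zero_iff]
          simp only [norm_mul, norm_exp_ofReal_mul_I, mul_one, norm_real,
            Real.norm_of_nonneg hr1.1.le]
          exact hr1.2
      simp only [Pi.div_apply]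
      rw [h _ hx, mul_div_cancel_left₀ _ hr]
  · rcases hπ with rfl | rfl
    · exact Or.inl ⟨blaschke c, fun x _ => rfl⟩
    · exact Or.inr ⟨blaschke c, fun x _ => rfl⟩
  · rintro ⟨d, hd⟩
    obtain ⟨e, he, hec⟩ : ∃ e : ℂ, ‖e‖ < 1 ∧ e ≠ c := by
      by_cases h0 : c = 0
      · exact ⟨1 / 2, by norm_num, by rw [h0]; norm_num⟩
      · exact ⟨0, by simp, fun h => h0 h.symm⟩
    have h1 := hd (c, c) ⟨mem_ball_zero_iff.2 hc, mem_ball_zero_iff.2 hc⟩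
    have h2 := hd (e, e) ⟨mem_ball_zero_iff.2 he, mem_ball_zero_iff.2 he⟩
    have hcc : π (c, c) = c := by rcases hπ with rfl | rfl <;> rfl
    have hee : π (e, e) = e := by rcases hπ with rfl | rfl <;> rfl
    simp only [hcc, hee] at h1 h2
    rw [← h1] at h2
    simp only [blaschke, sub_self, zero_div, div_eq_zero_iff, sub_eq_zero] at h2
    rcases h2 with h2 | h2
    · exact hec h2
    · exact one_sub_conj_mul_ne_zero hc he.le (sub_eq_zero.2 h2)

theorem contDiff_evalEval (p : ℂ[X][Y]) {n : WithTop ℕ∞} :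
    ContDiff ℂ n fun x : ℂ × ℂ => p.evalEval x.1 x.2 := by
  induction p using Polynomial.induction_on' with
  | add p q hp hq => simp only [evalEval_add]; exact hp.add hq
  | monomial k a =>
    have : ∀ x : ℂ × ℂ, (monomial k a).evalEval x.1 x.2 = a.eval x.1 * x.2 ^ k := by
      intro x
      rw [← C_mul_X_pow_eq_monomial, evalEval_mul, evalEval_pow, evalEval_C, evalEval_X]
    simp only [this]
    have ha : ContDiff ℂ n fun z : ℂ => a.eval z := by
      simpa only [coe_aeval_eq_eval] using Polynomial.contDiff_aeval (𝕜 := ℂ) a n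
    exact (ha.comp contDiff_fst).mul (contDiff_snd.pow k)

theorem differentiable_evalEval (p : ℂ[X][Y]) :
    Differentiable ℂ fun x : ℂ × ℂ => p.evalEval x.1 x.2 :=
  (contDiff_evalEval p (n := 1)).differentiable one_ne_zero

variable {θ : ℂ × ℂ → ℂ} {p q : ℂ[X][Y]}

/-- The linear factor `π - c` of the numerator is completed to a Blaschke factor, and its
denominator `1 - conj c * π` is moved into the cofactor, whose boundedness is checked slice by
slice. -/
theorem hasUnivariateInnerFactor_of_eq_mul (hθ : IsInner θ)
    (hpq : ∀ x ∈ bidisk, p.evalEval x.1 x.2 ≠ 0 ∧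
      θ x = q.evalEval x.1 x.2 / p.evalEval x.1 x.2) {c : ℂ} (hc : ‖c‖ < 1)
    {π : ℂ × ℂ → ℂ} (hπd : Differentiable ℂ π)
    (hπ : π = Prod.fst ∨ π = Prod.snd) {q' : ℂ[X][Y]}
    (hq : ∀ x, q.evalEval x.1 x.2 = (π x - c) * q'.evalEval x.1 x.2) :
    HasUnivariateInnerFactor θ := by
  have hmem : ∀ x ∈ bidisk, ‖π x‖ < 1 := by
    intro x hx
    rcases hπ with rfl | rfl
    · exact mem_ball_zero_iff.1 hx.1
    · exact mem_ball_zero_iff.1 hx.2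
  let ψ : ℂ × ℂ → ℂ := fun x =>
    (1 - conj c * π x) * q'.evalEval x.1 x.2 / p.evalEval x.1 x.2
  have hψ : DifferentiableOn ℂ ψ bidisk := by
    have h1 : DifferentiableOn ℂ (fun x : ℂ × ℂ => (p.evalEval x.1 x.2)⁻¹) bidisk :=
      (differentiable_evalEval p).differentiableOn.fun_inv fun x hx => (hpq x hx).1
    have h2 : Differentiable ℂ fun x : ℂ × ℂ => (1 - conj c * π x) * q'.evalEval x.1 x.2 :=
      ((hπd.const_mul _).const_sub _).fun_mul (differentiable_evalEval q')
    exact (h2.differentiableOn.fun_mul h1).congr fun x _ => div_eq_mul_inv _ _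
  have heq : ∀ x ∈ bidisk, θ x = blaschke c (π x) * ψ x := by
    intro x hx
    have h1 := one_sub_conj_mul_ne_zero hc (hmem x hx).le
    have h2 := (hpq x hx).1
    rw [(hpq x hx).2, hq]
    simp only [ψ, blaschke]
    rw [div_mul_div_comm, div_eq_div_iff h2 (mul_ne_zero h1 h2)]
    ring
  obtain ⟨K, hK⟩ := hθ.bounded
  refine hasUnivariateInnerFactor_of_eq_blaschke_mul hθ hc hπd hπ hψ ⟨4 / (1 - ‖c‖) * K, fun x hx => ?_⟩ heq
  have hsep := sepHolo_of_differentiableOn hψ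
  obtain ⟨z, w⟩ := x
  rcases hπ with rfl | rfl
  · exact norm_le_of_norm_blaschke_mul_le hc (hsep.left w hx.2) (fun y hy => by
      rw [← heq (y, w) ⟨hy, hx.2⟩]; exact hK _ ⟨hy, hx.2⟩) z hx.1
  · exact norm_le_of_norm_blaschke_mul_le hc (hsep.right z hx.1) (fun y hy => by
      rw [← heq (z, y) ⟨hx.1, hy⟩]; exact hK _ ⟨hx.1, hy⟩) w hx.2

theorem map_evalRingHom_ne_zero (hθ : IsInner θ) (hfactor : ¬ HasUnivariateInnerFactor θ)
    (hpq : ∀ x ∈ bidisk, p.evalEval x.1 x.2 ≠ 0 ∧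
      θ x = q.evalEval x.1 x.2 / p.evalEval x.1 x.2) {c : ℂ} (hc : ‖c‖ < 1) :
    q.map (evalRingHom c) ≠ 0 := by
  intro h
  have hdvd : C (X - C c) ∣ q := by
    rw [C_dvd_iff_dvd_coeff]
    intro i
    rw [dvd_iff_isRoot, IsRoot.def, ← coe_evalRingHom, ← coeff_map, h, coeff_zero]
  obtain ⟨q', rfl⟩ := hdvd
  refine hfactor (hasUnivariateInnerFactor_of_eq_mul hθ hpq hc differentiable_fst
    (Or.inl rfl) (q' := q') fun x => ?_)
  rw [evalEval_mul, evalEval_C, eval_sub, eval_X, eval_C]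

theorem eval_C_ne_zero_of_norm_lt (hθ : IsInner θ) (hfactor : ¬ HasUnivariateInnerFactor θ)
    (hpq : ∀ x ∈ bidisk, p.evalEval x.1 x.2 ≠ 0 ∧
      θ x = q.evalEval x.1 x.2 / p.evalEval x.1 x.2) {w : ℂ} (hw : ‖w‖ < 1) :
    q.eval (C w) ≠ 0 := by
  intro h
  obtain ⟨q', rfl⟩ := dvd_iff_isRoot.2 h
  refine hfactor (hasUnivariateInnerFactor_of_eq_mul hθ hpq hw differentiable_snd
    (Or.inr rfl) (q' := q') fun x => ?_)
  rw [evalEval_mul, evalEval_sub, evalEval_X, evalEval_C, eval_C]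

/-- If `q (·, w)` vanished identically, coprimality would leave a torus point over `w` with `p ≠ 0`.
Near it `|q / p| < 1`, contradicting unimodular radial limits on a dense set of torus points. -/
theorem eval_C_ne_zero_of_norm_eq_one (hθ : IsInner θ) (hrel : IsRelPrime p q)
    (hpq : ∀ x ∈ bidisk, p.evalEval x.1 x.2 ≠ 0 ∧
      θ x = q.evalEval x.1 x.2 / p.evalEval x.1 x.2) {w : ℂ} (hw : ‖w‖ = 1) :
    q.eval (C w) ≠ 0 := by
  intro h
  have hp : p.eval (C w) ≠ 0 := by
    intro h'
    have := hrel (dvd_iff_isRoot.2 h') (dvd_iff_isRoot.2 h)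
    exact Polynomial.not_isUnit_X_sub_C _ this
  obtain ⟨σ, hσ⟩ : ∃ σ : ℝ, p.evalEval (exp (σ * I)) w ≠ 0 := by
    by_contra! hcon
    refine hp (Polynomial.eq_zero_of_infinite_isRoot _ (Set.Infinite.mono
      (s := (fun σ : ℝ => exp (σ * I)) '' Set.Ioo 0 1) ?_ ?_))
    · rintro _ ⟨σ, -, rfl⟩
      exact hcon σ
    · refine (Set.Ioo_infinite one_pos).image fun a ha b hb hab => ?_
      have h1 := congrArg Complex.arg hab
      have hpi := Real.pi_gt_three
      rwa [arg_exp_mul_I, arg_exp_mul_I, toIocMod_eq_self _ |>.2, toIocMod_eq_self _ |>.2] at h1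
      · constructor <;> [linarith [hb.1]; linarith [hb.2]]
      · constructor <;> [linarith [ha.1]; linarith [ha.2]]
  set ω := w.arg with hω
  have hwω : w = exp (ω * I) := by
    conv_lhs => rw [← norm_mul_exp_arg_mul_I w, hw, ofReal_one, one_mul]
  let F : ℝ × ℝ → ℂ := fun t => q.evalEval (exp (t.1 * I)) (exp (t.2 * I)) /
    p.evalEval (exp (t.1 * I)) (exp (t.2 * I))
  have hexp : Continuous fun t : ℝ × ℝ => (exp (t.1 * I), exp (t.2 * I)) := by fun_prop
  have hcq := (differentiable_evalEval q).continuous.comp hexp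
  have hcp := (differentiable_evalEval p).continuous.comp hexp
  have hp0 : p.evalEval (exp (σ * I)) (exp (ω * I)) ≠ 0 := hwω ▸ hσ
  have hF : ContinuousAt F (σ, ω) := hcq.continuousAt.div hcp.continuousAt hp0
  have hq0 : q.evalEval (exp (σ * I)) (exp (ω * I)) = 0 := by
    rw [← hwω, evalEval, h, eval_zero]
  have hF0 : ‖F (σ, ω)‖ < 1 := by simp [F, hq0]
  have hnear : ∀ᶠ t in 𝓝 (σ, ω), ‖F t‖ < 1 ∧ p.evalEval (exp (t.1 * I)) (exp (t.2 * I)) ≠ 0 :=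
    (hF.norm.eventually_lt continuousAt_const hF0).and (hcp.continuousAt.eventually_ne hp0)
  obtain ⟨t, ⟨d, hd, hlim⟩, ht1, htp⟩ :=
    (Measure.dense_of_ae hθ.unimodular).inter_nhds_nonempty hnear
  have hrad : Continuous fun r : ℝ => ((r : ℂ) * exp (t.1 * I), (r : ℂ) * exp (t.2 * I)) := by
    fun_prop
  have hq1 := ((differentiable_evalEval q).continuous.comp hrad).tendsto 1
  have hp1 := ((differentiable_evalEval p).continuous.comp hrad).tendsto 1
  simp only [Function.comp_def, ofReal_one, one_mul] at hq1 hp1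
  have hlim' := (hq1.div hp1 htp).mono_left (nhdsWithin_le_nhds (s := Set.Iio 1))
  have hdF : d = F t := by
    refine tendsto_nhds_unique hlim (hlim'.congr' ?_)
    filter_upwards [Ioo_mem_nhdsLT (zero_lt_one' ℝ)] with r hr
    have hx : ((r : ℂ) * exp (t.1 * I), (r : ℂ) * exp (t.2 * I)) ∈ bidisk := by
      constructor <;>
      · rw [mem_ball_zero_iff]
        simp only [norm_mul, norm_exp_ofReal_mul_I, mul_one, norm_real,
          Real.norm_of_nonneg hr.1.le]
        exact hr.2
    exact (hpq _ hx).2.symm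
  rw [← hdF, hd] at ht1
  exact lt_irrefl _ ht1

end UnivariateFactors

/-! ### The bad set is closed with dense complement. -/

section BadSet

open Complex Metric Polynomial

/-- The points `z` for which `q (z, ·)` has a zero on the unit circle. -/
def badSet (q : ℂ[X][Y]) : Set ℂ := {z | ∃ w, ‖w‖ = 1 ∧ q.evalEval z w = 0}

theorem isClosed_badSet (q : ℂ[X][Y]) : IsClosed (badSet q) := by
  rw [← isOpen_compl_iff, isOpen_iff_eventually]
  intro z hz
  have hcont := (differentiable_evalEval q).continuous
  have h : ∀ᶠ y in 𝓝 z, ∀ w ∈ sphere (0 : ℂ) 1, q.evalEval y w ≠ 0 := by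
    refine (isCompact_sphere (0 : ℂ) 1).eventually_forall_of_forall_eventually fun w hw => ?_
    exact hcont.continuousAt.eventually_ne
      (fun h0 => hz ⟨w, mem_sphere_zero_iff_norm.1 hw, h0⟩)
  filter_upwards [h] with y hy
  rintro ⟨w, hw, h0⟩
  exact hy w (mem_sphere_zero_iff_norm.2 hw) h0

/-- The Lipschitz half of the implicit function theorem: where the `z`-derivative is nonzero, the
zero set is locally a Lipschitz graph over its `w`-coordinates. -/
theorem exists_lipschitz_of_hasStrictFDerivAt {G : ℂ × ℂ → ℂ} {L : ℂ × ℂ →L[ℂ] ℂ} {x₀ : ℂ × ℂ}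
    (hG : HasStrictFDerivAt G L x₀) (hL : L (1, 0) ≠ 0) :
    ∃ N ∈ 𝓝 x₀, ∃ K : NNReal, ∀ x ∈ N, ∀ y ∈ N, G x = 0 → G y = 0 →
      ‖x.1 - y.1‖ ≤ K * ‖x.2 - y.2‖ := by
  have ha : 0 < ‖L (1, 0)‖ := norm_pos_iff.2 hL
  have h := hG.isLittleO.def (half_pos ha)
  rw [nhds_prod_eq] at h
  obtain ⟨N, hN, hN'⟩ := eventually_prod_self_iff'.1 h
  refine ⟨N, hN, Real.toNNReal ((‖L (0, 1)‖ + ‖L (1, 0)‖ / 2) / (‖L (1, 0)‖ / 2)),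
    fun x hx y hy hGx hGy => ?_⟩
  rw [Real.coe_toNNReal _ (by positivity), div_mul_eq_mul_div, le_div_iff₀ (by positivity)]
  have h1 := hN' x hx y hy
  simp only [hGx, hGy, sub_zero, zero_sub, norm_neg] at h1
  have h2 : x - y = (x.1 - y.1) • ((1, 0) : ℂ × ℂ) + (x.2 - y.2) • ((0, 1) : ℂ × ℂ) := by
    ext <;> simp
  have h3 : L (x - y) = (x.1 - y.1) * L (1, 0) + (x.2 - y.2) * L (0, 1) := by
    rw [h2, map_add, map_smul, map_smul, smul_eq_mul, smul_eq_mul]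
  have h4 : ‖x - y‖ ≤ ‖x.1 - y.1‖ + ‖x.2 - y.2‖ := by
    rw [Prod.norm_def]
    exact max_le (le_add_of_nonneg_right (norm_nonneg _)) (le_add_of_nonneg_left (norm_nonneg _))
  have h5 : ‖x.1 - y.1‖ * ‖L (1, 0)‖ ≤ ‖L (x - y)‖ + ‖x.2 - y.2‖ * ‖L (0, 1)‖ := by
    rw [← norm_mul, ← norm_mul]
    have : (x.1 - y.1) * L (1, 0) = L (x - y) - (x.2 - y.2) * L (0, 1) := by rw [h3]; ring
    rw [this]
    exact norm_sub_le _ _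
  nlinarith

theorem dimH_sphere_le_one : dimH (sphere (0 : ℂ) 1) ≤ 1 := by
  have h1 : sphere (0 : ℂ) 1 ⊆ Set.range fun τ : ℝ => exp (τ * I) := by
    intro w hw
    refine ⟨w.arg, ?_⟩
    conv_rhs => rw [← norm_mul_exp_arg_mul_I w, mem_sphere_zero_iff_norm.1 hw, ofReal_one, one_mul]
  have h2 : ContDiff ℝ 1 fun τ : ℝ => exp (τ * I) := by
    exact (ofRealCLM.contDiff.mul contDiff_const).cexp
  refine (dimH_mono h1).trans (h2.dimH_range_le.trans ?_)
  simp

theorem exists_eval_C_eq_derivative (g : ℂ[X][Y]) :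
    ∃ g' : ℂ[X][Y], ∀ w : ℂ, g'.eval (C w) = derivative (g.eval (C w)) := by
  induction g using Polynomial.induction_on' with
  | add p q hp hq =>
    obtain ⟨p', hp⟩ := hp
    obtain ⟨q', hq⟩ := hq
    exact ⟨p' + q', fun w => by rw [eval_add, eval_add, hp, hq, derivative_add]⟩
  | monomial n a =>
    refine ⟨monomial n (derivative a), fun w => ?_⟩
    rw [eval_monomial, eval_monomial, ← C_pow, derivative_mul, derivative_C, mul_zero, add_zero]

/-- Here `g'` is the `z`-derivative of `g`. The simple zeros over the circle are covered by
countably many Lipschitz graphs over subsets of the circle, and Lipschitz maps do not raise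
Hausdorff dimension. -/
theorem dimH_fst_image_le_one {g g' : ℂ[X][Y]}
    (h : ∀ w : ℂ, g'.eval (C w) = derivative (g.eval (C w))) :
    dimH (Prod.fst '' {x : ℂ × ℂ | ‖x.2‖ = 1 ∧ g.evalEval x.1 x.2 = 0 ∧
      g'.evalEval x.1 x.2 ≠ 0}) ≤ 1 := by
  set Z := {x : ℂ × ℂ | ‖x.2‖ = 1 ∧ g.evalEval x.1 x.2 = 0 ∧ g'.evalEval x.1 x.2 ≠ 0} with hZ
  have hloc : ∀ x ∈ Z, ∃ N ∈ 𝓝 x, dimH (Prod.fst '' (Z ∩ N)) ≤ 1 := by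
    intro x hx
    have hd := (differentiable_evalEval g) x
    have hs : HasStrictFDerivAt (fun x : ℂ × ℂ => g.evalEval x.1 x.2)
        (fderiv ℂ (fun x : ℂ × ℂ => g.evalEval x.1 x.2) x) x :=
      ((contDiff_evalEval g).contDiffAt (n := 1)).hasStrictFDerivAt one_ne_zero
    have hL : fderiv ℂ (fun x : ℂ × ℂ => g.evalEval x.1 x.2) x (1, 0) ≠ 0 := by
      have h1 : HasDerivAt (fun z : ℂ => (z, x.2)) ((1 : ℂ), (0 : ℂ)) x.1 :=
        (hasDerivAt_id x.1).prodMk (hasDerivAt_const _ _)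
      have h2 : HasDerivAt (fun z : ℂ => g.evalEval z x.2) _ x.1 :=
        HasFDerivAt.comp_hasDerivAt (f := fun z : ℂ => (z, x.2)) x.1 hd.hasFDerivAt h1
      have h3 : HasDerivAt (fun z : ℂ => g.evalEval z x.2) (g'.evalEval x.1 x.2) x.1 := by
        rw [evalEval, h]
        exact (g.eval (C x.2)).hasDerivAt x.1
      rw [h2.unique h3]
      exact hx.2.2
    obtain ⟨N, hN, K, hK⟩ := exists_lipschitz_of_hasStrictFDerivAt hs hL
    refine ⟨N, hN, ?_⟩
    have hex : ∀ w ∈ Prod.snd '' (Z ∩ N), ∃ z, (z, w) ∈ Z ∩ N := by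
      rintro _ ⟨y, hy, rfl⟩
      exact ⟨y.1, hy⟩
    choose! φ hφ using hex
    have hlip : LipschitzOnWith K φ (Prod.snd '' (Z ∩ N)) := by
      refine LipschitzOnWith.of_dist_le_mul fun w hw w' hw' => ?_
      rw [dist_eq_norm, dist_eq_norm]
      exact hK _ (hφ w hw).2 _ (hφ w' hw').2 (hφ w hw).1.2.1 (hφ w' hw').1.2.1
    have himg : Prod.fst '' (Z ∩ N) ⊆ φ '' (Prod.snd '' (Z ∩ N)) := by
      rintro _ ⟨y, hy, rfl⟩
      have hy2 : y.2 ∈ Prod.snd '' (Z ∩ N) := ⟨y, hy, rfl⟩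
      refine ⟨y.2, hy2, ?_⟩
      have := hK _ (hφ _ hy2).2 _ hy.2 (hφ _ hy2).1.2.1 hy.1.2.1
      simp only [sub_self, norm_zero, mul_zero] at this
      exact sub_eq_zero.1 (norm_le_zero_iff.1 this)
    refine (dimH_mono himg).trans (hlip.dimH_image_le.trans ((dimH_mono ?_).trans
      dimH_sphere_le_one))
    rintro _ ⟨y, hy, rfl⟩
    exact mem_sphere_zero_iff_norm.2 hy.1.1
  choose! N hN hdim using hloc
  obtain ⟨t, htZ, htc, hcov⟩ := TopologicalSpace.countable_cover_nhdsWithin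
    (f := N) (s := Z) fun x hx => mem_nhdsWithin_of_mem_nhds (hN x hx)
  have hsub : Prod.fst '' Z ⊆ ⋃ x ∈ t, Prod.fst '' (Z ∩ N x) := by
    rintro _ ⟨y, hy, rfl⟩
    obtain ⟨x, hx, hyx⟩ := Set.mem_iUnion₂.1 (hcov hy)
    exact Set.mem_iUnion₂.2 ⟨x, hx, y, ⟨hy, hyx⟩, rfl⟩
  refine (dimH_mono hsub).trans ?_
  rw [dimH_bUnion htc]
  exact iSup₂_le fun x hx => hdim x (htZ hx)

/-- A zero of the nonzero polynomial `q (·, w)` has finite order, so it is a simple zero of some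
iterated `z`-derivative of `q`. Hence the bad set is a countable union of sets of dimension at most
one, inside a plane of real dimension two. -/
theorem dense_compl_badSet {q : ℂ[X][Y]} (h : ∀ w : ℂ, ‖w‖ = 1 → q.eval (C w) ≠ 0) :
    Dense (badSet q)ᶜ := by
  choose D hD using exists_eval_C_eq_derivative
  have hiter : ∀ k (w : ℂ), (D^[k] q).eval (C w) = derivative^[k] (q.eval (C w)) := by
    intro k w
    induction k with
    | zero => rfl
    | succ k ih => rw [Function.iterate_succ_apply', Function.iterate_succ_apply', hD, ih]
  have hcov : badSet q ⊆ ⋃ k : ℕ, Prod.fst '' {x : ℂ × ℂ | ‖x.2‖ = 1 ∧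
      (D^[k] q).evalEval x.1 x.2 = 0 ∧ (D^[k + 1] q).evalEval x.1 x.2 ≠ 0} := by
    rintro z ⟨w, hw, h0⟩
    have hex : ∃ k, (D^[k] q).evalEval z w ≠ 0 := by
      by_contra! hcon
      refine h w hw (eq_zero_of_hasseDeriv_eq_zero _ z fun k => ?_)
      have h1 := hcon k
      rw [evalEval, hiter, ← factorial_smul_hasseDeriv, LinearMap.smul_apply, eval_smul,
        nsmul_eq_mul] at h1
      exact (mul_eq_zero.1 h1).resolve_left (by exact_mod_cast k.factorial_ne_zero)
    obtain ⟨k, hk⟩ := Nat.exists_eq_add_one_of_ne_zero (n := Nat.find hex) fun hk =>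
      (Nat.find_spec hex) (by rw [hk]; exact h0)
    refine Set.mem_iUnion.2 ⟨k, (z, w), ⟨hw, ?_, ?_⟩, rfl⟩
    · exact not_not.1 (Nat.find_min hex (m := k) (by omega))
    · exact hk ▸ Nat.find_spec hex
  refine dense_compl_of_dimH_lt_finrank ?_
  refine lt_of_le_of_lt (b := 1) ((dimH_mono hcov).trans ?_) ?_
  · rw [dimH_iUnion]
    refine iSup_le fun k => dimH_fst_image_le_one fun w => ?_
    rw [Function.iterate_succ_apply', hD]
  · rw [finrank_real_complex]
    norm_num

end BadSet

/-! ### Slice operators, eigenvectors of the adjoint, injectivity. -/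

section SliceOperators

open Complex Metric Polynomial

/-- `θ = q / p` is an inner function such that no slice of `q` in `z` over the open disk and no
slice in `w` over the closed disk vanishes identically. -/
structure IsRegularQuotient (θ : ℂ × ℂ → ℂ) (p q : ℂ[X][Y]) : Prop where
  isInner : IsInner θ
  eq_div : ∀ x ∈ bidisk, p.evalEval x.1 x.2 ≠ 0 ∧
    θ x = q.evalEval x.1 x.2 / p.evalEval x.1 x.2
  map_ne_zero : ∀ c : ℂ, ‖c‖ < 1 → q.map (evalRingHom c) ≠ 0
  eval_C_ne_zero : ∀ w : ℂ, ‖w‖ ≤ 1 → q.eval (C w) ≠ 0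

/-- Multiplication by `θ` and by its slice `θ (c, ·)`, and the decomposition
`f = f (c, ·) + (z - c) D f`. -/
structure SliceOps (θ : ℂ × ℂ → ℂ) (c : ℂ) where
  /-- multiplication by `θ` -/
  mul : H2 →L[ℂ] H2
  /-- multiplication by `θ (c, ·)` -/
  mulSlice : H2 →L[ℂ] H2
  /-- evaluation at `z = c` -/
  ev : H2 →L[ℂ] H2
  /-- the difference quotient at `z = c` -/
  D : H2 →L[ℂ] H2
  toFun_mul : ∀ h : H2, ∀ x ∈ bidisk, (mul h).toFun x = θ x * h.toFun x
  toFun_mulSlice : ∀ h : H2, ∀ x ∈ bidisk, (mulSlice h).toFun x = θ (c, x.2) * h.toFun x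
  decomp : ∀ f, f = ev f + (Mz (D f) - c • D f)
  toFun_ev : ∀ f, ∀ x ∈ bidisk, (ev f).toFun x = f.toFun (c, x.2)

variable {θ : ℂ × ℂ → ℂ} {p q : ℂ[X][Y]} {c : ℂ}

theorem exists_sliceOps (hθ : IsInner θ) (hc : ‖c‖ < 1) : Nonempty (SliceOps θ c) := by
  obtain ⟨K, hK⟩ := hθ.bounded
  have hs := sepHolo_of_differentiableOn hθ.holomorphic
  obtain ⟨X, hX⟩ := exists_mulOp hs hK
  obtain ⟨X', hX'⟩ := exists_mulOp (hs.freeze (mem_ball_zero_iff.2 hc)) (C := K)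
    fun x hx => hK _ ⟨mem_ball_zero_iff.2 hc, hx.2⟩
  obtain ⟨ev, D, h1, h2⟩ := exists_evalOp hc
  exact ⟨⟨X, X', ev, D, hX, hX', h1, h2⟩⟩

theorem mk_mem_bidisk_of_mem (hc : ‖c‖ < 1) {x : ℂ × ℂ} (hx : x ∈ bidisk) : (c, x.2) ∈ bidisk :=
  ⟨mem_ball_zero_iff.2 hc, hx.2⟩

theorem toFun_Mz_sub_smul (c : ℂ) (h : H2) {x : ℂ × ℂ} (hx : x ∈ bidisk) :
    (Mz h - c • h).toFun x = (x.1 - c) * h.toFun x := by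
  rw [H2.toFun_sub _ _ hx, toFun_Mz, H2.toFun_smul, sub_mul]

namespace SliceOps

variable (o : SliceOps θ c)

theorem ev_mul (hc : ‖c‖ < 1) (h : H2) : o.ev (o.mul h) = o.mulSlice (o.ev h) :=
  H2.ext_toFun fun x hx => by
    rw [o.toFun_ev _ x hx, o.toFun_mul _ _ (mk_mem_bidisk_of_mem hc hx), o.toFun_mulSlice _ x hx,
      o.toFun_ev _ x hx]

theorem ev_mulSlice (hc : ‖c‖ < 1) (h : H2) : o.ev (o.mulSlice h) = o.mulSlice (o.ev h) :=
  H2.ext_toFun fun x hx => by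
    rw [o.toFun_ev _ x hx, o.toFun_mulSlice _ _ (mk_mem_bidisk_of_mem hc hx),
      o.toFun_mulSlice _ x hx, o.toFun_ev _ x hx]

theorem ev_Mz_sub_smul (hc : ‖c‖ < 1) (h : H2) : o.ev (Mz h - c • h) = 0 :=
  H2.ext_toFun fun x hx => by
    rw [o.toFun_ev _ x hx, toFun_Mz_sub_smul _ _ (mk_mem_bidisk_of_mem hc hx), sub_self, zero_mul,
      H2.toFun_zero]

theorem mul_Mz_sub_smul (h : H2) : o.mul (Mz h - c • h) = Mz (o.mul h) - c • o.mul h :=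
  H2.ext_toFun fun x hx => by
    rw [o.toFun_mul _ x hx, toFun_Mz_sub_smul _ _ hx, toFun_Mz_sub_smul _ _ hx, o.toFun_mul _ x hx]
    ring

theorem mem_thetaH2_iff (f : H2) : f ∈ thetaH2 θ ↔ ∃ h, o.mul h = f := by
  constructor
  · rintro ⟨h, hh⟩
    exact ⟨h, H2.ext_toFun fun x hx => by rw [o.toFun_mul _ x hx, hh x hx]⟩
  · rintro ⟨h, rfl⟩
    exact ⟨h, o.toFun_mul h⟩

end SliceOps

theorem norm_le_norm_mul (hθ : IsRegularQuotient θ p q) (o : SliceOps θ c) (h : H2) :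
    ‖h‖ ≤ ‖o.mul h‖ := by
  have := norm_le_of_mul_eq zero_le_one (ae_slice_one_le hθ.isInner hθ.eq_div) (o.toFun_mul h)
  rwa [one_mul] at this

theorem isClosed_range_of_norm_le {A : H2 →L[ℂ] H2} {K : ℝ} (hK : 0 ≤ K)
    (h : ∀ f, ‖f‖ ≤ K * ‖A f‖) : IsClosed (A.range : Set H2) := by
  have h1 : AntilipschitzWith (Real.toNNReal K) A :=
    A.antilipschitz_of_bound fun f => by rw [Real.coe_toNNReal _ hK]; exact h f
  exact h1.isClosed_range A.uniformContinuous

/-- Multiplication by `θ` is bounded below, so `θ H²` is closed. -/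
theorem orthogonal_quotientModule (hθ : IsRegularQuotient θ p q) :
    (quotientModule θ)ᗮ = thetaH2 θ := by
  obtain ⟨o⟩ := exists_sliceOps (c := 0) hθ.isInner (by simp)
  have h1 : thetaH2 θ = o.mul.range := by
    ext f
    rw [o.mem_thetaH2_iff, LinearMap.mem_range]
    rfl
  have h2 : IsClosed (o.mul.range : Set H2) :=
    isClosed_range_of_norm_le zero_le_one fun f => by
      rw [one_mul]; exact norm_le_norm_mul hθ o f
  rw [quotientModule, Submodule.orthogonal_orthogonal_eq_closure, h1]
  exact h2.submodule_topologicalClosure_eq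

/-! ### The compressed shift and its adjoint -/

theorem Mz_mem_thetaH2 {f : H2} (hf : f ∈ thetaH2 θ) : Mz f ∈ thetaH2 θ := by
  obtain ⟨h, hh⟩ := hf
  exact ⟨Mz h, fun x hx => by rw [toFun_Mz, toFun_Mz, hh x hx]; ring⟩

theorem adjoint_Mz_mem_quotientModule {f : H2} (hf : f ∈ quotientModule θ) :
    ContinuousLinearMap.adjoint Mz f ∈ quotientModule θ := by
  rw [Submodule.mem_orthogonal] at hf ⊢
  intro u hu
  rw [ContinuousLinearMap.adjoint_inner_right]
  exact hf _ (Mz_mem_thetaH2 hu)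

theorem coe_adjoint_Sz (f : quotientModule θ) :
    (ContinuousLinearMap.adjoint (Sz θ) f : H2) = ContinuousLinearMap.adjoint Mz f := by
  have : ContinuousLinearMap.adjoint (Sz θ) f =
      ⟨ContinuousLinearMap.adjoint Mz f, adjoint_Mz_mem_quotientModule f.2⟩ := by
    refine ext_inner_left ℂ fun g => ?_
    rw [ContinuousLinearMap.adjoint_inner_right]
    have h1 : ⟪Sz θ g, f⟫_ℂ = ⟪Mz (g : H2), (f : H2)⟫_ℂ :=
      (quotientModule θ).inner_orthogonalProjectionOnto_eq_of_mem_right f (Mz (g : H2))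
    rw [h1, ← ContinuousLinearMap.adjoint_inner_right, Submodule.coe_inner]
  rw [this]

theorem mem_kernelBundle_iff {d : ℂ} (f : quotientModule θ) :
    f ∈ kernelBundle (ContinuousLinearMap.adjoint (Sz θ)) d ↔
      ContinuousLinearMap.adjoint Mz (f : H2) = d • (f : H2) := by
  rw [kernelBundle, LinearMap.mem_ker, ← coe_adjoint_Sz, ← Submodule.coe_smul, Subtype.coe_inj,
    ← sub_eq_zero (a := ContinuousLinearMap.adjoint (Sz θ) f)]
  rfl

theorem inner_Mz_sub_smul_eq_zero {u : H2}
    (hu : ContinuousLinearMap.adjoint Mz u = conj c • u) (h : H2) : ⟪Mz h - c • h, u⟫_ℂ = 0 := by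
  rw [inner_sub_left, ← ContinuousLinearMap.adjoint_inner_right, hu, inner_smul_right,
    inner_smul_left, sub_self]

theorem inner_eq_inner_ev (o : SliceOps θ c) {u : H2}
    (hu : ContinuousLinearMap.adjoint Mz u = conj c • u) (h : H2) :
    ⟪h, u⟫_ℂ = ⟪o.ev h, u⟫_ℂ := by
  conv_lhs => rw [o.decomp h, inner_add_left, inner_Mz_sub_smul_eq_zero hu, add_zero]

/-- An eigenvector at `conj c` does not distinguish `θ (c, ·) h` from `θ h`, as both have the same
restriction to `z = c`; the latter is orthogonal to `K_θ`. -/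
theorem inner_mulSlice_eq_zero (hc : ‖c‖ < 1) (o : SliceOps θ c) {u : H2}
    (huK : u ∈ quotientModule θ)
    (hu : ContinuousLinearMap.adjoint Mz u = conj c • u) (h : H2) : ⟪o.mulSlice h, u⟫_ℂ = 0 := by
  rw [inner_eq_inner_ev o hu, o.ev_mulSlice hc, ← o.ev_mul hc, ← inner_eq_inner_ev o hu]
  exact huK _ ((o.mem_thetaH2_iff _).2 ⟨h, rfl⟩)

/-- The converse source of eigenvectors: every `v` orthogonal to `θ (c, ·) H²` yields one by the
adjoint of evaluation at `z = c`. -/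
theorem adjoint_ev_mem (hc : ‖c‖ < 1) (o : SliceOps θ c) {v : H2}
    (hv : ∀ h, ⟪o.mulSlice h, v⟫_ℂ = 0) :
    ContinuousLinearMap.adjoint o.ev v ∈ quotientModule θ ∧
      ContinuousLinearMap.adjoint Mz (ContinuousLinearMap.adjoint o.ev v) =
        conj c • ContinuousLinearMap.adjoint o.ev v := by
  constructor
  · rw [Submodule.mem_orthogonal]
    intro u hu
    obtain ⟨h, rfl⟩ := (o.mem_thetaH2_iff u).1 hu
    rw [ContinuousLinearMap.adjoint_inner_right, o.ev_mul hc, hv]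
  · refine ext_inner_left ℂ fun h => ?_
    rw [ContinuousLinearMap.adjoint_inner_right, inner_smul_right, ← inner_smul_left,
      ← sub_eq_zero, ← inner_sub_left, ContinuousLinearMap.adjoint_inner_right,
      o.ev_Mz_sub_smul hc, inner_zero_left]

/-! ### Injectivity of `S_z - c` -/

theorem eq_zero_of_mem_of_mem {f : H2} (h1 : f ∈ quotientModule θ) (h2 : f ∈ thetaH2 θ) : f = 0 :=
  inner_self_eq_zero.1 (h1 f h2)

theorem coe_Sz_sub_apply (c : ℂ) (f : quotientModule θ) :
    (((Sz θ) - c • ContinuousLinearMap.id ℂ (quotientModule θ)) f : H2) =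
      (quotientModule θ).orthogonalProjectionOnto (Mz f - c • (f : H2)) := by
  rw [map_sub, map_smul, Submodule.orthogonalProjectionOnto_mem_subspace_eq_self]
  rfl

theorem sub_coe_Sz_sub_apply_mem (hθ : IsRegularQuotient θ p q) (c : ℂ) (f : quotientModule θ) :
    (Mz f - c • (f : H2)) - (((Sz θ) - c • ContinuousLinearMap.id ℂ (quotientModule θ)) f : H2) ∈
      thetaH2 θ := by
  rw [coe_Sz_sub_apply]
  refine (orthogonal_quotientModule hθ).le ?_
  exact (quotientModule θ).sub_starProjection_mem_orthogonal _

theorem eq_zero_of_Mz_eq_smul {f : H2} (h : Mz f = c • f) : f = 0 := by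
  have hcoef : ∀ k, Mz f k = c * f k := fun k => by rw [h]; rfl
  by_cases hc : c = 0
  · rw [← norm_eq_zero, ← norm_Mz, h, hc, zero_smul, norm_zero]
  · ext ⟨m, n⟩
    change f (m, n) = 0
    induction m with
    | zero =>
      have := hcoef (0, n)
      rw [Mz_apply_zero] at this
      exact (mul_eq_zero.1 this.symm).resolve_left hc
    | succ m ih =>
      have := hcoef (m + 1, n)
      rw [Mz_apply_succ, ih] at this
      exact (mul_eq_zero.1 this.symm).resolve_left hc

theorem exists_slice_ne_zero (hθ : IsRegularQuotient θ p q) (hc : ‖c‖ < 1) :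
    ∃ w ∈ ball (0 : ℂ) 1, θ (c, w) ≠ 0 := by
  by_contra! hcon
  refine hθ.map_ne_zero c hc (eq_zero_of_infinite_isRoot _ (Set.Infinite.mono
    (s := ball (0 : ℂ) 1) (fun w hw => ?_) ?_))
  · have h1 := hθ.eq_div (c, w) ⟨mem_ball_zero_iff.2 hc, hw⟩
    rw [hcon w hw, eq_comm, div_eq_zero_iff] at h1
    change eval w _ = 0
    rw [map_evalRingHom_eval]
    exact h1.2.resolve_right h1.1
  · exact infinite_of_mem_nhds (0 : ℂ) (ball_mem_nhds _ one_pos)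

theorem ev_eq_zero_of_mulSlice_eq_zero (hθ : IsRegularQuotient θ p q) (hc : ‖c‖ < 1)
    (o : SliceOps θ c) {h : H2} (hY : o.mulSlice (o.ev h) = 0) : o.ev h = 0 := by
  have hcb : c ∈ ball (0 : ℂ) 1 := mem_ball_zero_iff.2 hc
  have h1 := ((sepHolo_of_differentiableOn hθ.isInner.holomorphic).right c hcb).analyticOnNhd
    isOpen_ball
  have h2 := (h.sepHolo.right c hcb).analyticOnNhd isOpen_ball
  have h3 : ∀ w ∈ ball (0 : ℂ) 1, θ (c, w) * h.toFun (c, w) = 0 := by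
    intro w hw
    have hx : ((0 : ℂ), w) ∈ bidisk := ⟨mem_ball_self one_pos, hw⟩
    have := o.toFun_mulSlice (o.ev h) _ hx
    rw [hY, H2.toFun_zero, o.toFun_ev _ _ hx] at this
    exact this.symm
  rcases h1.eq_zero_or_eq_zero_of_mul_eq_zero h2 h3 (convex_ball _ _).isPreconnected with h | h'
  · obtain ⟨w, hw, hne⟩ := exists_slice_ne_zero hθ hc
    exact absurd (h w hw) hne
  · exact H2.ext_toFun fun x hx => by rw [o.toFun_ev _ x hx, H2.toFun_zero, h' x.2 hx.2]

/-- A kernel vector satisfies `(z - c) f = θ h`. For `|c| < 1`, setting `z = c` gives `h (c, ·) =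
0`, so `z - c` cancels and `f` lies in both `θ H²` and `K_θ`. For `|c| ≥ 1`, `(z - c) f` is
orthogonal to `f`, and Pythagoras applied to `z f` forces `(z - c) f = 0`. -/
theorem injective_Sz_sub (hθ : IsRegularQuotient θ p q) (c : ℂ) :
    Function.Injective ((Sz θ) - c • ContinuousLinearMap.id ℂ (quotientModule θ)) := by
  rw [injective_iff_map_eq_zero]
  intro f hf
  have hmem := sub_coe_Sz_sub_apply_mem hθ c f
  rw [hf, Submodule.coe_zero, sub_zero] at hmem
  rw [← Submodule.coe_eq_zero]
  rcases lt_or_ge ‖c‖ 1 with hc | hc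
  · obtain ⟨o⟩ := exists_sliceOps hθ.isInner hc
    obtain ⟨h, hh⟩ := (o.mem_thetaH2_iff _).1 hmem
    have hev : o.ev h = 0 := ev_eq_zero_of_mulSlice_eq_zero hθ hc o (by
      rw [← o.ev_mul hc, hh, o.ev_Mz_sub_smul hc])
    have hD := o.decomp h
    rw [hev, zero_add] at hD
    rw [hD, o.mul_Mz_sub_smul] at hh
    have h0 : Mz ((f : H2) - o.mul (o.D h)) = c • ((f : H2) - o.mul (o.D h)) := by
      rw [map_sub, smul_sub, sub_eq_sub_iff_sub_eq_sub, hh]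
    have h1 := sub_eq_zero.1 (eq_zero_of_Mz_eq_smul h0)
    exact eq_zero_of_mem_of_mem f.2 ((o.mem_thetaH2_iff _).2 ⟨_, h1.symm⟩)
  · refine eq_zero_of_Mz_eq_smul (c := c) (sub_eq_zero.1 ?_)
    have h1 := f.2 _ hmem
    have h2 := norm_add_sq (𝕜 := ℂ) (Mz f - c • (f : H2)) (c • (f : H2))
    rw [sub_add_cancel, inner_smul_right, h1, mul_zero, map_zero, mul_zero, add_zero, norm_Mz,
      norm_smul] at h2
    have h3 : ‖(f : H2)‖ ≤ ‖c‖ * ‖(f : H2)‖ := le_mul_of_one_le_left (norm_nonneg _) hc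
    have h4 := pow_le_pow_left₀ (norm_nonneg _) h3 2
    exact norm_eq_zero.1 (pow_eq_zero_iff two_ne_zero |>.1
      (le_antisymm (by linarith) (by positivity)))

end SliceOperators

/-! ### The fibres of the kernel bundle, and the conclusion. -/

section Kernels

open Complex Metric Polynomial

variable {θ : ℂ × ℂ → ℂ} {p q : ℂ[X][Y]} {c : ℂ}

/-- A polynomial in `w` as an element of `H²(𝔻²)`. -/
def polyW (s : ℂ[X]) : H2 := ∑ j ∈ s.support, lp.single 2 ((0 : ℕ), j) (s.coeff j)

theorem toFun_single (k : ℕ × ℕ) (a : ℂ) (x : ℂ × ℂ) :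
    H2.toFun (lp.single 2 k a) x = a * (x.1 ^ k.1 * x.2 ^ k.2) := by
  rw [H2.toFun, tsum_eq_single k]
  · rw [lp.single_apply_self]
  · intro j hj
    rw [lp.single_apply_ne _ _ _ hj, zero_mul]

theorem toFun_polyW (s : ℂ[X]) {x : ℂ × ℂ} (hx : x ∈ bidisk) : (polyW s).toFun x = s.eval x.2 := by
  have h : ∀ t : Finset ℕ,
      H2.toFun (∑ j ∈ t, lp.single 2 ((0 : ℕ), j) (s.coeff j)) x =
        ∑ j ∈ t, s.coeff j * x.2 ^ j := by
    intro t
    induction t using Finset.induction_on with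
    | empty => rw [Finset.sum_empty, Finset.sum_empty, H2.toFun_zero]
    | insert a t ha ih =>
      rw [Finset.sum_insert ha, Finset.sum_insert ha, H2.toFun_add _ _ hx, ih, toFun_single,
        pow_zero, one_mul]
  rw [polyW, h, eval_eq_sum, Polynomial.sum]

theorem inner_polyW (s : ℂ[X]) (f : H2) :
    ⟪polyW s, f⟫_ℂ = ∑ j ∈ s.support, conj (s.coeff j) * f (0, j) := by
  rw [polyW, sum_inner]
  refine Finset.sum_congr rfl fun j _ => ?_
  rw [lp.inner_single_left, RCLike.inner_apply, mul_comm]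

theorem apply_eq_pow_mul {d : ℂ} {f : H2} (hf : ContinuousLinearMap.adjoint Mz f = d • f)
    (m n : ℕ) : f (m, n) = d ^ m * f (0, n) := by
  induction m with
  | zero => rw [pow_zero, one_mul]
  | succ m ih =>
    rw [← adjoint_Mz_apply, hf]
    change d * f (m, n) = _
    rw [ih, pow_succ']
    ring

theorem norm_lt_one_of_adjoint_Mz_eq {d : ℂ} {f : H2}
    (hf : ContinuousLinearMap.adjoint Mz f = d • f) (hf0 : f ≠ 0) : ‖d‖ < 1 := by
  by_contra! hd
  refine hf0 ?_
  ext ⟨m, n⟩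
  change f (m, n) = 0
  rw [apply_eq_pow_mul hf]
  refine mul_eq_zero_of_right _ ?_
  have h1 : Tendsto (fun m : ℕ => ‖f (m, n)‖ ^ 2) atTop (𝓝 0) := by
    have hinj : Function.Injective fun m : ℕ => (m, n) := fun a b h => (Prod.mk.inj h).1
    have := f.hasSum_norm_sq.summable.comp_injective hinj
    exact this.tendsto_atTop_zero
  have h2 : ‖f (0, n)‖ ^ 2 ≤ 0 := by
    refine ge_of_tendsto' h1 fun m => ?_
    rw [apply_eq_pow_mul hf m, norm_mul, norm_pow]
    exact pow_le_pow_left₀ (norm_nonneg _)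
      (le_mul_of_one_le_left (norm_nonneg _) (one_le_pow₀ hd)) 2
  exact norm_eq_zero.1 ((pow_eq_zero_iff two_ne_zero).1 (le_antisymm h2 (by positivity)))

theorem exists_bound_evalEval (r : ℂ[X][Y]) :
    ∃ M : ℝ, 0 < M ∧ ∀ z w : ℂ, ‖z‖ ≤ 1 → ‖w‖ ≤ 1 → ‖r.evalEval z w‖ ≤ M := by
  obtain ⟨M, hM⟩ := ((isCompact_closedBall (0 : ℂ) 1).prod
    (isCompact_closedBall (0 : ℂ) 1)).exists_bound_of_continuousOn
    (differentiable_evalEval r).continuous.continuousOn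
  refine ⟨max M 1, by positivity, fun z w hz hw => le_max_of_le_left (hM (z, w) ⟨?_, ?_⟩)⟩
  · exact mem_closedBall_zero_iff.2 hz
  · exact mem_closedBall_zero_iff.2 hw

/-- Since `θ p w ^ k = q w ^ k` lies in `θ H²` and `u` sees only its value at `z = c`, `u` is
orthogonal to `q (c, w) w ^ k`. -/
theorem inner_polyW_eq_zero (hθ : IsRegularQuotient θ p q) (hc : ‖c‖ < 1) {u : H2}
    (huK : u ∈ quotientModule θ) (hu : ContinuousLinearMap.adjoint Mz u = conj c • u) (k : ℕ) :
    ⟪polyW (q.map (evalRingHom c) * X ^ k), u⟫_ℂ = 0 := by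
  obtain ⟨o⟩ := exists_sliceOps hθ.isInner hc
  obtain ⟨M, -, hM⟩ := exists_bound_evalEval p
  obtain ⟨P, hP⟩ := exists_mulOp
    (sepHolo_of_differentiableOn (differentiable_evalEval p).differentiableOn)
    (fun x hx => hM x.1 x.2 (mem_ball_zero_iff.1 hx.1).le (mem_ball_zero_iff.1 hx.2).le)
  have h1 : o.ev (o.mul (P (polyW (X ^ k)))) = polyW (q.map (evalRingHom c) * X ^ k) := by
    refine H2.ext_toFun fun x hx => ?_
    have hx' := mk_mem_bidisk_of_mem hc hx
    have h2 := hθ.eq_div _ hx'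
    rw [o.toFun_ev _ x hx, o.toFun_mul _ _ hx', hP _ _ hx', toFun_polyW _ hx', toFun_polyW _ hx,
      h2.2, eval_mul, map_evalRingHom_eval, ← mul_assoc, div_mul_cancel₀ _ h2.1]
  rw [← h1, ← inner_eq_inner_ev o hu]
  exact huK _ ((o.mem_thetaH2_iff _).2 ⟨_, rfl⟩)

/-- The nonzero leading coefficient of `s` lets each relation solve for its last entry in terms of
earlier ones. -/
theorem eq_zero_of_recurrence {s : ℂ[X]} (hs : s ≠ 0) {a : ℕ → ℂ}
    (h : ∀ k, ∑ j ∈ (s * X ^ k).support, conj ((s * X ^ k).coeff j) * a j = 0)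
    (h0 : ∀ j < s.natDegree, a j = 0) (j : ℕ) : a j = 0 := by
  induction j using Nat.strong_induction_on with
  | _ j ih =>
    rcases lt_or_ge j s.natDegree with hj | hj
    · exact h0 j hj
    · obtain ⟨k, rfl⟩ := Nat.exists_eq_add_of_le hj
      have hdeg : (s * X ^ k).natDegree = s.natDegree + k := natDegree_mul_X_pow _ hs
      have hlead : (s * X ^ k).coeff (s.natDegree + k) ≠ 0 := by
        rw [coeff_mul_X_pow]
        exact leadingCoeff_ne_zero.2 hs
      have h1 := h k
      rw [Finset.sum_eq_single (s.natDegree + k)] at h1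
      · exact (mul_eq_zero.1 h1).resolve_left ((_root_.map_ne_zero _).2 hlead)
      · intro i hi hij
        have hile : i ≤ s.natDegree + k := (le_natDegree_of_mem_supp i hi).trans hdeg.le
        rw [ih i (lt_of_le_of_ne hile hij), mul_zero]
      · intro hj'
        exact absurd (mem_support_iff.2 hlead) hj'

theorem eq_zero_of_first_coeff_eq_zero (hθ : IsRegularQuotient θ p q) (hc : ‖c‖ < 1) {u : H2}
    (huK : u ∈ quotientModule θ) (hu : ContinuousLinearMap.adjoint Mz u = conj c • u)
    (h0 : ∀ j < (q.map (evalRingHom c)).natDegree, u (0, j) = 0) : u = 0 := by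
  have hall : ∀ j, u (0, j) = 0 :=
    eq_zero_of_recurrence (a := fun j => u (0, j)) (hθ.map_ne_zero c hc)
      (fun k => (inner_polyW _ u).symm.trans (inner_polyW_eq_zero hθ hc huK hu k)) h0
  ext ⟨m, n⟩
  change u (m, n) = 0
  rw [apply_eq_pow_mul hu, hall, mul_zero]

/-- By the recurrence an eigenvector is determined by its first coefficients in `w`, as many as the
degree of `q (conj d, ·)`. The argument is algebraic and covers bad points as well. -/
theorem finiteDimensional_kernelBundle (hθ : IsRegularQuotient θ p q) (d : ℂ) :
    FiniteDimensional ℂ (kernelBundle (ContinuousLinearMap.adjoint (Sz θ)) d) := by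
  let N := (q.map (evalRingHom (conj d))).natDegree
  let φ : kernelBundle (ContinuousLinearMap.adjoint (Sz θ)) d →ₗ[ℂ] (Fin N → ℂ) :=
    { toFun := fun f j => ((f : quotientModule θ) : H2) (0, (j : ℕ))
      map_add' := fun _ _ => rfl
      map_smul' := fun _ _ => rfl }
  refine Module.Finite.of_injective φ ((injective_iff_map_eq_zero φ).2 fun f hf => ?_)
  have hker := (mem_kernelBundle_iff (f : quotientModule θ)).1 f.2
  by_contra hne
  have hne' : ((f : quotientModule θ) : H2) ≠ 0 := fun h => hne (Subtype.ext (Subtype.ext h))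
  have hd := norm_lt_one_of_adjoint_Mz_eq hker hne'
  refine hne' (eq_zero_of_first_coeff_eq_zero hθ (c := conj d) (by rwa [norm_conj])
    (f : quotientModule θ).2 (by rwa [conj_conj]) fun j hj => ?_)
  exact congrFun hf ⟨j, hj⟩

/-! ### Points off the bad set -/

theorem exists_le_norm_near_sphere {g : ℂ → ℂ} (hg : Continuous g)
    (h : ∀ w, ‖w‖ = 1 → g w ≠ 0) :
    ∃ δ > 0, ∃ ρ < (1 : ℝ), ∀ w, ρ < ‖w‖ → ‖w‖ < 1 → δ ≤ ‖g w‖ := by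
  obtain ⟨e, he, hmin⟩ := (isCompact_sphere (0 : ℂ) 1).exists_isMinOn
    ⟨1, by simp⟩ hg.norm.continuousOn
  have hpos : 0 < ‖g e‖ := norm_pos_iff.2 (h e (mem_sphere_zero_iff_norm.1 he))
  have hopen : IsOpen {w | ‖g e‖ / 2 < ‖g w‖} := isOpen_lt continuous_const hg.norm
  obtain ⟨η, hη, hsub⟩ := (isCompact_sphere (0 : ℂ) 1).exists_thickening_subset_open hopen
    fun w hw => by
      have h1 : ‖g e‖ ≤ ‖g w‖ := hmin hw
      change ‖g e‖ / 2 < ‖g w‖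
      linarith
  refine ⟨‖g e‖ / 2, by positivity, max (1 - η) 0, max_lt (by linarith) one_pos,
    fun w hw hw1 => le_of_lt (hsub ?_)⟩
  have hw0 : 0 < ‖w‖ := (le_max_right _ _).trans_lt hw
  have hwη : 1 - η < ‖w‖ := (le_max_left _ _).trans_lt hw
  refine mem_thickening_iff.2 ⟨(‖w‖⁻¹ : ℝ) • w, ?_, ?_⟩
  · rw [mem_sphere_zero_iff_norm, norm_smul, norm_inv, norm_norm, inv_mul_cancel₀ hw0.ne']
  · rw [dist_eq_norm]
    have h1 : w - (‖w‖⁻¹ : ℝ) • w = (1 - ‖w‖⁻¹ : ℝ) • w := by rw [sub_smul, one_smul]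
    have h2 : 1 ≤ ‖w‖⁻¹ := (one_le_inv₀ hw0).2 hw1.le
    rw [h1, norm_smul, Real.norm_of_nonpos (by linarith), neg_sub, sub_mul, one_mul,
      inv_mul_cancel₀ hw0.ne']
    linarith

theorem exists_slice_bound (hθ : IsRegularQuotient θ p q) (hc : ‖c‖ < 1) (hcq : c ∉ badSet q) :
    ∃ K : ℝ, 0 ≤ K ∧ ∀ᵐ τ : ℝ, ∀ ε > 0, ∃ ρ < (1 : ℝ), ∀ t : ℂ, ρ < ‖t‖ → ‖t‖ < 1 →
      1 ≤ (K + ε) * ‖θ (c, t * exp (τ * I))‖ := by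
  obtain ⟨δ, hδ, ρ, hρ, hq⟩ := exists_le_norm_near_sphere (g := fun w => q.evalEval c w)
    ((differentiable_evalEval q).continuous.comp (by fun_prop : Continuous fun w : ℂ => (c, w)))
    fun w hw h0 => hcq ⟨w, hw, h0⟩
  obtain ⟨M, hM0, hM⟩ := exists_bound_evalEval p
  refine ⟨M / δ, by positivity, Eventually.of_forall fun τ ε hε => ⟨ρ, hρ, fun t ht ht1 => ?_⟩⟩
  have hn : ‖t * exp (τ * I)‖ = ‖t‖ := by rw [norm_mul, norm_exp_ofReal_mul_I, mul_one]
  have h1 := hθ.eq_div (c, t * exp (τ * I))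
    ⟨mem_ball_zero_iff.2 hc, mem_ball_zero_iff.2 (hn.trans_lt ht1)⟩
  have h2 := hq (t * exp (τ * I)) (by rwa [hn]) (by rwa [hn])
  have h3 := hM c (t * exp (τ * I)) hc.le (by rw [hn]; exact ht1.le)
  have hp : 0 < ‖p.evalEval c (t * exp (τ * I))‖ := norm_pos_iff.2 h1.1
  have h4 : δ / M ≤ ‖θ (c, t * exp (τ * I))‖ := by
    rw [h1.2, norm_div]
    exact div_le_div₀ (norm_nonneg _) h2 hp h3
  calc (1 : ℝ) = M / δ * (δ / M) := by field_simp
    _ ≤ (M / δ + ε) * ‖θ (c, t * exp (τ * I))‖ := by gcongr; linarith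

theorem exists_norm_le_mulSlice (hθ : IsRegularQuotient θ p q) (hc : ‖c‖ < 1)
    (hcq : c ∉ badSet q) (o : SliceOps θ c) : ∃ K : ℝ, 0 ≤ K ∧ ∀ h, ‖h‖ ≤ K * ‖o.mulSlice h‖ := by
  obtain ⟨K, hK, hb⟩ := exists_slice_bound hθ hc hcq
  exact ⟨K, hK, fun h => norm_le_of_mul_eq (F := fun x => θ (c, x.2)) hK hb (o.toFun_mulSlice h)⟩

/-- This is the injectivity argument made quantitative: with `r = (S_z - c) f` and `(z - c) f = r +
θ h`, setting `z = c` controls `h (c, ·)` by `r`. The remaining part of `θ h` is `(z - c) θ D h`,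
and it can be moved to the left at no cost because `θ D h` is orthogonal to `f`. -/
theorem exists_norm_le_Sz_sub (hθ : IsRegularQuotient θ p q) (hc : ‖c‖ < 1) (hcq : c ∉ badSet q) :
    ∃ K : ℝ, 0 ≤ K ∧ ∀ f : quotientModule θ,
      ‖f‖ ≤ K * ‖((Sz θ) - c • ContinuousLinearMap.id ℂ (quotientModule θ)) f‖ := by
  obtain ⟨o⟩ := exists_sliceOps hθ.isInner hc
  obtain ⟨K, hK, hb⟩ := exists_norm_le_mulSlice hθ hc hcq o
  have hc' : 0 < 1 - ‖c‖ := by linarith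
  refine ⟨(1 + ‖o.mul‖ * (K * ‖o.ev‖)) / (1 - ‖c‖), by positivity, fun f => ?_⟩
  set r := ((Sz θ) - c • ContinuousLinearMap.id ℂ (quotientModule θ)) f with hr
  obtain ⟨h, hh⟩ := (o.mem_thetaH2_iff _).1 (sub_coe_Sz_sub_apply_mem hθ c f)
  rw [← hr] at hh
  have h1 : o.mulSlice (o.ev h) = - o.ev r := by
    rw [← o.ev_mul hc, hh, map_sub, o.ev_Mz_sub_smul hc, zero_sub]
  have h2 : ‖o.ev h‖ ≤ K * (‖o.ev‖ * ‖r‖) := by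
    refine (hb _).trans ?_
    rw [h1, norm_neg]
    gcongr
    exact o.ev.le_opNorm _
  have h3 : Mz ((f : H2) - o.mul (o.D h)) - c • ((f : H2) - o.mul (o.D h)) =
      r + o.mul (o.ev h) := by
    have h4 : o.mul h = o.mul (o.ev h) + (Mz (o.mul (o.D h)) - c • o.mul (o.D h)) := by
      rw [← o.mul_Mz_sub_smul, ← map_add, ← o.decomp h]
    rw [h4, eq_sub_iff_add_eq] at hh
    rw [map_sub, smul_sub, sub_sub_sub_comm, ← hh]
    abel
  have h5 := norm_Mz_sub_smul_ge c ((f : H2) - o.mul (o.D h))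
  rw [h3] at h5
  have h6 : ‖(r : H2) + o.mul (o.ev h)‖ ≤ ‖r‖ + ‖o.mul‖ * (K * (‖o.ev‖ * ‖r‖)) := by
    exact (norm_add_le _ _).trans (add_le_add le_rfl ((o.mul.le_opNorm _).trans
      (mul_le_mul_of_nonneg_left h2 (norm_nonneg _))))
  have h7 : ‖f‖ ≤ ‖(f : H2) - o.mul (o.D h)‖ := by
    have h8 : ⟪(f : H2), o.mul (o.D h)⟫_ℂ = 0 :=
      inner_eq_zero_symm.1 (f.2 _ ((o.mem_thetaH2_iff _).2 ⟨_, rfl⟩))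
    have h9 := norm_sub_sq (𝕜 := ℂ) (f : H2) (o.mul (o.D h))
    rw [h8, map_zero, mul_zero, sub_zero] at h9
    refine le_of_sq_le_sq ?_ (norm_nonneg _)
    rw [h9, Submodule.coe_norm]
    exact le_add_of_nonneg_right (by positivity)
  rw [div_mul_eq_mul_div, le_div_iff₀ hc']
  nlinarith

theorem surjective_adjoint_Sz_sub (hθ : IsRegularQuotient θ p q) (hc : ‖c‖ < 1)
    (hcq : c ∉ badSet q) : Function.Surjective (ContinuousLinearMap.adjoint (Sz θ) -
      conj c • ContinuousLinearMap.id ℂ (quotientModule θ)) := by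
  obtain ⟨K, hK, hb⟩ := exists_norm_le_Sz_sub hθ hc hcq
  set A := (Sz θ) - c • ContinuousLinearMap.id ℂ (quotientModule θ) with hA
  have h1 : AntilipschitzWith (Real.toNNReal K) A :=
    A.antilipschitz_of_bound fun f => by rw [Real.coe_toNNReal _ hK]; exact hb f
  obtain ⟨L, hL⟩ := exists_leftInverse_of_isClosed_range h1.injective
    (h1.isClosed_range A.uniformContinuous)
  rw [← adjoint_sub_smul_id, ← hA]
  intro y
  refine ⟨ContinuousLinearMap.adjoint L y, ?_⟩
  rw [← ContinuousLinearMap.comp_apply, ← ContinuousLinearMap.adjoint_comp]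
  change ContinuousLinearMap.adjoint (L * A) y = y
  rw [hL]
  refine ext_inner_left ℂ fun g => ?_
  rw [ContinuousLinearMap.adjoint_inner_right]
  rfl

/-- Off the bad set `θ (c, ·) H²` is closed, so membership can be tested against its orthogonal
complement, and `adjoint_ev_mem` turns each test vector into a kernel vector. -/
theorem exists_mulSlice_eq_ev (hθ : IsRegularQuotient θ p q) (hc : ‖c‖ < 1) (hcq : c ∉ badSet q)
    (o : SliceOps θ c) {f : quotientModule θ}
    (hf : ∀ g ∈ kernelBundle (ContinuousLinearMap.adjoint (Sz θ)) (conj c), ⟪g, f⟫_ℂ = 0) :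
    ∃ g, o.mulSlice g = o.ev f := by
  obtain ⟨K, hK, hb⟩ := exists_norm_le_mulSlice hθ hc hcq o
  have hcl := isClosed_range_of_norm_le hK hb
  have hmem : o.ev f ∈ (o.mulSlice.range)ᗮᗮ := by
    rw [Submodule.mem_orthogonal]
    intro v hv
    rw [Submodule.mem_orthogonal] at hv
    have h1 := adjoint_ev_mem hc o (v := v) fun h => hv _ ⟨h, rfl⟩
    have h2 := hf ⟨_, h1.1⟩ ((mem_kernelBundle_iff _).2 h1.2)
    rw [Submodule.coe_inner] at h2
    rwa [← ContinuousLinearMap.adjoint_inner_left]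
  rw [Submodule.orthogonal_orthogonal_eq_closure, hcl.submodule_topologicalClosure_eq] at hmem
  exact hmem

theorem eq_zero_of_forall_inner_kernelBundle (hθ : IsRegularQuotient θ p q)
    {f : quotientModule θ} (hf : ∀ c : ℂ, ‖c‖ < 1 → c ∉ badSet q →
      ∀ g ∈ kernelBundle (ContinuousLinearMap.adjoint (Sz θ)) (conj c), ⟪g, f⟫_ℂ = 0) : f = 0 := by
  have hdense := dense_compl_badSet fun w hw => hθ.eval_C_ne_zero w hw.le
  obtain ⟨b, hb, hbf⟩ := exists_powerSum_mul_eq (f : H2).sepHolo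
    (sepHolo_of_differentiableOn hθ.isInner.holomorphic)
    (fun z hz => exists_slice_ne_zero hθ (mem_ball_zero_iff.1 hz)) (S := (badSet q)ᶜ)
    (by rw [hdense.closure_eq]; exact Set.subset_univ _) (by
      rintro z ⟨hzq, hz⟩
      have hz1 := mem_ball_zero_iff.1 hz
      obtain ⟨o⟩ := exists_sliceOps hθ.isInner hz1
      obtain ⟨g, hg⟩ := exists_mulSlice_eq_ev hθ hz1 hzq o (hf z hz1 hzq)
      refine ⟨fun w => g.toFun (z, w), g.sepHolo.right z hz, fun w hw => ?_⟩
      have hx : (z, w) ∈ bidisk := ⟨hz, hw⟩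
      rw [← o.toFun_mulSlice g (z, w) hx, hg, o.toFun_ev _ _ hx])
  obtain ⟨h, hh, -⟩ := exists_H2_of_mul_eq zero_le_one
    (ae_slice_one_le hθ.isInner hθ.eq_div) hb f hbf
  refine Subtype.ext (eq_zero_of_mem_of_mem f.2 ⟨h, fun x hx => ?_⟩)
  rw [← hbf x hx, toFun_eq_powerSum h, hh]

/-- Without zeros, `θ (c, ·)` could be divided out of every element of `H²(𝔻²)`; a kernel vector
would then lie in `θ (c, ·) H²`, to which it is orthogonal. -/
theorem exists_slice_zero (hθ : IsRegularQuotient θ p q) (hc : ‖c‖ < 1) (hcq : c ∉ badSet q)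
    (hker : kernelBundle (ContinuousLinearMap.adjoint (Sz θ)) (conj c) ≠ ⊥) :
    ∃ w ∈ ball (0 : ℂ) 1, θ (c, w) = 0 := by
  by_contra! hcon
  obtain ⟨o⟩ := exists_sliceOps hθ.isInner hc
  obtain ⟨K, hK, hb⟩ := exists_slice_bound hθ hc hcq
  obtain ⟨u, hu, hu0⟩ := (Submodule.ne_bot_iff _).1 hker
  have hcb : c ∈ ball (0 : ℂ) 1 := mem_ball_zero_iff.2 hc
  have hinv : SepHolo fun x : ℂ × ℂ => (θ (c, x.2))⁻¹ := by
    have hs := (sepHolo_of_differentiableOn hθ.isInner.holomorphic).freeze hcb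
    exact ⟨hs.cont.inv₀ fun x hx => hcon _ hx.2,
      fun w hw => (hs.left w hw).fun_inv fun z _ => hcon _ hw,
      fun z hz => (hs.right z hz).fun_inv fun w hw => hcon _ hw⟩
  obtain ⟨b, hbc, hbf⟩ := (hinv.mul (u : H2).sepHolo).exists_powerSum
  obtain ⟨h, hh, -⟩ := exists_H2_of_mul_eq (F := fun x => θ (c, x.2)) hK hb hbc (u : H2)
    fun x hx => by rw [hbf x hx, mul_inv_cancel_left₀ (hcon _ hx.2)]
  have h1 : o.mulSlice h = u := by
    refine H2.ext_toFun fun x hx => ?_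
    rw [o.toFun_mulSlice _ x hx, toFun_eq_powerSum h, hh, hbf x hx,
      mul_inv_cancel_left₀ (hcon _ hx.2)]
  have h2 := inner_mulSlice_eq_zero hc o u.2 ((mem_kernelBundle_iff u).1 hu) h
  rw [h1] at h2
  exact hu0 (Subtype.ext (inner_self_eq_zero.1 h2))

theorem one_sub_mul_toFun {d : ℂ} {f : H2} (hf : ContinuousLinearMap.adjoint Mz f = d • f)
    {x : ℂ × ℂ} (hx : x ∈ bidisk) : (1 - d * x.1) * f.toFun x = f.toFun (0, x.2) := by
  have h := mul_toFun_adjoint_Mz f hx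
  rw [hf, H2.toFun_smul] at h
  linear_combination -h

/-- An element of a kernel that is orthogonal to the kernels over a nonempty open set is zero. -/
theorem eq_zero_of_inner_eq_zero_on_open (hθ : IsRegularQuotient θ p q) {V : Set ℂ}
    (hV : IsOpen V) (hVne : V.Nonempty) (hV1 : ∀ c ∈ V, ‖c‖ < 1)
    (hker : ∀ c ∈ V, kernelBundle (ContinuousLinearMap.adjoint (Sz θ)) (conj c) ≠ ⊥) {d : ℂ}
    {f : quotientModule θ} (hf : f ∈ kernelBundle (ContinuousLinearMap.adjoint (Sz θ)) d)
    (horth : ∀ c ∈ V, ∀ g ∈ kernelBundle (ContinuousLinearMap.adjoint (Sz θ)) (conj c),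
      ⟪g, f⟫_ℂ = 0) : f = 0 := by
  have hfk := (mem_kernelBundle_iff f).1 hf
  by_contra hf0
  have hf0' : (f : H2) ≠ 0 := fun h => hf0 (Subtype.ext h)
  have hd := norm_lt_one_of_adjoint_Mz_eq hfk hf0'
  have hslice : ∃ w ∈ ball (0 : ℂ) 1, (f : H2).toFun (0, w) ≠ 0 := by
    by_contra! hcon
    refine hf0' (H2.ext_toFun fun x hx => ?_)
    have h1 := one_sub_mul_toFun hfk hx
    rw [hcon _ hx.2] at h1
    rw [H2.toFun_zero]
    refine (mul_eq_zero.1 h1).resolve_left fun h2 => ?_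
    have h3 : ‖d * x.1‖ = 1 := by rw [← sub_eq_zero.1 h2, norm_one]
    rw [norm_mul] at h3
    nlinarith [mem_ball_zero_iff.1 hx.1, norm_nonneg d, norm_nonneg x.1]
  have hcount := countable_zeros ((f : H2).sepHolo.right 0 (mem_ball_self one_pos)) isOpen_ball
    (convex_ball _ _).isPreconnected hslice
  -- At a good `z`, `f (z, ·)` is divisible by `θ (z, ·)` and inherits its zero `w`; since `f` is `f
  -- (0, w)` over `1 - d z`, also `f (0, w) = 0`. Countably many `w` are possible, and each allows
  -- finitely many `z`.
  have hcov : V ∩ (badSet q)ᶜ ⊆ ⋃ w ∈ {w ∈ ball (0 : ℂ) 1 | (f : H2).toFun (0, w) = 0},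
      {z | (q.eval (C w)).IsRoot z} := by
    rintro z ⟨hzV, hzq⟩
    have hz1 := hV1 z hzV
    obtain ⟨w, hw, hw0⟩ := exists_slice_zero hθ hz1 hzq (hker z hzV)
    have hx : (z, w) ∈ bidisk := ⟨mem_ball_zero_iff.2 hz1, hw⟩
    obtain ⟨o⟩ := exists_sliceOps hθ.isInner hz1
    obtain ⟨g, hg⟩ := exists_mulSlice_eq_ev hθ hz1 hzq o (horth z hzV)
    have h1 := o.toFun_ev (f : H2) (z, w) hx
    rw [← hg, o.toFun_mulSlice g (z, w) hx, hw0, zero_mul] at h1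
    have h2 := one_sub_mul_toFun hfk hx
    rw [← h1, mul_zero] at h2
    refine Set.mem_iUnion₂.2 ⟨w, ⟨hw, h2.symm⟩, ?_⟩
    have h3 := hθ.eq_div (z, w) hx
    rw [hw0, eq_comm, div_eq_zero_iff] at h3
    exact h3.2.resolve_right h3.1
  have hVc : (V ∩ (badSet q)ᶜ).Countable := by
    refine (hcount.biUnion fun w hw => Set.Finite.countable ?_).mono hcov
    exact Polynomial.finite_setOfPred_isRoot (hθ.eval_C_ne_zero w (mem_ball_zero_iff.1 hw.1).le)
  have hdense := dense_compl_badSet fun w hw => hθ.eval_C_ne_zero w hw.le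
  obtain ⟨z, hz⟩ := hdense.inter_open_nonempty V hV hVne
  obtain ⟨z', hz', hz''⟩ := (hVc.dense_compl ℝ).inter_open_nonempty _
    (hV.inter (isClosed_badSet q).isOpen_compl) ⟨z, hz⟩
  exact hz'' hz'

theorem IsRegularQuotient.cowenDouglas_and_isReducible_Sz_iff (hθ : IsRegularQuotient θ p q) :
    IsGeneralizedCowenDouglas (baseSet θ) (ContinuousLinearMap.adjoint (Sz θ)) ∧
      (IsReducible (Sz θ) ↔
        KernelBundleStrictlyReducible (baseSet θ) (ContinuousLinearMap.adjoint (Sz θ))) := by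
  have hinj := injective_Sz_sub hθ
  have hfin := finiteDimensional_kernelBundle hθ
  have hmem : ∀ c, c ∈ baseSet θ ↔ _ := mem_conj_image_iff hinj hfin
  have hnorm : ∀ c ∈ baseSet θ, ‖c‖ < 1 := by
    intro c hc
    obtain ⟨u, hu, hu0⟩ := (Submodule.ne_bot_iff _).1 ((hmem c).1 hc).2
    exact norm_lt_one_of_adjoint_Mz_eq ((mem_kernelBundle_iff u).1 hu)
      fun h => hu0 (Subtype.ext h)
  have hspan : (⨆ c ∈ baseSet θ,
      kernelBundle (ContinuousLinearMap.adjoint (Sz θ)) c).topologicalClosure = ⊤ := by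
    rw [Submodule.topologicalClosure_eq_top_iff, eq_bot_iff]
    intro f hf
    refine eq_zero_of_forall_inner_kernelBundle hθ fun c hc hcq g hg => ?_
    -- A good point outside the base has zero fibre and imposes no condition, so orthogonality over
    -- the base suffices.
    by_cases hbot : kernelBundle (ContinuousLinearMap.adjoint (Sz θ)) (conj c) = ⊥
    · rw [hbot, Submodule.mem_bot] at hg
      rw [hg, inner_zero_left]
    · have hcΩ : conj c ∈ baseSet θ :=
        (hmem _).2 ⟨surjective_adjoint_Sz_sub hθ hc hcq, hbot⟩
      exact hf g (Submodule.mem_iSup_of_mem _ (Submodule.mem_iSup_of_mem hcΩ hg))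
  have hopen : IsOpen (baseSet θ) :=
    (isGeneralizedCowenDouglas_of_mem_iff hmem
      (isBounded_ball.subset fun c hc => mem_ball_zero_iff.2 (hnorm c hc)) hfin hspan).isOpen
  refine cowenDouglas_and_isReducible_iff hinj hfin rfl hspan fun c₀ hc₀ d _ f hf horth => ?_
  have hsub := connectedComponentIn_subset (baseSet θ) c₀
  refine eq_zero_of_inner_eq_zero_on_open hθ
    (V := (fun c => conj c) ⁻¹' connectedComponentIn (baseSet θ) c₀)
    (hopen.connectedComponentIn.preimage continuous_conj)
    ⟨conj c₀, ?_⟩ (fun c hc => ?_) (fun c hc => ((hmem _).1 (hsub hc)).2) hf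
    fun c hc => horth _ hc
  · change conj (conj c₀) ∈ connectedComponentIn (baseSet θ) c₀
    rw [conj_conj]
    exact mem_connectedComponentIn hc₀
  · rw [← norm_conj]
    exact hnorm _ (hsub hc)

/-- Cancelling common factors in the factorial ring of bivariate polynomials preserves the quotient
on the bidisk and supplies the coprimality needed for slices over `|w| = 1`. -/
theorem exists_isRegularQuotient (hθ : IsRationalInner θ)
    (hfactor : ¬ HasUnivariateInnerFactor θ) : ∃ p q, IsRegularQuotient θ p q := by
  obtain ⟨hin, p, q, hpq⟩ := hθ
  have hp0 : p ≠ 0 := by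
    rintro rfl
    exact (hpq (0, 0) ⟨mem_ball_self one_pos, mem_ball_self one_pos⟩).1 (evalEval_zero _ _)
  obtain ⟨p', q', r, hrel, hp, hq⟩ := UniqueFactorizationMonoid.exists_reduced_factors p hp0 q
  have hpq' : ∀ x ∈ bidisk, p'.evalEval x.1 x.2 ≠ 0 ∧
      θ x = q'.evalEval x.1 x.2 / p'.evalEval x.1 x.2 := by
    intro x hx
    have h := hpq x hx
    rw [← hp, ← hq, evalEval_mul, evalEval_mul] at h
    have hr := left_ne_zero_of_mul h.1
    exact ⟨right_ne_zero_of_mul h.1, by rw [h.2, mul_div_mul_left _ _ hr]⟩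
  refine ⟨p', q', hin, hpq', fun c hc => map_evalRingHom_ne_zero hin hfactor hpq' hc,
    fun w hw => ?_⟩
  rcases hw.lt_or_eq with hw | hw
  · exact eval_C_ne_zero_of_norm_lt hin hfactor hpq' hw
  · exact eval_C_ne_zero_of_norm_eq_one hin hrel hpq' hw

end Kernels

end Bidisk
end

theorem mainTheorem2 (θ : ℂ × ℂ → ℂ) (hθ : Bidisk.IsRationalInner θ)
    (hfactor : ¬ Bidisk.HasUnivariateInnerFactor θ) :
    Bidisk.IsGeneralizedCowenDouglas (Bidisk.baseSet θ)
        (ContinuousLinearMap.adjoint (Bidisk.Sz θ)) ∧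
      (Bidisk.IsReducible (Bidisk.Sz θ) ↔
        Bidisk.KernelBundleStrictlyReducible (Bidisk.baseSet θ)
          (ContinuousLinearMap.adjoint (Bidisk.Sz θ))) := by
  obtain ⟨p, q, h⟩ := Bidisk.exists_isRegularQuotient hθ hfactor
  exact h.cowenDouglas_and_isReducible_Sz_iff
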